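/- **Setting.** Let $\mathcal A=\{1,\dots,m\}$ and let ${\bf a}=(\zeta_j)_{j\ge1}$ be a sequence of substitutions $\zeta_j:\mathcal A\to\mathcal A^+$ such that, for each $j$, all letters appear in the words $\zeta_j(b)$, $b\in\mathcal A$, and $|\zeta_j(b)|>1$ for some $b$. Put $\zeta^{[n]}=\zeta_1\circ\cdots\circ\zeta_n$, let ${\sf S}_\zeta(i,j)$ be the number of symbols $i$ in $\zeta(j)$, ${\sf S}_n={\sf S}_{\zeta_n}$, ${\sf S}^{[n]}={\sf S}_{\zeta^{[n]}}$, and $\sigma^\ell{\bf a}=(\zeta_{\ell+j})_{j\ge1}$. Let $X_{\bf a}\subset\mathcal A^{\mathbb Z}$ be the set of two-sided sequences all of whose subwords occur in some $\zeta^{[n]}(b)$, $n\ge1$, $b\in\mathcal A$, with the left shift $T$. Fix $\ell\in\mathbb N$ and $\lambda_{\bf a}\in\mathbb R$, and assume: * **(A1′)** there is a finite word ${\bf q}$ of substitutions, whose product ${\sf S}_{\bf q}$ of substitution matrices is strictly positive, such that for every $\varepsilon>0$ and all $n\ge n_0(\varepsilon)$ the word ${\bf q}$ is a subword of $\zeta_{\lfloor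 n(1-\varepsilon)\rfloor+1},\dots,\zeta_n$; * **(A2-ℓ)** $\lim_{n\to\infty}\frac1n\log\|{\sf S}_{\ell+1}\cdots{\sf S}_{\ell+n}\|=\lambda_{\bf a}$; * **(A3)** $\lim_{n\to\infty}\frac1n\log(1+\|{\sf S}_n\|)=0$; * $(X_{\bf a},T)$ has no periodic points, and ${\bf a}$ is recognizable: for all $n\ge1$ and $x\in X_{\bf a}$ the representation $x=T^k(\zeta^{[n]}(x'))$ with $x'\in X_{\sigma^n{\bf a}}$, $0\le k<|\zeta^{[n]}(x'_0)|$, is unique. Let $\mu$ be the $T$-invariant Borel probability measure on $X_{\bf a}$, let $\vec s\in\mathbb R^m$ have positive coordinates, and let $h_t$ be the suspension flow over $(X_{\bf a},T)$ with roof function $x\mapsto s_{x_0}$, on $\mathfrak X=\{(x,t):x\in X_{\bf a},\,0\le t<s_{x_0}\}$ with the invariant measure $\widetilde\mu$ that is the restriction of $\mu\times$Lebesgue. Put $\vec s^{\,(\ell)}=({\sf S}^{[\ell]})^t\vec s$. Let $f$ be a Lip-cylindrical function of level $\ell$: there are Lipschitz functions $\psi^{(\ell)}_b:[0,s^{(\ell)}_b]\to\mathbb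 C$ such that $f\bigl(h_t(\zeta^{[\ell]}(y),0)\bigr)=\psi^{(\ell)}_{y_0}(t)$ for $y\in X_{\sigma^\ell{\bf a}}$ and $0\le t<s^{(\ell)}_{y_0}$. Let $\sigma_f$ be its spectral measure, i.e. the finite positive Borel measure on $\mathbb R$ with $\int e^{2\pi i\tau t}\,d\sigma_f(\tau)=\langle f\circ h_t,f\rangle_{L^2(\widetilde\mu)}$ for all $t\in\mathbb R$, and let $$\underline d(\sigma_f,\omega)=\liminf_{r\to0+}\frac{\log\sigma_f(B_r(\omega))}{\log r}\in[0,+\infty].$$ For a substitution $\zeta$ with $\zeta(b)=u^b_1\cdots u^b_{|\zeta(b)|}$ and $\xi\in\mathbb R^m$ let $\mathscr M_\zeta(\xi)$ be the complex $m\times m$ matrix with entries $$\mathscr M_\zeta(\xi)_{b,c}=\sum_{j:\,u^b_j=c}\exp\Bigl(-2\pi i\sum_{k=1}^{j-1}\xi_{u^b_k}\Bigr),$$ which depends only on $\xi$ mod $\mathbb Z^m$. For a sequence ${\bf b}=(\eta_j)_{j\ge1}$ of substitutions let $$\mathscr M_{\bf b}(\xi,n)=\mathscr M_{\eta_n}\bigl({\sf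 S}^t_{\eta_1\circ\cdots\circ\eta_{n-1}}\xi\bigr)\cdots\mathscr M_{\eta_2}({\sf S}^t_{\eta_1}\xi)\,\mathscr M_{\eta_1}(\xi),\qquad \chi^+_{{\bf b},\xi,\vec z}=\limsup_{n\to\infty}\frac1n\log\|\mathscr M_{\bf b}(\xi,n)\vec z\|\in[-\infty,+\infty].$$ **Theorem.** Under these assumptions, let $\omega\in\mathbb R$, $\xi=\omega\vec s^{\,(\ell)}$ (mod $\mathbb Z^m$), and $$\vec z=\bigl(\widehat\psi^{(\ell)}_b(\omega)\bigr)_{b\in\mathcal A},\qquad \widehat\psi^{(\ell)}_b(\omega)=\int_0^{s^{(\ell)}_b}e^{-2\pi i\omega t}\psi^{(\ell)}_b(t)\,dt .$$ Let $\chi^+=\chi^+_{\sigma^\ell{\bf a},\xi,\vec z}$ be the upper Lyapunov exponent of the cocycle over the shifted sequence $\sigma^\ell{\bf a}$. If $\chi^+>0$, then $$\underline d(\sigma_f,\omega)=2-\frac{2\chi^+}{\lambda_{\bf a}}.$$ If $\chi^+\le0$ and $\lambda_{\bf a}>0$, then $\underline d(\sigma_f,\omega)\ge2$. -/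

import Mathlib

open MeasureTheory Filter Topology Matrix

noncomputable section

namespace SAdic

/-! ### Substitutions -/

/-- A substitution on the alphabet `{1, …, m}` (modelled by `Fin m`): a map from letters to
non-empty words. -/
structure Substitution (m : ℕ) where
  word : Fin m → List (Fin m)
  word_ne_nil : ∀ b, word b ≠ []

namespace Substitution

variable {m : ℕ}

/-- All letters appear in the words `ζ(b)`, and some word `ζ(b)` has length greater than one. -/
def IsAdmissible (ζ : Substitution m) : Prop :=
  (∀ c, ∃ b, c ∈ ζ.word b) ∧ ∃ b, 1 < (ζ.word b).length

/-- The identity substitution `b ↦ b`. -/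
def one : Substitution m where
  word b := [b]
  word_ne_nil b := List.cons_ne_nil b []

/-- The composition `ζ ∘ η`, where `ζ` acts on words by concatenation. -/
def comp (ζ η : Substitution m) : Substitution m where
  word b := (η.word b).flatMap ζ.word
  word_ne_nil b := by
    obtain ⟨c, hc⟩ := List.exists_mem_of_ne_nil _ (η.word_ne_nil b)
    intro h
    exact ζ.word_ne_nil c (List.flatMap_eq_nil_iff.mp h c hc)

/-- The substitution matrix: `S(i, j)` is the number of symbols `i` in the word `ζ(j)`. -/
def matrix (ζ : Substitution m) : Matrix (Fin m) (Fin m) ℕ :=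
  Matrix.of fun i j => (ζ.word j).count i

/-- The vector `Sᵗ v`, where `S` is the substitution matrix. -/
def transposeMul (ζ : Substitution m) (v : Fin m → ℝ) : Fin m → ℝ :=
  (ζ.matrix.map (fun k : ℕ => (k : ℝ)))ᵀ *ᵥ v

end Substitution

/-- The matrix 1-norm (maximal column sum) of a matrix with entries in `ℕ`. -/
def norm1 {m : ℕ} (S : Matrix (Fin m) (Fin m) ℕ) : ℕ :=
  Finset.univ.sup fun j => ∑ i, S i j

/-! ### Partial sums along a two-sided sequence -/

section Cumul

variable {m : ℕ} {R : Type*} [AddCommGroup R]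

/-- The two-sided partial sums of `r (x i)`: for `n ≥ 0` this is `r (x 0) + ⋯ + r (x (n-1))`, and
for `n < 0` it is `-(r (x n) + ⋯ + r (x (-1)))`. -/
def cumul (r : Fin m → R) (x : ℤ → Fin m) (n : ℤ) : R :=
  ∑ i ∈ Finset.Ico 0 n, r (x i) - ∑ i ∈ Finset.Ico n 0, r (x i)

/-- The index `n` with `cumul r x n ≤ τ < cumul r x (n + 1)` (for positive `r`). -/
def locate [LinearOrder R] (r : Fin m → R) (x : ℤ → Fin m) (τ : R) : ℤ :=
  sSup {n : ℤ | cumul r x n ≤ τ}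

theorem cumul_zero (r : Fin m → R) (x : ℤ → Fin m) : cumul r x 0 = 0 := by
  simp [cumul]

theorem cumul_succ (r : Fin m → R) (x : ℤ → Fin m) (n : ℤ) :
    cumul r x (n + 1) = cumul r x n + r (x n) := by
  unfold cumul
  rcases le_or_gt 0 n with hn | hn
  · have h1 : Finset.Ico (0 : ℤ) (n + 1) = insert n (Finset.Ico 0 n) := by
      ext i; simp only [Finset.mem_Ico, Finset.mem_insert]; omega
    rw [h1, Finset.sum_insert (by simp), Finset.Ico_eq_empty (by omega : ¬ n + 1 < 0),
      Finset.Ico_eq_empty (by omega : ¬ n < 0)]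
    simp [add_comm]
  · have h1 : Finset.Ico n (0 : ℤ) = insert n (Finset.Ico (n + 1) 0) := by
      ext i; simp only [Finset.mem_Ico, Finset.mem_insert]; omega
    rw [h1, Finset.sum_insert (by simp), Finset.Ico_eq_empty (by omega : ¬ (0 : ℤ) < n + 1),
      Finset.Ico_eq_empty (by omega : ¬ (0 : ℤ) < n)]
    simp

theorem locate_eq [LinearOrder R] [IsOrderedAddMonoid R] {r : Fin m → R} (hr : ∀ j, 0 < r j)
    (x : ℤ → Fin m) {τ : R} {n : ℤ} (h1 : cumul r x n ≤ τ) (h2 : τ < cumul r x (n + 1)) :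
    locate r x τ = n := by
  have hmono : StrictMono (cumul r x) := strictMono_int_of_lt_succ fun k => by
    rw [cumul_succ]; exact lt_add_of_pos_right _ (hr _)
  refine IsGreatest.csSup_eq ⟨h1, fun k hk => ?_⟩
  have : k < n + 1 := hmono.lt_iff_lt.mp (lt_of_le_of_lt hk h2)
  omega

theorem locate_spec [LinearOrder R] [IsOrderedAddMonoid R] [Archimedean R] {r : Fin m → R}
    (hr : ∀ j, 0 < r j) (x : ℤ → Fin m) (τ : R) :
    cumul r x (locate r x τ) ≤ τ ∧ τ < cumul r x (locate r x τ + 1) := by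
  have hne : (Finset.univ : Finset (Fin m)).Nonempty := ⟨x 0, Finset.mem_univ _⟩
  obtain ⟨j, -, hj⟩ := Finset.exists_min_image Finset.univ r hne
  have hup : ∀ k : ℕ, k • r j ≤ cumul r x k := by
    intro k
    induction k with
    | zero => simp [cumul_zero]
    | succ k ih =>
      push_cast
      rw [cumul_succ, succ_nsmul]
      exact add_le_add ih (hj _ (Finset.mem_univ _))
  have hdown : ∀ k : ℕ, cumul r x (-k) ≤ -(k • r j) := by
    intro k
    induction k with
    | zero => simp [cumul_zero]
    | succ k ih =>
      have h := cumul_succ r x (-((k + 1 : ℕ) : ℤ))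
      have h' : (-((k + 1 : ℕ) : ℤ) + 1) = -(k : ℤ) := by push_cast; ring
      rw [h'] at h
      rw [eq_sub_of_add_eq h.symm, succ_nsmul, neg_add, sub_eq_add_neg]
      exact add_le_add ih (neg_le_neg (hj _ (Finset.mem_univ _)))
  have hmono : StrictMono (cumul r x) := strictMono_int_of_lt_succ fun k => by
    rw [cumul_succ]; exact lt_add_of_pos_right _ (hr _)
  obtain ⟨k, hk⟩ := Archimedean.arch τ (hr j)
  obtain ⟨l, hl⟩ := Archimedean.arch (-τ) (hr j)
  have hbdd : BddAbove {n : ℤ | cumul r x n ≤ τ} :=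
    ⟨k, fun n hn => hmono.le_iff_le.mp (le_trans hn (hk.trans (hup k)))⟩
  have hnon : {n : ℤ | cumul r x n ≤ τ}.Nonempty :=
    ⟨-l, (hdown l).trans (by simpa using neg_le_neg hl)⟩
  refine ⟨Int.csSup_mem hnon hbdd, ?_⟩
  by_contra hcon
  have := le_csSup hbdd (show (locate r x τ + 1) ∈ {n : ℤ | cumul r x n ≤ τ} from not_lt.mp hcon)
  change locate r x τ + 1 ≤ locate r x τ at this
  omega

end Cumul

/-! ### `S`-adic shifts -/

section Shift

variable {m : ℕ}

/-- The length of `ζ(b)`, as an integer. -/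
def Substitution.len (ζ : Substitution m) (b : Fin m) : ℤ := ((ζ.word b).length : ℤ)

/-- The action of a substitution on two-sided sequences:
`ζ(… x₋₁ . x₀ x₁ …) = … ζ(x₋₁) . ζ(x₀) ζ(x₁) …`. The letter in position `j` lies in the block
`ζ(xₙ)`, which occupies the positions from `cumul ζ.len x n` to `cumul ζ.len x (n + 1) - 1`. -/
def Substitution.onSeq (ζ : Substitution m) (x : ℤ → Fin m) : ℤ → Fin m := fun j =>
  let n := locate ζ.len x j
  (ζ.word (x n)).getD (j - cumul ζ.len x n).toNat (x n)

/-- The `n`-th power of the left shift. -/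
def shiftBy (n : ℤ) (x : ℤ → Fin m) : ℤ → Fin m := fun j => x (j + n)

/-- A sequence of substitutions `ζ₁, ζ₂, …` is given as `a : ℕ → Substitution m` with
`a j = ζ_{j+1}`. This is `ζ^{[n]} = ζ₁ ∘ ⋯ ∘ ζₙ`. -/
def iter (a : ℕ → Substitution m) : ℕ → Substitution m
  | 0 => Substitution.one
  | n + 1 => (iter a n).comp (a n)

/-- The shifted sequence of substitutions `ζ_{ℓ+1}, ζ_{ℓ+2}, …`. -/
def tailSeq (a : ℕ → Substitution m) (l : ℕ) : ℕ → Substitution m := fun j => a (l + j)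

/-- The matrix product `S_{1} ⋯ S_{n}` of the substitution matrices of `ζ₁, …, ζₙ`. -/
def matProd (a : ℕ → Substitution m) : ℕ → Matrix (Fin m) (Fin m) ℕ
  | 0 => 1
  | n + 1 => matProd a n * (a n).matrix

/-- The space of all two-sided sequences each of whose subwords is a subword of `ζ^{[n]}(b)` for
some `b` and some `n ≥ 1`. -/
def space (a : ℕ → Substitution m) : Set (ℤ → Fin m) :=
  {x | ∀ (i : ℤ) (k : ℕ), ∃ (b : Fin m) (n : ℕ), 1 ≤ n ∧
    (List.ofFn fun j : Fin k => x (i + (j : ℕ))) <:+: (iter a n).word b}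

/-- The shift on the `S`-adic space has no periodic points. -/
def Aperiodic (a : ℕ → Substitution m) : Prop :=
  ∀ x ∈ space a, ∀ n : ℕ, 1 ≤ n → shiftBy n x ≠ x

/-- Recognizability: for every `n ≥ 1`, the representation of a point `x` of the `S`-adic space as
`x = T^k (ζ^{[n]}(y))` with `y` in the space of `ζ_{n+1}, ζ_{n+2}, …` and
`0 ≤ k < |ζ^{[n]}(y₀)|` is unique. -/
def Recognizable (a : ℕ → Substitution m) : Prop :=
  ∀ n : ℕ, 1 ≤ n → ∀ x ∈ space a,
    ∀ y ∈ space (tailSeq a n), ∀ y' ∈ space (tailSeq a n), ∀ k k' : ℕ,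
      k < ((iter a n).word (y 0)).length → k' < ((iter a n).word (y' 0)).length →
      x = shiftBy k ((iter a n).onSeq y) → x = shiftBy k' ((iter a n).onSeq y') →
      y = y' ∧ k = k'

/-- There is a word `q` of substitutions with strictly positive matrix `S_q` such that for every
`ε > 0` and all large `n`, the word `q` is a subword of `ζ_{⌊n(1-ε)⌋+1}, …, ζ_n`. -/
def RegularPositiveWord (a : ℕ → Substitution m) : Prop :=
  ∃ q : List (Substitution m), q ≠ [] ∧
    (∀ i j, 0 < (q.map Substitution.matrix).prod i j) ∧
    ∀ ε : ℝ, 0 < ε → ∃ n₀ : ℕ, ∀ n : ℕ, n₀ ≤ n →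
      ∃ k : ℕ, ⌊(n : ℝ) * (1 - ε)⌋ ≤ (k : ℤ) ∧ k + q.length ≤ n ∧
        (List.ofFn fun j : Fin q.length => a (k + j)) = q

/-- The exponential growth rate of `‖S_{ℓ+1} ⋯ S_{ℓ+n}‖` exists and equals `lam`. -/
def HasGrowthRate (a : ℕ → Substitution m) (l : ℕ) (lam : ℝ) : Prop :=
  Tendsto (fun n : ℕ => (1 / (n : ℝ)) * Real.log (norm1 (matProd (tailSeq a l) n) : ℝ))
    atTop (𝓝 lam)

/-- `(1/n) log (1 + ‖S_n‖) → 0`. -/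
def SubexponentialMatrices (a : ℕ → Substitution m) : Prop :=
  Tendsto (fun n : ℕ => (1 / ((n : ℝ) + 1)) * Real.log (1 + (norm1 (a n).matrix : ℝ)))
    atTop (𝓝 0)

/-- `μ` is a shift-invariant Borel probability measure carried by the `S`-adic space. -/
structure IsInvariantProb (a : ℕ → Substitution m) (μ : Measure (ℤ → Fin m)) : Prop where
  prob : IsProbabilityMeasure μ
  carried : μ (space a)ᶜ = 0
  invariant : MeasurePreserving (shiftBy 1) μ μ

end Shift

/-! ### The suspension flow, cylindrical functions and spectral measures -/

section Flow

variable {m : ℕ}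

/-- The suspension flow with the piecewise constant roof function `x ↦ s (x 0)`. Points of the
suspension are pairs `(x, u)` with `0 ≤ u < s (x 0)`; the flow moves up at unit speed and
identifies `(x, s (x 0))` with `(T x, 0)`. -/
def flow (s : Fin m → ℝ) (t : ℝ) (p : (ℤ → Fin m) × ℝ) : (ℤ → Fin m) × ℝ :=
  let n := locate s p.1 (p.2 + t)
  (shiftBy n p.1, p.2 + t - cumul s p.1 n)

/-- The invariant measure of the suspension flow: `μ × Lebesgue`, restricted to the region under
the graph of the roof function. -/
def suspMeasure (s : Fin m → ℝ) (μ : Measure (ℤ → Fin m)) : Measure ((ℤ → Fin m) × ℝ) :=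
  (μ.prod volume).restrict {p | 0 ≤ p.2 ∧ p.2 < s (p.1 0)}

/-- The roof vector of level `ℓ`: `s^{(ℓ)} = (S^{[ℓ]})ᵗ s`. -/
def levelRoof (a : ℕ → Substitution m) (s : Fin m → ℝ) (l : ℕ) : Fin m → ℝ :=
  (iter a l).transposeMul s

/-- `f` is the Lip-cylindrical function of level `ℓ` with components `ψ_b ∈ Lip[0, s_b^{(ℓ)}]`: for
`x = ζ^{[ℓ]}(y)` with `y₀ = b` and `0 ≤ t < s_b^{(ℓ)}`, the value of `f` at the point at height `t`
above `x`, that is at `h_t (x, 0)`, is `ψ_b(t)`. -/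
structure IsLipCylindrical (a : ℕ → Substitution m) (s : Fin m → ℝ) (l : ℕ)
    (ψ : Fin m → ℝ → ℂ) (f : (ℤ → Fin m) × ℝ → ℂ) : Prop where
  lipschitz : ∀ b, ∃ K, LipschitzOnWith K (ψ b) (Set.Icc 0 (levelRoof a s l b))
  value : ∀ y ∈ space (tailSeq a l), ∀ t ∈ Set.Ico 0 (levelRoof a s l (y 0)),
    f (flow s t ((iter a l).onSeq y, 0)) = ψ (y 0) t

/-- `σ` is the spectral measure of `f` for the suspension flow: the finite positive Borel measure
on `ℝ` with `∫ e^{2πiτt} dσ(τ) = ⟨f ∘ h_t, f⟩` for all real `t`. -/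
structure IsSpectralMeasure (s : Fin m → ℝ) (μ : Measure (ℤ → Fin m))
    (f : (ℤ → Fin m) × ℝ → ℂ) (σ : Measure ℝ) : Prop where
  finite : IsFiniteMeasure σ
  fourier : ∀ t : ℝ,
    ∫ τ, Complex.exp (2 * Real.pi * Complex.I * τ * t) ∂σ =
      ∫ p, f (flow s t p) * (starRingEnd ℂ) (f p) ∂(suspMeasure s μ)

end Flow

/-- The lower local dimension `liminf_{r → 0+} log ν(B_r(ω)) / log r`, in the extended reals
(with `log 0 = -∞`, so that it is `+∞` outside the support). -/
def lowerLocalDim (ν : Measure ℝ) (w : ℝ) : EReal :=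
  liminf (fun r : ℝ => ENNReal.log (ν (Metric.ball w r)) / ((Real.log r : ℝ) : EReal)) (𝓝[>] 0)

/-! ### The spectral cocycle -/

section Cocycle

variable {m : ℕ}

/-- The matrix `M_ζ(ξ)`: if `ζ(b) = u₁ … u_k`, the `(b, c)` entry is the sum of
`exp (-2πi (ξ_{u₁} + ⋯ + ξ_{u_{j-1}}))` over all `j` with `u_j = c`. -/
def Substitution.spectralMatrix (ζ : Substitution m) (ξ : Fin m → ℝ) :
    Matrix (Fin m) (Fin m) ℂ :=
  Matrix.of fun b c => ∑ j : Fin (ζ.word b).length,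
    if (ζ.word b).get j = c then
      Complex.exp (-2 * Real.pi * Complex.I * (((((ζ.word b).take j).map ξ).sum : ℝ) : ℂ))
    else 0

/-- The spectral cocycle
`M_a(ξ, n) = M_{ζₙ}((S^{[n-1]})ᵗ ξ) ⋯ M_{ζ₂}(S₁ᵗ ξ) M_{ζ₁}(ξ)`. -/
def cocycle (a : ℕ → Substitution m) (ξ : Fin m → ℝ) : ℕ → Matrix (Fin m) (Fin m) ℂ
  | 0 => 1
  | n + 1 => (a n).spectralMatrix ((iter a n).transposeMul ξ) * cocycle a ξ n

/-- The pointwise upper Lyapunov exponent `limsup (1/n) log ‖M_a(ξ, n) z‖`, in the extended reals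
(with `log 0 = -∞`). -/
def upperLyapunov (a : ℕ → Substitution m) (ξ : Fin m → ℝ) (z : Fin m → ℂ) : EReal :=
  limsup (fun n : ℕ => ENNReal.log ‖cocycle a ξ n *ᵥ z‖ₑ / (n : EReal)) atTop

end Cocycle

end SAdic

end

open SAdic

/-!
The proof compares the mass `σ_f(B_r(ω))` with the twisted ergodic integrals
`S_R(p) = ∫₀ᴿ e^{-2πiωt} f(h_t p) dt` for `R` of order `1 / r`, and these with the spectral cocycle.

*Spectral side.* The identity `∫ |S_R|² dμ̃ = ∫ |D_R(ω - τ)|² dσ_f(τ)` with the kernel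
`D_R(x) = ∫₀ᴿ e^{-2πixt} dt` (`integral_norm_twist_sq`) turns a uniform bound `|S_R| ≤ D R^β` into
`σ_f(B_r(ω)) ≤ D' r^{2 - 2β}` (`measureReal_ball_le`). Conversely a bound
`σ_f(B_r(ω)) ≤ A r^{2 - 2α}` for all `r` makes the mean of `|S_R|` at most `K R^α`
(`integral_norm_twist_le`).

*Symbolic side.* Every orbit is tiled by the words `ζ_{l+1} ∘ ⋯ ∘ ζ_{l+n} (c)` of every level `n`
(`exists_desubstitution`, `CylValue.tiled`), along which `f` follows its components. The entries of
`𝓜(ξ, n) z` are the twisted integrals `Φ_n(c)` along these words (`cocycle_mulVec_eq_wordTotal`).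
The positive word makes all words of level `n` occur in each word of level slightly above `n`
(`eventually_infix`), so all the words of level `n` have length `e^{(λ + o(1)) n}` (`growth_upper`,
`growth_lower`), while a word of level `n + 1` consists of only `e^{o(n)}` words of level `n`
(`eventually_length_le`).

*Lower bound for the dimension.* If `|Φ_n| ≤ e^{κn}`, the same holds, up to a change of `κ`, for all
initial segments of words (`exists_wordInt_bound`); an interval of length `R ≈ e^{λn}` meets at most
two words of level `n`, hence `|S_R| ≤ D R^{κ/λ}` and `σ_f(B_r(ω)) ≤ D' r^{2 - 2κ/λ}`
(`eventually_measureReal_ball_le`).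

*Upper bound for the dimension.* The converse has to recover the pointwise quantities `Φ_n(c)` from
a bound `K R^α` for the mean of `|S_R|`. Any word of level `n` is read with bounded gaps of length
`e^{(λ + o(1)) n}` on every orbit, so averaging over time bounds the averaged increments
`∫ |I(u + R) - I(u)| du` of the twisted integral `I` along the word (`incrementBound_of_infix`).
Therefore the mean value of `I` over a word of level `n + 1` differs from its mean over the first
subword of level `n` by at most `e^{(αλ + o(1)) n}`, and similarly for the integrals up to the end
of the word and its last subword. Summing a geometric series bounds both means, and `Φ_n(c)` is
their sum (`eventually_wordTotal_le`), so that `χ⁺ ≤ αλ`. If the dimension exceeded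
`2 - 2χ⁺/λ`, the hypothesis would hold for some `0 < α < χ⁺/λ`, a contradiction. Here `λ > 0`,
because `χ⁺ ≤ λ` by the trivial bound for `Φ_n` by the length of the words.
-/

namespace SAdic

/-! ### Words and substitutions -/

namespace Substitution

variable {m : ℕ}

theorem ext_word {ζ η : Substitution m} (h : ∀ b, ζ.word b = η.word b) : ζ = η := by
  cases ζ; cases η; congr; exact funext h

theorem transposeMul_apply (ζ : Substitution m) (v : Fin m → ℝ) (b : Fin m) :
    ζ.transposeMul v b = ((ζ.word b).map v).sum := by
  have key : ∀ w : List (Fin m), ∑ i, ((w.count i : ℕ) : ℝ) * v i = (w.map v).sum := by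
    intro w
    induction w with
    | nil => simp
    | cons c w ih =>
      simp only [List.count_cons, List.map_cons, List.sum_cons, Nat.cast_add, add_mul,
        Finset.sum_add_distrib, ih]
      simp [add_comm]
  rw [← key]
  simp [transposeMul, matrix, Matrix.mulVec, dotProduct]

theorem transposeMul_pos (ζ : Substitution m) {v : Fin m → ℝ} (hv : ∀ b, 0 < v b) (b : Fin m) :
    0 < ζ.transposeMul v b := by
  rw [transposeMul_apply]
  refine List.sum_pos _ ?_ (by simpa using ζ.word_ne_nil b)
  simp only [List.mem_map]
  rintro _ ⟨c, -, rfl⟩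
  exact hv c

theorem matrix_comp (ζ η : Substitution m) : (ζ.comp η).matrix = ζ.matrix * η.matrix := by
  have key : ∀ (w : List (Fin m)) (i : Fin m),
      (w.flatMap ζ.word).count i = ∑ j, (ζ.word j).count i * w.count j := by
    intro w i
    induction w with
    | nil => simp
    | cons c w ih =>
      simp only [List.flatMap_cons, List.count_append, ih, List.count_cons, mul_add,
        Finset.sum_add_distrib]
      simp [add_comm]
  ext i j
  simp [matrix, comp, Matrix.mul_apply, key]

theorem matrix_one : (one : Substitution m).matrix = 1 := by
  ext i j
  by_cases h : i = j
  · subst h; simp [matrix, one]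
  · simp [matrix, one, h, Ne.symm h]

theorem comp_assoc (ζ η θ : Substitution m) : (ζ.comp η).comp θ = ζ.comp (η.comp θ) :=
  ext_word fun b => by simp [comp, List.flatMap_assoc]

theorem comp_one (ζ : Substitution m) : ζ.comp one = ζ :=
  ext_word fun b => by simp [comp, one]

theorem length_eq_sum_matrix (ζ : Substitution m) (b : Fin m) :
    (ζ.word b).length = ∑ i, ζ.matrix i b := by
  have key : ∀ w : List (Fin m), w.length = ∑ i, w.count i := by
    intro w
    induction w with
    | nil => simp
    | cons c w ih =>
      simp [List.count_cons, Finset.sum_add_distrib, ih]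
  exact key _

theorem length_le_norm1 (ζ : Substitution m) (b : Fin m) :
    (ζ.word b).length ≤ norm1 ζ.matrix := by
  rw [length_eq_sum_matrix]
  exact Finset.le_sup (f := fun j => ∑ i, ζ.matrix i j) (Finset.mem_univ b)

theorem mem_word_iff (ζ : Substitution m) (i b : Fin m) : i ∈ ζ.word b ↔ 0 < ζ.matrix i b := by
  simp [matrix, List.count_pos_iff]

end Substitution

variable {m : ℕ}

theorem matrix_iter (a : ℕ → Substitution m) (n : ℕ) : (iter a n).matrix = matProd a n := by
  induction n with
  | zero => exact Substitution.matrix_one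
  | succ n ih => simp [iter, matProd, Substitution.matrix_comp, ih]

theorem iter_add (a : ℕ → Substitution m) (n k : ℕ) :
    iter a (n + k) = (iter a n).comp (iter (tailSeq a n) k) := by
  induction k with
  | zero => simp [iter, Substitution.comp_one]
  | succ k ih =>
    rw [← add_assoc, iter, ih, Substitution.comp_assoc]
    rfl

theorem tailSeq_tailSeq (a : ℕ → Substitution m) (n k : ℕ) :
    tailSeq (tailSeq a n) k = tailSeq a (n + k) := by
  funext j; simp [tailSeq, add_assoc]

theorem infix_flatMap_of_mem {α β : Type*} {f : α → List β} {w : List α} {c : α} (hc : c ∈ w) :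
    f c <:+: w.flatMap f := by
  obtain ⟨u, v, rfl⟩ := List.append_of_mem hc
  exact ⟨u.flatMap f, v.flatMap f, by simp⟩

/-! ### The spectral cocycle along words -/

/-- The character `t ↦ e^{-2πiωt}`. -/
noncomputable def wave (ω t : ℝ) : ℂ := Complex.exp (-2 * Real.pi * Complex.I * ω * t)

theorem wave_add (ω t u : ℝ) : wave ω (t + u) = wave ω t * wave ω u := by
  rw [wave, wave, wave, ← Complex.exp_add]; push_cast; ring_nf

theorem wave_zero (ω : ℝ) : wave ω 0 = 1 := by simp [wave]

theorem norm_wave (ω t : ℝ) : ‖wave ω t‖ = 1 := by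
  have : -2 * (Real.pi : ℂ) * Complex.I * ω * t = ((-2 * Real.pi * ω * t : ℝ) : ℂ) * Complex.I := by
    push_cast; ring
  rw [wave, this, Complex.norm_exp_ofReal_mul_I]

theorem continuous_wave (ω : ℝ) : Continuous (wave ω) := by
  unfold wave; fun_prop

theorem exp_int_congr {x y : ℝ} (k : ℤ) (h : x = y + k) :
    Complex.exp (-2 * Real.pi * Complex.I * (x : ℂ)) =
      Complex.exp (-2 * Real.pi * Complex.I * (y : ℂ)) := by
  rw [Complex.exp_eq_exp_iff_exists_int]
  refine ⟨-k, ?_⟩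
  rw [h]; push_cast; ring

/-- The value at a vector `v` of the row of the spectral matrix attached to a word `w`. -/
noncomputable def wordSum (ω : ℝ) (ρ : Fin m → ℝ) (v : Fin m → ℂ) : List (Fin m) → ℂ
  | [] => 0
  | c :: w => v c + wave ω (ρ c) * wordSum ω ρ v w

theorem spectralMatrix_mulVec (ζ : Substitution m) (ω : ℝ) (ρ ξ : Fin m → ℝ)
    (h : ∀ b, ∃ k : ℤ, ξ b = ω * ρ b + k) (v : Fin m → ℂ) (b : Fin m) :
    (ζ.spectralMatrix ξ *ᵥ v) b = wordSum ω ρ v (ζ.word b) := by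
  have key : ∀ w : List (Fin m), ∑ j : Fin w.length,
      Complex.exp (-2 * Real.pi * Complex.I * ((((w.take j).map ξ).sum : ℝ) : ℂ)) * v (w.get j)
      = wordSum ω ρ v w := by
    intro w
    induction w with
    | nil => simp [wordSum]
    | cons c w ih =>
      have h0 : Complex.exp (-2 * Real.pi * Complex.I * (ξ c : ℂ)) = wave ω (ρ c) := by
        obtain ⟨k, hk⟩ := h c
        rw [exp_int_congr k hk, wave]; push_cast; ring_nf
      simp only [wordSum, ← ih, Finset.mul_sum]
      rw [show ∑ j : Fin (c :: w).length, Complex.exp (-2 * Real.pi * Complex.I *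
          (((((c :: w).take j).map ξ).sum : ℝ) : ℂ)) * v ((c :: w).get j) =
          ∑ j : Fin (w.length + 1), Complex.exp (-2 * Real.pi * Complex.I *
          (((((c :: w).take j).map ξ).sum : ℝ) : ℂ)) * v ((c :: w).get j) from rfl,
        Fin.sum_univ_succ]
      congr 1
      · simp
      · refine Finset.sum_congr rfl fun j _ => ?_
        simp only [Fin.val_succ, List.take_succ_cons, List.map_cons, List.sum_cons,
          List.get_cons_succ', ← mul_assoc]
        rw [← h0, ← Complex.exp_add]
        push_cast
        ring_nf
  rw [← key]
  simp only [Matrix.mulVec, dotProduct, Substitution.spectralMatrix, Matrix.of_apply,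
    Finset.sum_mul]
  rw [Finset.sum_comm]
  refine Finset.sum_congr rfl fun j _ => ?_
  simp [ite_mul]

theorem transposeMul_congr_int (ζ : Substitution m) (ω : ℝ) (ρ ξ : Fin m → ℝ)
    (h : ∀ b, ∃ k : ℤ, ξ b = ω * ρ b + k) (b : Fin m) :
    ∃ k : ℤ, ζ.transposeMul ξ b = ω * ζ.transposeMul ρ b + k := by
  simp only [Substitution.transposeMul_apply]
  induction ζ.word b with
  | nil => exact ⟨0, by simp⟩
  | cons c w ih =>
    obtain ⟨k, hk⟩ := ih
    obtain ⟨k', hk'⟩ := h c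
    refine ⟨k' + k, ?_⟩
    simp only [List.map_cons, List.sum_cons, hk, hk']
    push_cast; ring

theorem cocycle_succ_mulVec (b : ℕ → Substitution m) (ω : ℝ) (ρ ξ : Fin m → ℝ)
    (h : ∀ c, ∃ k : ℤ, ξ c = ω * ρ c + k) (z : Fin m → ℂ) (n : ℕ) (c : Fin m) :
    (cocycle b ξ (n + 1) *ᵥ z) c =
      wordSum ω ((iter b n).transposeMul ρ) (cocycle b ξ n *ᵥ z) ((b n).word c) := by
  rw [cocycle, ← Matrix.mulVec_mulVec]
  exact spectralMatrix_mulVec _ _ _ _ (transposeMul_congr_int _ _ _ _ h) _ _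

/-! ### Two-sided sequences, partial sums and substitutions -/

section Cumul

variable {R : Type*} [AddCommGroup R]

theorem shiftBy_zero (x : ℤ → Fin m) : shiftBy 0 x = x := by
  funext j; simp [shiftBy]

theorem shiftBy_shiftBy (n k : ℤ) (x : ℤ → Fin m) :
    shiftBy n (shiftBy k x) = shiftBy (n + k) x := by
  funext j; simp [shiftBy, add_assoc]

theorem int_eq_of_succ {f g : ℤ → R} (h0 : f 0 = g 0)
    (h : ∀ n, f (n + 1) - f n = g (n + 1) - g n) (n : ℤ) : f n = g n := by
  induction n using Int.induction_on with
  | zero => exact h0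
  | succ i ih =>
    have := h i
    rw [ih] at this
    exact sub_left_injective this
  | pred i ih =>
    have := h (-(i : ℤ) - 1)
    rw [sub_add_cancel, ih] at this
    exact sub_right_injective this

theorem cumul_shift (r : Fin m → R) (x : ℤ → Fin m) (n k : ℤ) :
    cumul r (shiftBy n x) k = cumul r x (n + k) - cumul r x n := by
  refine int_eq_of_succ (f := fun k => cumul r (shiftBy n x) k)
    (g := fun k => cumul r x (n + k) - cumul r x n) ?_ ?_ k
  · simp [cumul_zero]
  · intro k
    simp only [cumul_succ, ← add_assoc, shiftBy]
    rw [add_comm k n]; abel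

end Cumul

theorem cumul_strictMono {R : Type*} [AddCommGroup R] [LinearOrder R] [IsOrderedAddMonoid R]
    {r : Fin m → R} (hr : ∀ j, 0 < r j) (x : ℤ → Fin m) : StrictMono (cumul r x) :=
  strictMono_int_of_lt_succ fun k => by
    rw [cumul_succ]; exact lt_add_of_pos_right _ (hr _)

theorem locate_shift {R : Type*} [AddCommGroup R] [LinearOrder R] [IsOrderedAddMonoid R]
    [Archimedean R] {r : Fin m → R} (hr : ∀ j, 0 < r j) (x : ℤ → Fin m) (n : ℤ) (τ : R) :
    locate r (shiftBy n x) (τ - cumul r x n) = locate r x τ - n := by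
  obtain ⟨h1, h2⟩ := locate_spec hr x τ
  refine locate_eq hr _ ?_ ?_
  · rw [cumul_shift]
    simpa using h1
  · rw [cumul_shift]
    simpa [← add_assoc] using h2

namespace Substitution

theorem len_pos (ζ : Substitution m) (b : Fin m) : 0 < ζ.len b := by
  have := List.length_pos_iff.mpr (ζ.word_ne_nil b)
  simpa [len] using this

theorem onSeq_cumul_add (ζ : Substitution m) (y : ℤ → Fin m) (j : ℤ) (i : ℕ)
    (hi : i < (ζ.word (y j)).length) :
    ζ.onSeq y (cumul ζ.len y j + i) = (ζ.word (y j))[i] := by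
  have hl : locate ζ.len y (cumul ζ.len y j + i) = j := by
    refine locate_eq ζ.len_pos y (by omega) ?_
    rw [cumul_succ]
    simp only [len]
    omega
  unfold onSeq
  simp [hl, hi]

theorem onSeq_shift (ζ : Substitution m) (y : ℤ → Fin m) (n : ℤ) :
    ζ.onSeq (shiftBy n y) = shiftBy (cumul ζ.len y n) (ζ.onSeq y) := by
  funext j
  have hl := locate_shift ζ.len_pos y n (j + cumul ζ.len y n)
  rw [add_sub_cancel_right] at hl
  simp only [onSeq, shiftBy, hl, cumul_shift, sub_add_cancel, add_sub_cancel]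
  congr 2
  abel

end Substitution

/-- The subword `x_i x_{i+1} ⋯ x_{i+k-1}` of a two-sided sequence. -/
def seg (x : ℤ → Fin m) (i : ℤ) (k : ℕ) : List (Fin m) := List.ofFn fun j : Fin k => x (i + (j : ℕ))

theorem seg_length (x : ℤ → Fin m) (i : ℤ) (k : ℕ) : (seg x i k).length = k := by simp [seg]

theorem seg_getElem (x : ℤ → Fin m) (i : ℤ) (k j : ℕ) (h : j < (seg x i k).length) :
    (seg x i k)[j] = x (i + j) := by simp [seg]

theorem seg_eq_iff (x : ℤ → Fin m) (i : ℤ) (k : ℕ) (w : List (Fin m)) :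
    seg x i k = w ↔ w.length = k ∧ ∀ (j : ℕ) (h : j < w.length), x (i + j) = w[j] := by
  constructor
  · rintro rfl
    exact ⟨seg_length _ _ _, fun j h => (seg_getElem _ _ _ _ h).symm⟩
  · rintro ⟨rfl, h⟩
    exact List.ext_getElem (seg_length _ _ _) fun j h1 h2 => by rw [seg_getElem, h j h2]

theorem seg_congr {x y : ℤ → Fin m} {i i' : ℤ} {k : ℕ}
    (h : ∀ j : ℕ, j < k → x (i + j) = y (i' + j)) : seg x i k = seg y i' k := by
  unfold seg
  congr 1
  funext j
  exact h j j.2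

theorem seg_add (x : ℤ → Fin m) (i : ℤ) (k k' : ℕ) :
    seg x i (k + k') = seg x i k ++ seg x (i + k) k' := by
  rw [seg_eq_iff]
  refine ⟨by simp [seg_length], fun j h => ?_⟩
  rw [List.getElem_append]
  split_ifs with h1
  · rw [seg_getElem]
  · rw [seg_getElem, seg_length]
    rw [seg_length] at h1
    congr 1; omega

theorem seg_one (x : ℤ → Fin m) (i : ℤ) : seg x i 1 = [x i] := by simp [seg]

theorem seg_succ (x : ℤ → Fin m) (i : ℤ) (k : ℕ) : seg x i (k + 1) = seg x i k ++ [x (i + k)] := by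
  rw [seg_add, seg_one]

theorem seg_shift (x : ℤ → Fin m) (n i : ℤ) (k : ℕ) : seg (shiftBy n x) i k = seg x (n + i) k :=
  seg_congr fun j _ => by simp only [shiftBy]; congr 1; ring

theorem seg_infix (x : ℤ → Fin m) {i i' : ℤ} {k k' : ℕ} (h1 : i ≤ i') (h2 : i' + k' ≤ i + k) :
    seg x i' k' <:+: seg x i k := by
  obtain ⟨u, rfl⟩ := Int.exists_add_of_le h1
  obtain ⟨v, hv⟩ : ∃ v, k = u + (k' + v) := ⟨k - u - k', by omega⟩
  rw [hv, seg_add, seg_add]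
  exact ⟨seg x i u, _, List.append_assoc _ _ _⟩

theorem cumul_add_seg (s : Fin m → ℝ) (x : ℤ → Fin m) (i : ℤ) (k : ℕ) :
    cumul s x (i + k) = cumul s x i + ((seg x i k).map s).sum := by
  induction k with
  | zero => simp [seg]
  | succ k ih =>
    push_cast
    rw [← add_assoc, cumul_succ, ih, seg_succ]
    simp [add_assoc]

namespace Substitution

theorem seg_block (ζ : Substitution m) (y : ℤ → Fin m) (j : ℤ) :
    seg (ζ.onSeq y) (cumul ζ.len y j) (ζ.word (y j)).length = ζ.word (y j) := by
  rw [seg_eq_iff]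
  exact ⟨rfl, fun i h => ζ.onSeq_cumul_add y j i h⟩

theorem seg_flatMap (ζ : Substitution m) (y : ℤ → Fin m) (j : ℤ) (k : ℕ) :
    cumul ζ.len y (j + k) = cumul ζ.len y j + ((seg y j k).flatMap ζ.word).length ∧
    seg (ζ.onSeq y) (cumul ζ.len y j) ((seg y j k).flatMap ζ.word).length =
      (seg y j k).flatMap ζ.word := by
  induction k with
  | zero => simp [seg]
  | succ k ih =>
    obtain ⟨h1, h2⟩ := ih
    have h3 : (seg y j (k + 1)).flatMap ζ.word =
        (seg y j k).flatMap ζ.word ++ ζ.word (y (j + k)) := by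
      simp [seg_succ]
    rw [h3, List.length_append]
    constructor
    · push_cast
      rw [← add_assoc, cumul_succ, h1, add_assoc]
      rfl
    · rw [seg_add, h2, ← h1, seg_block]

/-- Partial sums along `ζ(y)` at the end points of the blocks are partial sums along `y` for the
transposed action of the substitution matrix. -/
theorem cumul_onSeq (ζ : Substitution m) (s : Fin m → ℝ) (y : ℤ → Fin m) (j : ℤ) :
    cumul s (ζ.onSeq y) (cumul ζ.len y j) = cumul (ζ.transposeMul s) y j := by
  refine int_eq_of_succ (f := fun j => cumul s (ζ.onSeq y) (cumul ζ.len y j))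
    (g := fun j => cumul (ζ.transposeMul s) y j) ?_ ?_ j
  · simp [cumul_zero]
  · intro j
    simp only [cumul_succ]
    have := cumul_add_seg s (ζ.onSeq y) (cumul ζ.len y j) (ζ.word (y j)).length
    rw [seg_block, ← transposeMul_apply] at this
    rw [show ζ.len (y j) = ((ζ.word (y j)).length : ℤ) from rfl, this]
    abel

end Substitution

/-! ### Continuity and desubstitution -/

theorem eventually_eq_coord (x : ℤ → Fin m) (F : Finset ℤ) :
    ∀ᶠ y in 𝓝 x, ∀ i ∈ F, y i = x i := by
  rw [Filter.eventually_all_finset]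
  intro i _
  have h : Tendsto (fun y : ℤ → Fin m => y i) (𝓝 x) (𝓝 (x i)) := (continuous_apply i).tendsto x
  rw [nhds_discrete (Fin m)] at h
  exact tendsto_pure.mp h

theorem cumul_congr {R : Type*} [AddCommGroup R] (r : Fin m → R) {x y : ℤ → Fin m} {n : ℤ}
    (h : ∀ i ∈ Finset.Ico 0 n ∪ Finset.Ico n 0, y i = x i) : cumul r y n = cumul r x n := by
  unfold cumul
  congr 1 <;> refine Finset.sum_congr rfl fun i hi => ?_
  · rw [h i (Finset.mem_union_left _ hi)]
  · rw [h i (Finset.mem_union_right _ hi)]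

theorem Substitution.eventually_onSeq_eq (ζ : Substitution m) (x : ℤ → Fin m) (j : ℤ) :
    ∀ᶠ y in 𝓝 x, ζ.onSeq y j = ζ.onSeq x j := by
  set n := locate ζ.len x j with hn
  filter_upwards [eventually_eq_coord x (Finset.Ico 0 n ∪ Finset.Ico n 0),
    eventually_eq_coord x (Finset.Ico 0 (n + 1) ∪ Finset.Ico (n + 1) 0),
    eventually_eq_coord x {n}] with y h1 h2 h3
  have h3' := h3 n (by simp)
  have e1 := cumul_congr ζ.len h1
  have e2 := cumul_congr ζ.len h2
  obtain ⟨s1, s2⟩ := locate_spec ζ.len_pos x j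
  have hl : locate ζ.len y j = n := locate_eq ζ.len_pos y (e1.trans_le s1) (s2.trans_eq e2.symm)
  simp only [Substitution.onSeq, hl, ← hn, h3', e1]

theorem Substitution.continuous_onSeq (ζ : Substitution m) : Continuous ζ.onSeq := by
  refine continuous_pi fun j => continuous_iff_continuousAt.mpr fun x => ?_
  rw [ContinuousAt, nhds_discrete (Fin m)]
  exact tendsto_pure.mpr (ζ.eventually_onSeq_eq x j)

theorem continuous_shiftBy (n : ℤ) : Continuous (shiftBy (m := m) n) :=
  continuous_pi fun j => continuous_apply (j + n)

theorem isClosed_space (a : ℕ → Substitution m) : IsClosed (space a) := by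
  have : space a = ⋂ (i : ℤ) (k : ℕ), (fun x : ℤ → Fin m => fun j : Fin k => x (i + (j : ℕ))) ⁻¹'
      {w | ∃ (b : Fin m) (n : ℕ), 1 ≤ n ∧ List.ofFn w <:+: (iter a n).word b} := by
    ext x; simp [space]
  rw [this]
  refine isClosed_iInter fun i => isClosed_iInter fun k => ?_
  exact (isClosed_discrete _).preimage (continuous_pi fun j => continuous_apply _)

theorem shiftBy_mem_space {a : ℕ → Substitution m} {x : ℤ → Fin m} (hx : x ∈ space a) (n : ℤ) :
    shiftBy n x ∈ space a := by
  intro i k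
  obtain ⟨b, N, h1, h2⟩ := hx (n + i) k
  refine ⟨b, N, h1, ?_⟩
  have := seg_shift x n i k
  unfold seg at this
  rwa [this]

theorem cumul_sub_le {r : Fin m → ℤ} {M : ℤ} (h1 : ∀ b, r b ≤ M) (x : ℤ → Fin m) (n : ℤ) (k : ℕ) :
    cumul r x (n + k) - cumul r x n ≤ M * k := by
  induction k with
  | zero => simp
  | succ k ih =>
    have := h1 (x (n + k))
    push_cast
    rw [← add_assoc, cumul_succ]
    linarith

/-- Every point of the `S`-adic space is, up to a shift inside a block, the image under `ζ^{[N]}`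
of a point of the space of the shifted sequence of substitutions. The preimage is a limit, along
an ultrafilter, of sequences that desubstitute longer and longer windows. -/
theorem exists_desubstitution (a : ℕ → Substitution m) (N : ℕ) {x : ℤ → Fin m} (hx : x ∈ space a) :
    ∃ y ∈ space (tailSeq a N), ∃ k : ℕ, k < ((iter a N).word (y 0)).length ∧
      x = shiftBy k ((iter a N).onSeq y) := by
  classical
  set ζ := iter a N with hζ
  obtain ⟨M, hM⟩ : ∃ M : ℕ, ∀ n ≤ N, ∀ b, ((iter a n).word b).length ≤ M := by
    refine ⟨∑ n ∈ Finset.range (N + 1), ∑ b, ((iter a n).word b).length, fun n hn b => ?_⟩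
    refine le_trans ?_ (Finset.single_le_sum
      (f := fun n => ∑ b, ((iter a n).word b).length) (fun _ _ => Nat.zero_le _)
      (Finset.mem_range.mpr (Nat.lt_succ_of_le hn)))
    exact Finset.single_le_sum (f := fun b => ((iter a n).word b).length)
      (fun _ _ => Nat.zero_le _) (Finset.mem_univ b)
  have hM1 : ∀ b, ζ.len b ≤ M := fun b => Nat.cast_le.mpr (hM N le_rfl b)
  have hM0 : 0 < M := lt_of_lt_of_le (List.length_pos_iff.mpr (ζ.word_ne_nil (x 0)))
    (hM N le_rfl (x 0))
  -- a desubstitution of the window `[-r, r]`, for `r ≥ M`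
  have hwin : ∀ r : ℕ, M ≤ r → ∃ (y : ℤ → Fin m) (k : ℕ), k < (ζ.word (y 0)).length ∧
      (∀ i : ℤ, -r ≤ i → i ≤ r → x i = ζ.onSeq y (i + k)) ∧
      ∀ (i : ℤ) (q : ℕ), (|i| + q + 1) * M ≤ r → ∃ (b : Fin m) (n : ℕ), 1 ≤ n ∧
        seg y i q <:+: (iter (tailSeq a N) n).word b := by
    intro r hr
    obtain ⟨b, n, hn1, hinf⟩ := hx (-r) (2 * r + 1)
    change seg x (-r) (2 * r + 1) <:+: _ at hinf
    have hnN : N < n := by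
      by_contra hcon
      have h1 := hinf.length_le
      rw [seg_length] at h1
      have := hM n (by omega) b
      omega
    obtain ⟨n', rfl⟩ : ∃ n', n = N + n' := ⟨n - N, by omega⟩
    rw [iter_add] at hinf
    set w := (iter (tailSeq a N) n').word b with hw
    change seg x (-r) (2 * r + 1) <:+: w.flatMap ζ.word at hinf
    set v : ℤ → Fin m := fun j => w.getD j.toNat (x 0) with hv
    have hvw : seg v 0 w.length = w := by
      rw [seg_eq_iff]
      refine ⟨rfl, fun j h => ?_⟩
      simp [hv, h]
    obtain ⟨hc, hs⟩ := ζ.seg_flatMap v 0 w.length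
    rw [hvw, cumul_zero, zero_add] at hc
    rw [hvw, cumul_zero] at hs
    obtain ⟨u1, u2, hu⟩ := hinf
    have hlen : u1.length + (2 * r + 1) + u2.length = (w.flatMap ζ.word).length := by
      rw [← hu]; simp [seg_length, add_assoc]
    have hxv : ∀ i : ℕ, i < 2 * r + 1 → x (-r + i) = ζ.onSeq v (u1.length + i) := by
      intro i hi
      have h1 := ((seg_eq_iff _ _ _ _).mp hs).2 (u1.length + i) (by omega)
      rw [zero_add] at h1
      push_cast at h1
      rw [h1]
      simp only [← hu, List.append_assoc]
      rw [List.getElem_append_right (by omega), List.getElem_append_left (by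
        rw [seg_length]; omega), seg_getElem]
      congr 2; omega
    set p : ℤ := u1.length + r with hp
    obtain ⟨s1, s2⟩ := locate_spec ζ.len_pos v p
    set n₀ := locate ζ.len v p with hn₀
    have hmono := cumul_strictMono ζ.len_pos v
    have hn0 : 0 ≤ n₀ := by
      have : cumul ζ.len v 0 < cumul ζ.len v (n₀ + 1) := by
        rw [cumul_zero]; omega
      have := hmono.lt_iff_lt.mp this
      omega
    have hnw : n₀ < w.length := by
      have : cumul ζ.len v n₀ < cumul ζ.len v w.length := by
        rw [hc]; omega
      exact hmono.lt_iff_lt.mp this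
    have hb1 : (r : ℤ) < M * (n₀ + 1) := by
      have := cumul_sub_le hM1 v 0 (n₀ + 1).toNat
      rw [cumul_zero, zero_add, Int.toNat_of_nonneg (by omega)] at this
      omega
    have hb2 : (r : ℤ) < M * (w.length - n₀) := by
      have := cumul_sub_le hM1 v n₀ (w.length - n₀).toNat
      rw [Int.toNat_of_nonneg (by omega), add_sub_cancel, hc] at this
      omega
    obtain ⟨k, hk⟩ := Int.exists_add_of_le s1
    refine ⟨shiftBy n₀ v, k, ?_, ?_, ?_⟩
    · rw [cumul_succ] at s2
      have : (k : ℤ) < ζ.len (v n₀) := by omega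
      simpa [shiftBy, Substitution.len] using this
    · intro i hi1 hi2
      rw [ζ.onSeq_shift]
      have := hxv (i + r).toNat (by omega)
      rw [Int.toNat_of_nonneg (by omega)] at this
      rw [show -(r : ℤ) + (i + r) = i by ring] at this
      rw [this, shiftBy]
      congr 1; omega
    · intro i q hq
      refine ⟨b, n', by omega, ?_⟩
      rw [seg_shift, ← hw]
      have hMz : (0 : ℤ) < M := by exact_mod_cast hM0
      have a1 : |i| + q + 1 < n₀ + 1 := by
        have : (|i| + q + 1) * (M : ℤ) < (n₀ + 1) * M := by nlinarith
        exact lt_of_mul_lt_mul_right this hMz.le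
      have a2 : |i| + q + 1 < w.length - n₀ := by
        have : (|i| + q + 1) * (M : ℤ) < (w.length - n₀) * M := by nlinarith
        exact lt_of_mul_lt_mul_right this hMz.le
      have := neg_abs_le i
      have := le_abs_self i
      calc seg v (n₀ + i) q <:+: seg v 0 w.length := seg_infix v (by omega) (by omega)
        _ = w := hvw
  have hwin' : ∀ r : ℕ, ∃ yk : (ℤ → Fin m) × Fin M, yk.2.1 < (ζ.word (yk.1 0)).length ∧
      (M ≤ r → (∀ i : ℤ, -r ≤ i → i ≤ r → x i = ζ.onSeq yk.1 (i + yk.2.1)) ∧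
      ∀ (i : ℤ) (q : ℕ), (|i| + q + 1) * M ≤ r → ∃ (b : Fin m) (n : ℕ), 1 ≤ n ∧
        seg yk.1 i q <:+: (iter (tailSeq a N) n).word b) := by
    intro r
    by_cases hr : M ≤ r
    · obtain ⟨y, k, h1, h2, h3⟩ := hwin r hr
      exact ⟨(y, ⟨k, lt_of_lt_of_le h1 (hM N le_rfl _)⟩), h1, fun _ => ⟨h2, h3⟩⟩
    · exact ⟨(x, ⟨0, hM0⟩), List.length_pos_iff.mpr (ζ.word_ne_nil _), fun h => absurd h hr⟩
  choose yk hyk1 hyk2 using hwin'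
  set U : Ultrafilter ℕ := hyperfilter ℕ
  have hU : (U : Filter ℕ) ≤ atTop := by
    rw [← Nat.cofinite_eq_atTop]; exact hyperfilter_le_cofinite
  obtain ⟨⟨y, k⟩, -, hlim⟩ := (isCompact_univ (X := (ℤ → Fin m) × Fin M)).ultrafilter_le_nhds
    (U.map yk) (by simp)
  have hlim' : Tendsto yk U (𝓝 (y, k)) := hlim
  have hy : Tendsto (fun r => (yk r).1) U (𝓝 y) :=
    (continuous_fst.tendsto (y, k)).comp hlim'
  have hk : ∀ᶠ r in (U : Filter ℕ), (yk r).2 = k := by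
    have : Tendsto (fun r => (yk r).2) U (𝓝 k) := (continuous_snd.tendsto (y, k)).comp hlim'
    rw [nhds_discrete] at this
    exact tendsto_pure.mp this
  refine ⟨y, ?_, k, ?_, ?_⟩
  · intro i q
    have e1 : ∀ᶠ r in (U : Filter ℕ), ∀ j ∈ Finset.Ico i (i + q), (yk r).1 j = y j :=
      hy.eventually (eventually_eq_coord y _)
    have e2 : ∀ᶠ r : ℕ in (U : Filter ℕ), max M ((|i| + q + 1) * M).toNat ≤ r :=
      hU (eventually_ge_atTop _)
    obtain ⟨r, h1, h2⟩ := (e1.and e2).exists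
    obtain ⟨b, n, hn, hinf⟩ := (hyk2 r (le_trans (le_max_left _ _) h2)).2 i q (by
      have := le_trans (le_max_right _ _) h2
      omega)
    refine ⟨b, n, hn, ?_⟩
    have : seg y i q = seg (yk r).1 i q := seg_congr fun j hj =>
      (h1 (i + j) (by simp only [Finset.mem_Ico]; omega)).symm
    change seg y i q <:+: _
    rwa [this]
  · have e1 := hy.eventually (eventually_eq_coord y {0})
    obtain ⟨r, h1, h2⟩ := (e1.and hk).exists
    have := hyk1 r
    rwa [h2, h1 0 (by simp)] at this
  · funext i
    have e1 := hy.eventually (ζ.eventually_onSeq_eq y (i + k))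
    have e2 : ∀ᶠ r : ℕ in (U : Filter ℕ), max M i.natAbs ≤ r := hU (eventually_ge_atTop _)
    obtain ⟨r, ⟨h1, h2⟩, h3⟩ := ((e1.and e2).and hk).exists
    have := (hyk2 r (le_trans (le_max_left _ _) h2)).1 i (by omega) (by omega)
    rw [this, h3, h1]
    rfl

/-! ### The suspension flow -/

theorem locate_eq_iff {s : Fin m → ℝ} (hs : ∀ b, 0 < s b) (x : ℤ → Fin m) (τ : ℝ) (n : ℤ) :
    locate s x τ = n ↔ cumul s x n ≤ τ ∧ τ < cumul s x (n + 1) :=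
  ⟨fun h => h ▸ locate_spec hs x τ, fun h => locate_eq hs x h.1 h.2⟩

/-- The region under the graph of the roof function, described by `locate`. -/
theorem locate_eq_zero_iff {s : Fin m → ℝ} (hs : ∀ b, 0 < s b) (p : (ℤ → Fin m) × ℝ) :
    locate s p.1 p.2 = 0 ↔ 0 ≤ p.2 ∧ p.2 < s (p.1 0) := by
  rw [locate_eq_iff hs, cumul_succ, cumul_zero, zero_add]

theorem locate_shift' {s : Fin m → ℝ} (hs : ∀ b, 0 < s b) (x : ℤ → Fin m) (n : ℤ) (τ : ℝ) :
    locate s (shiftBy n x) τ = locate s x (τ + cumul s x n) - n := by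
  rw [← locate_shift hs, add_sub_cancel_right]

theorem locate_flow {s : Fin m → ℝ} (hs : ∀ b, 0 < s b) (t : ℝ) (p : (ℤ → Fin m) × ℝ) :
    locate s (flow s t p).1 (flow s t p).2 = 0 := by
  simp only [flow]
  rw [locate_shift hs, sub_self]

theorem flow_flow {s : Fin m → ℝ} (hs : ∀ b, 0 < s b) (t t' : ℝ) (p : (ℤ → Fin m) × ℝ) :
    flow s t (flow s t' p) = flow s (t + t') p := by
  have h : locate s (flow s t' p).1 ((flow s t' p).2 + t) =
      locate s p.1 (p.2 + (t + t')) - locate s p.1 (p.2 + t') := by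
    simp only [flow]
    rw [locate_shift' hs]
    congr 2; ring
  unfold flow at h ⊢
  simp only at h ⊢
  rw [h, shiftBy_shiftBy, cumul_shift, sub_add_cancel, add_sub_cancel]
  ext1
  · rfl
  · simp only; ring

theorem flow_cumul {s : Fin m → ℝ} (hs : ∀ b, 0 < s b) (x : ℤ → Fin m) (n : ℤ) {u : ℝ}
    (hu : locate s (shiftBy n x) u = 0) :
    flow s (cumul s x n + u) (x, 0) = (shiftBy n x, u) := by
  rw [locate_shift' hs, add_comm, sub_eq_zero] at hu
  simp [flow, hu]

theorem measurable_cumul {R : Type*} [AddCommGroup R] [MeasurableSpace R] [MeasurableAdd₂ R]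
    [MeasurableSub₂ R] (r : Fin m → R) (n : ℤ) : Measurable fun x : ℤ → Fin m => cumul r x n := by
  unfold cumul
  refine Measurable.sub ?_ ?_ <;> refine Finset.measurable_sum _ fun i _ => ?_ <;>
    exact (measurable_of_countable r).comp (measurable_pi_apply i)

theorem measurable_shiftBy (n : ℤ) : Measurable (shiftBy (m := m) n) :=
  measurable_pi_lambda _ fun j => measurable_pi_apply (j + n)

theorem measurable_locate {s : Fin m → ℝ} (hs : ∀ b, 0 < s b) :
    Measurable fun p : (ℤ → Fin m) × ℝ => locate s p.1 p.2 := by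
  refine measurable_to_countable' fun n => ?_
  have : (fun p : (ℤ → Fin m) × ℝ => locate s p.1 p.2) ⁻¹' {n} =
      {p | cumul s p.1 n ≤ p.2} ∩ {p | p.2 < cumul s p.1 (n + 1)} := by
    ext p; simp [locate_eq_iff hs]
  rw [this]
  exact (measurableSet_le ((measurable_cumul s n).comp measurable_fst) measurable_snd).inter
    (measurableSet_lt measurable_snd ((measurable_cumul s _).comp measurable_fst))

theorem measurable_comp_index {α β : Type*} [MeasurableSpace α] [MeasurableSpace β]
    {X : Type*} [MeasurableSpace X] {c : X → ℤ → β} (hc : ∀ n, Measurable fun x => c x n)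
    {g : α → X} (hg : Measurable g) {L : α → ℤ} (hL : Measurable L) :
    Measurable fun q => c (g q) (L q) := by
  have h : Measurable fun q : X × ℤ => c q.1 q.2 := measurable_from_prod_countable_left hc
  exact h.comp (hg.prodMk hL)

theorem measurable_shiftBy_locate {s : Fin m → ℝ} (hs : ∀ b, 0 < s b) :
    Measurable fun q : (ℤ → Fin m) × ℝ =>
      (shiftBy (locate s q.1 q.2) q.1, q.2 - cumul s q.1 (locate s q.1 q.2)) := by
  refine Measurable.prodMk ?_ (measurable_snd.sub ?_)
  · exact measurable_comp_index (c := fun x n => shiftBy n x) measurable_shiftBy measurable_fst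
      (measurable_locate hs)
  · exact measurable_comp_index (c := cumul s) (measurable_cumul s) measurable_fst
      (measurable_locate hs)

theorem measurable_flow {s : Fin m → ℝ} (hs : ∀ b, 0 < s b) :
    Measurable (Function.uncurry (flow s)) := by
  have h0 : Measurable fun q : ℝ × ((ℤ → Fin m) × ℝ) => (q.2.1, q.2.2 + q.1) :=
    (measurable_fst.comp measurable_snd).prodMk
      ((measurable_snd.comp measurable_snd).add measurable_fst)
  have h5 := (measurable_shiftBy_locate hs).comp h0
  exact h5

theorem measurePreserving_shiftBy {μ : Measure (ℤ → Fin m)}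
    (h : MeasurePreserving (shiftBy 1) μ μ) (n : ℤ) : MeasurePreserving (shiftBy n) μ μ := by
  let e : (ℤ → Fin m) ≃ᵐ (ℤ → Fin m) :=
    { toFun := shiftBy 1
      invFun := shiftBy (-1)
      left_inv := fun x => by rw [shiftBy_shiftBy]; exact shiftBy_zero x
      right_inv := fun x => by rw [shiftBy_shiftBy]; exact shiftBy_zero x
      measurable_toFun := measurable_shiftBy 1
      measurable_invFun := measurable_shiftBy (-1) }
  have he : MeasurePreserving e μ μ := h
  have h' : MeasurePreserving (shiftBy (-1)) μ μ := he.symm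
  induction n using Int.induction_on with
  | zero => rw [show shiftBy (m := m) 0 = id from funext shiftBy_zero]; exact .id _
  | succ i ih =>
    have := h.comp ih
    rwa [show shiftBy (m := m) 1 ∘ shiftBy i = shiftBy (i + 1) from
      funext fun x => by rw [Function.comp, shiftBy_shiftBy, add_comm]] at this
  | pred i ih =>
    have := h'.comp ih
    rwa [show shiftBy (m := m) (-1) ∘ shiftBy (-(i : ℤ)) = shiftBy (-(i : ℤ) - 1) from
      funext fun x => by
        rw [Function.comp, shiftBy_shiftBy, add_comm, ← sub_eq_add_neg]] at this

theorem suspMeasure_eq {s : Fin m → ℝ} (hs : ∀ b, 0 < s b) (μ : Measure (ℤ → Fin m)) :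
    suspMeasure s μ = (μ.prod volume).restrict {p | locate s p.1 p.2 = 0} := by
  unfold suspMeasure
  congr 1
  ext p
  exact (locate_eq_zero_iff hs p).symm

theorem measurableSet_locate {s : Fin m → ℝ} (hs : ∀ b, 0 < s b) :
    MeasurableSet {p : (ℤ → Fin m) × ℝ | locate s p.1 p.2 = 0} :=
  measurable_locate hs (measurableSet_singleton 0)

theorem measure_eq_tsum_inter {α : Type*} [MeasurableSpace α] (ν : Measure α) {g : α → ℤ}
    (hg : Measurable g) {S : Set α} (hS : MeasurableSet S) :
    ν S = ∑' n : ℤ, ν (S ∩ g ⁻¹' {n}) := by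
  rw [← measure_iUnion]
  · congr 1
    ext x; simp
  · intro i j hij
    refine Set.disjoint_left.mpr fun x h1 h2 => hij ?_
    have e1 : g x = i := h1.2
    have e2 : g x = j := h2.2
    rw [← e1, e2]
  · exact fun n => hS.inter (hg (measurableSet_singleton n))

/-- The suspension flow preserves the suspension measure: on the set where the base point is
shifted by `n`, the flow is a skew product of the shift with translations. -/
theorem measurePreserving_flow {s : Fin m → ℝ} (hs : ∀ b, 0 < s b) {μ : Measure (ℤ → Fin m)}
    [SFinite μ] (h : MeasurePreserving (shiftBy 1) μ μ) (t : ℝ) :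
    MeasurePreserving (flow s t) (suspMeasure s μ) (suspMeasure s μ) := by
  have hft : Measurable (flow s t) := (measurable_flow hs).of_uncurry_left
  refine ⟨hft, Measure.ext fun A hA => ?_⟩
  rw [Measure.map_apply hft hA, suspMeasure_eq hs, Measure.restrict_apply (hft hA),
    Measure.restrict_apply hA]
  have hD := measurableSet_locate hs
  have hadd : ∀ c : ℝ, Measurable fun q : (ℤ → Fin m) × ℝ => (q.1, q.2 + c) := by
    intro c; fun_prop
  have hg1 : Measurable fun p : (ℤ → Fin m) × ℝ => locate s p.1 (p.2 + t) :=
    (measurable_locate hs).comp (hadd t)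
  have hg2 : Measurable fun p : (ℤ → Fin m) × ℝ => locate s p.1 (p.2 - t) :=
    (measurable_locate hs).comp (hadd (-t))
  rw [measure_eq_tsum_inter _ hg1 ((hft hA).inter hD), measure_eq_tsum_inter _ hg2 (hA.inter hD),
    ← (Equiv.neg ℤ).tsum_eq]
  refine tsum_congr fun n => ?_
  have hφ : MeasurePreserving (fun p : (ℤ → Fin m) × ℝ =>
      (shiftBy (-n) p.1, p.2 + (t - cumul s p.1 (-n)))) (μ.prod volume) (μ.prod volume) := by
    refine (measurePreserving_shiftBy h (-n)).skew_product
      (g := fun x u => u + (t - cumul s x (-n))) ?_ ?_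
    · exact measurable_snd.add (measurable_const.sub
        ((measurable_cumul s (-n)).comp measurable_fst))
    · exact Eventually.of_forall fun x => map_add_right_eq_self volume _
  rw [← hφ.measure_preimage
    ((hA.inter hD).inter (hg2 (measurableSet_singleton n))).nullMeasurableSet]
  congr 1
  ext p
  have e1 : p.2 + (t - cumul s p.1 (-n)) + cumul s p.1 (-n) = p.2 + t := by ring
  have e2 : p.2 + (t - cumul s p.1 (-n)) - t + cumul s p.1 (-n) = p.2 := by ring
  simp only [Equiv.neg_apply, Set.mem_inter_iff, Set.mem_preimage, Set.mem_ofPred_eq,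
    Set.mem_singleton_iff, locate_shift' hs, e1, e2]
  constructor
  · rintro ⟨⟨h1, h2⟩, h3⟩
    refine ⟨⟨?_, by omega⟩, by omega⟩
    rw [flow, h3] at h1
    convert h1 using 2
    ring
  · rintro ⟨⟨h1, h2⟩, h3⟩
    have h3' : locate s p.1 (p.2 + t) = -n := by omega
    refine ⟨⟨?_, by omega⟩, h3'⟩
    rw [flow, h3']
    convert h1 using 2
    ring

theorem suspMeasure_univ {s : Fin m → ℝ} (μ : Measure (ℤ → Fin m)) [SFinite μ] :
    suspMeasure s μ Set.univ = ∫⁻ x, ENNReal.ofReal (s (x 0)) ∂μ := by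
  have hmeas : Measurable fun x : ℤ → Fin m => s (x 0) :=
    (measurable_of_countable s).comp (measurable_pi_apply 0)
  have hS : MeasurableSet {p : (ℤ → Fin m) × ℝ | 0 ≤ p.2 ∧ p.2 < s (p.1 0)} :=
    (measurableSet_le measurable_const measurable_snd).inter
      (measurableSet_lt measurable_snd (hmeas.comp measurable_fst))
  rw [suspMeasure, Measure.restrict_apply_univ, Measure.prod_apply hS]
  refine lintegral_congr fun x => ?_
  have : Prod.mk x ⁻¹' {p : (ℤ → Fin m) × ℝ | 0 ≤ p.2 ∧ p.2 < s (p.1 0)} = Set.Ico 0 (s (x 0)) := by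
    ext u; simp
  rw [this, Real.volume_Ico, sub_zero]

theorem suspMeasure_finite {s : Fin m → ℝ} (μ : Measure (ℤ → Fin m)) [IsFiniteMeasure μ] :
    IsFiniteMeasure (suspMeasure s μ) := by
  refine ⟨?_⟩
  rw [suspMeasure_univ]
  refine lt_of_le_of_lt (lintegral_mono (g := fun _ => ENNReal.ofReal (∑ b, |s b|)) fun x => ?_) ?_
  · exact ENNReal.ofReal_le_ofReal ((le_abs_self _).trans
      (Finset.single_le_sum (f := fun b => |s b|) (fun _ _ => abs_nonneg _) (Finset.mem_univ _)))
  · rw [lintegral_const]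
    exact ENNReal.mul_lt_top ENNReal.ofReal_lt_top (measure_lt_top _ _)

theorem suspMeasure_ne_zero {s : Fin m → ℝ} (hs : ∀ b, 0 < s b) (μ : Measure (ℤ → Fin m))
    [IsProbabilityMeasure μ] : suspMeasure s μ Set.univ ≠ 0 := by
  rw [suspMeasure_univ]
  have hmeas : Measurable fun x : ℤ → Fin m => s (x 0) :=
    (measurable_of_countable s).comp (measurable_pi_apply 0)
  intro h
  rw [lintegral_eq_zero_iff (f := fun x : ℤ → Fin m => ENNReal.ofReal (s (x 0)))
    (ENNReal.measurable_ofReal.comp hmeas)] at h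
  obtain ⟨x, hx⟩ := h.exists
  have := hs (x 0)
  simp at hx
  linarith

/-! ### Cylindrical functions along orbits -/

/-- The points of the suspension over the `S`-adic space. -/
def suspSpace (a : ℕ → Substitution m) (s : Fin m → ℝ) : Set ((ℤ → Fin m) × ℝ) :=
  {p | p.1 ∈ space a ∧ locate s p.1 p.2 = 0}

theorem flow_mem_suspSpace {a : ℕ → Substitution m} {s : Fin m → ℝ} (hs : ∀ b, 0 < s b)
    {p : (ℤ → Fin m) × ℝ} (hp : p ∈ suspSpace a s) (t : ℝ) : flow s t p ∈ suspSpace a s :=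
  ⟨shiftBy_mem_space hp.1 _, locate_flow hs t p⟩

theorem measurableSet_space (a : ℕ → Substitution m) : MeasurableSet (space a) :=
  (isClosed_space a).measurableSet

theorem measurableSet_suspSpace (a : ℕ → Substitution m) {s : Fin m → ℝ} (hs : ∀ b, 0 < s b) :
    MeasurableSet (suspSpace a s) :=
  (measurable_fst (measurableSet_space a)).inter (measurableSet_locate hs)

theorem ae_mem_suspSpace {a : ℕ → Substitution m} {s : Fin m → ℝ} (hs : ∀ b, 0 < s b)
    {μ : Measure (ℤ → Fin m)} [SFinite μ] (hμ : μ (space a)ᶜ = 0) :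
    ∀ᵐ p ∂(suspMeasure s μ), p ∈ suspSpace a s := by
  rw [suspMeasure_eq hs, ae_restrict_iff' (measurableSet_locate hs)]
  have h1 : ∀ᵐ x ∂μ, x ∈ space a := hμ
  have h2 : ∀ᵐ p ∂(μ.prod (volume : Measure ℝ)), p.1 ∈ space a :=
    Measure.quasiMeasurePreserving_fst.ae h1
  filter_upwards [h2] with p hp hl
  exact ⟨hp, hl⟩

/-- The defining property of a cylindrical function, without the regularity of its components. -/
def CylValue (a : ℕ → Substitution m) (s : Fin m → ℝ) (l : ℕ) (ψ : Fin m → ℝ → ℂ)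
    (f : (ℤ → Fin m) × ℝ → ℂ) : Prop :=
  ∀ y ∈ space (tailSeq a l), ∀ t ∈ Set.Ico 0 (levelRoof a s l (y 0)),
    f (flow s t ((iter a l).onSeq y, 0)) = ψ (y 0) t

theorem exists_orbit {a : ℕ → Substitution m} {s : Fin m → ℝ} (hs : ∀ b, 0 < s b) (l : ℕ)
    {p : (ℤ → Fin m) × ℝ} (hp : p ∈ suspSpace a s) :
    ∃ y ∈ space (tailSeq a l), ∃ k : ℕ, k < ((iter a l).word (y 0)).length ∧
      p.1 = shiftBy k ((iter a l).onSeq y) ∧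
      p = flow s (cumul s ((iter a l).onSeq y) k + p.2) ((iter a l).onSeq y, 0) := by
  obtain ⟨y, hy, k, hk, hx⟩ := exists_desubstitution a l hp.1
  refine ⟨y, hy, k, hk, hx, ?_⟩
  rw [flow_cumul hs _ _ (by rw [← hx]; exact hp.2), ← hx]

theorem CylValue.block {a : ℕ → Substitution m} {s : Fin m → ℝ} (hs : ∀ b, 0 < s b) {l : ℕ}
    {ψ : Fin m → ℝ → ℂ} {f : (ℤ → Fin m) × ℝ → ℂ} (hf : CylValue a s l ψ f)
    {y : ℤ → Fin m} (hy : y ∈ space (tailSeq a l)) (j : ℤ) {v : ℝ} (h0 : 0 ≤ v)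
    (h1 : v < levelRoof a s l (y j)) :
    f (flow s (cumul (levelRoof a s l) y j + v) ((iter a l).onSeq y, 0)) = ψ (y j) v := by
  have h2 := hf (shiftBy j y) (shiftBy_mem_space hy j) v
  simp only [shiftBy, zero_add] at h2
  have h3 := h2 ⟨h0, h1⟩
  change f (flow s v ((iter a l).onSeq (shiftBy j y), 0)) = _ at h3
  rw [Substitution.onSeq_shift] at h3
  rw [← h3, add_comm, ← flow_flow hs, levelRoof, ← Substitution.cumul_onSeq]
  have h4 := flow_cumul hs ((iter a l).onSeq y) (cumul (iter a l).len y j) (u := 0)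
    ((locate_eq_zero_iff hs (_, 0)).mpr ⟨le_rfl, hs _⟩)
  rw [add_zero] at h4
  rw [h4]

theorem CylValue.norm_le {a : ℕ → Substitution m} {s : Fin m → ℝ} (hs : ∀ b, 0 < s b) {l : ℕ}
    {ψ : Fin m → ℝ → ℂ} {f : (ℤ → Fin m) × ℝ → ℂ} (hf : CylValue a s l ψ f) {C : ℝ}
    (hC : ∀ b t, ‖ψ b t‖ ≤ C) {p : (ℤ → Fin m) × ℝ} (hp : p ∈ suspSpace a s) : ‖f p‖ ≤ C := by
  obtain ⟨y, hy, k, -, -, hk⟩ := exists_orbit hs l hp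
  set τ := cumul s ((iter a l).onSeq y) k + p.2
  have hr : ∀ b, 0 < levelRoof a s l b := (iter a l).transposeMul_pos hs
  obtain ⟨h1, h2⟩ := locate_spec hr y τ
  rw [cumul_succ] at h2
  have := hf.block hs hy (locate (levelRoof a s l) y τ)
    (v := τ - cumul (levelRoof a s l) y (locate (levelRoof a s l) y τ)) (by linarith) (by linarith)
  rw [add_sub_cancel, ← hk] at this
  rw [this]
  exact hC _ _

/-- A cylindrical function with continuous components is measurable on the suspension space: it
is continuous in the fibre coordinate over each of the finitely many compact sets
`T^k ζ^{[l]} [b]`. -/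
theorem CylValue.measurable {a : ℕ → Substitution m} {s : Fin m → ℝ} (hs : ∀ b, 0 < s b) {l : ℕ}
    {ψ : Fin m → ℝ → ℂ} {f : (ℤ → Fin m) × ℝ → ℂ} (hf : CylValue a s l ψ f)
    (hψ : ∀ b, Continuous (ψ b)) : Measurable ((suspSpace a s).indicator f) := by
  classical
  set ζ := iter a l with hζ
  let E : Fin m → ℕ → Set (ℤ → Fin m) := fun b k =>
    shiftBy k '' (ζ.onSeq '' (space (tailSeq a l) ∩ {y | y 0 = b}))
  have hE : ∀ b k, MeasurableSet (E b k) := by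
    intro b k
    have hb : IsClosed {y : ℤ → Fin m | y 0 = b} :=
      isClosed_eq (continuous_apply 0) continuous_const
    have hcl := (isClosed_space (tailSeq a l)).inter hb
    exact ((hcl.isCompact.image ζ.continuous_onSeq).image
      (continuous_shiftBy k)).isClosed.measurableSet
  let g : Fin m → ℕ → (ℤ → Fin m) × ℝ → ℂ := fun b k p =>
    ψ b (cumul s (shiftBy (-k) p.1) k + p.2)
  have hg : ∀ b k, Measurable (g b k) := by
    intro b k
    refine (hψ b).measurable.comp (Measurable.add ?_ measurable_snd)
    exact (measurable_cumul s k).comp ((measurable_shiftBy (-k)).comp measurable_fst)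
  have hfg : ∀ p ∈ suspSpace a s, ∃ b, ∃ k : ℕ, p.1 ∈ E b k ∧ k < (ζ.word b).length := by
    intro p hp
    obtain ⟨y, hy, k, hk, hx, -⟩ := exists_orbit hs l hp
    exact ⟨y 0, k, ⟨_, ⟨y, ⟨hy, rfl⟩, rfl⟩, hx.symm⟩, hk⟩
  have hval : ∀ p ∈ suspSpace a s, ∀ b, ∀ k : ℕ, p.1 ∈ E b k → k < (ζ.word b).length →
      f p = g b k p := by
    rintro p hp b k ⟨_, ⟨y, ⟨hy, rfl⟩, rfl⟩, hx⟩ hk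
    have h1 : shiftBy (-k) p.1 = ζ.onSeq y := by
      rw [← hx, shiftBy_shiftBy, neg_add_cancel, shiftBy_zero]
    have h2 := flow_cumul hs (ζ.onSeq y) k (u := p.2) (by rw [hx]; exact hp.2)
    rw [hx] at h2
    have h3 : locate s (ζ.onSeq y) (cumul s (ζ.onSeq y) k + p.2) = k := by
      have := hp.2
      rw [← hx, locate_shift' hs] at this
      rw [add_comm]; omega
    obtain ⟨h4, h5⟩ := (locate_eq_iff hs _ _ _).mp h3
    have hm := (cumul_strictMono hs (ζ.onSeq y)).monotone
    have h6 : cumul s (ζ.onSeq y) ((k : ℤ) + 1) ≤ levelRoof a s l (y 0) := by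
      have e := ζ.cumul_onSeq s y 1
      have e0 := cumul_succ (ζ.transposeMul s) y 0
      rw [cumul_zero, zero_add, zero_add] at e0
      rw [e0] at e
      rw [levelRoof, ← hζ, ← e]
      refine hm ?_
      have e1 := cumul_succ ζ.len y 0
      rw [cumul_zero, zero_add, zero_add] at e1
      rw [e1, Substitution.len]
      omega
    have h7 : 0 ≤ cumul s (ζ.onSeq y) k := by
      have := hm (show (0 : ℤ) ≤ k by omega)
      rwa [cumul_zero] at this
    have h8 := hf y hy (cumul s (ζ.onSeq y) k + p.2) ⟨by linarith, by linarith⟩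
    rw [h2] at h8
    simp only [g, h1]
    exact h8
  intro A hA
  have : (suspSpace a s).indicator f ⁻¹' A =
      (⋃ (b : Fin m) (k : Fin (ζ.word b).length),
        suspSpace a s ∩ (Prod.fst ⁻¹' E b k) ∩ (g b k ⁻¹' A)) ∪
      ((suspSpace a s)ᶜ ∩ {_p | (0 : ℂ) ∈ A}) := by
    ext p
    simp only [Set.mem_preimage, Set.mem_union, Set.mem_iUnion, Set.mem_inter_iff,
      Set.mem_compl_iff, Set.mem_ofPred_eq]
    by_cases hp : p ∈ suspSpace a s
    · rw [Set.indicator_of_mem hp]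
      simp only [hp, true_and, not_true_eq_false, false_and, or_false]
      constructor
      · intro h
        obtain ⟨b, k, h1, h2⟩ := hfg p hp
        exact ⟨b, ⟨k, h2⟩, h1, by rw [← hval p hp b k h1 h2]; exact h⟩
      · rintro ⟨b, k, h1, h2⟩
        rw [hval p hp b k h1 k.2]; exact h2
    · rw [Set.indicator_of_notMem hp]
      simp [hp]
  rw [this]
  have hX := measurableSet_suspSpace a hs
  refine MeasurableSet.union (MeasurableSet.iUnion fun b => MeasurableSet.iUnion fun k =>
    (hX.inter (measurable_fst (hE b k))).inter (hg b k hA)) (hX.compl.inter (.const _))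

/-! ### Spectral measures and twisted ergodic integrals -/

/-- A bounded measurable observable `f` along a measure preserving flow `Φ`, with spectral
measure `σ`. -/
structure IsSpectralSystem {P : Type*} [MeasurableSpace P] (ν : Measure P) (Φ : ℝ → P → P)
    (f : P → ℂ) (C : ℝ) (σ : Measure ℝ) : Prop where
  measurable_flow : Measurable (Function.uncurry Φ)
  measurePreserving : ∀ t, MeasurePreserving (Φ t) ν ν
  flow_flow : ∀ t t' p, Φ t (Φ t' p) = Φ (t + t') p
  measurable : Measurable f
  norm_le : ∀ p, ‖f p‖ ≤ C
  fourier : ∀ t : ℝ, ∫ τ, Complex.exp (2 * Real.pi * Complex.I * τ * t) ∂σ =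
    ∫ p, f (Φ t p) * (starRingEnd ℂ) (f p) ∂ν

/-- The twisted ergodic integral `∫_0^R e^{-2πiωt} f(Φ_t p) dt`. -/
noncomputable def twist {P : Type*} (Φ : ℝ → P → P) (f : P → ℂ) (ω R : ℝ) (p : P) : ℂ :=
  ∫ t in (0 : ℝ)..R, wave ω t * f (Φ t p)

/-- The kernel `∫_0^R e^{-2πixt} dt`. -/
noncomputable def waveIntegral (R x : ℝ) : ℂ := ∫ t in (0 : ℝ)..R, wave x t

theorem wave_conj (ω t : ℝ) : (starRingEnd ℂ) (wave ω t) = wave ω (-t) := by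
  unfold wave
  rw [← Complex.exp_conj]
  congr 1
  simp [Complex.conj_ofNat]

theorem continuous_wave_uncurry : Continuous fun q : ℝ × ℝ => wave q.1 q.2 := by
  unfold wave; fun_prop

theorem norm_waveIntegral_le {R : ℝ} (hR : 0 ≤ R) (x : ℝ) : ‖waveIntegral R x‖ ≤ R := by
  have := intervalIntegral.norm_integral_le_of_norm_le_const (a := 0) (b := R) (C := 1)
    (f := wave x) fun t _ => (norm_wave x t).le
  simpa [waveIntegral, abs_of_nonneg hR] using this

theorem norm_waveIntegral_le_inv (R : ℝ) {x : ℝ} (hx : x ≠ 0) : ‖waveIntegral R x‖ ≤ 1 / |x| := by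
  have hc : -2 * (Real.pi : ℂ) * Complex.I * x ≠ 0 := by
    have := Real.pi_ne_zero
    simp [hx, this]
  have h1 : waveIntegral R x =
      (wave x R - 1) / (-2 * (Real.pi : ℂ) * Complex.I * x) := by
    unfold waveIntegral wave
    rw [integral_exp_mul_complex hc]
    simp
  rw [h1, norm_div]
  have h2 : ‖wave x R - 1‖ ≤ 2 := by
    refine (norm_sub_le _ _).trans ?_
    rw [norm_wave, norm_one]; norm_num
  have h3 : ‖-2 * (Real.pi : ℂ) * Complex.I * x‖ = 2 * Real.pi * |x| := by
    simp [abs_of_pos Real.pi_pos]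
  rw [h3]
  have hx' : 0 < |x| := abs_pos.mpr hx
  rw [div_le_div_iff₀ (by positivity) hx']
  have := Real.pi_gt_three
  nlinarith

theorem half_le_norm_waveIntegral {R x : ℝ} (hR : 0 ≤ R) (hx : |x| * R ≤ 1 / 16) :
    R / 2 ≤ ‖waveIntegral R x‖ := by
  have h1 : waveIntegral R x - R = ∫ t in (0 : ℝ)..R, (wave x t - 1) := by
    rw [intervalIntegral.integral_sub ((continuous_wave x).intervalIntegrable _ _)
      (by simp)]
    simp [waveIntegral]
  have h2 : ‖waveIntegral R x - R‖ ≤ 1 / 2 * |R - 0| := by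
    rw [h1]
    refine intervalIntegral.norm_integral_le_of_norm_le_const fun t ht => ?_
    rw [Set.uIoc_of_le hR] at ht
    have h3 : wave x t = Complex.exp (Complex.I * ((-2 * Real.pi * x * t : ℝ) : ℂ)) := by
      unfold wave; push_cast; ring_nf
    rw [h3]
    refine (Real.norm_exp_I_mul_ofReal_sub_one_le).trans ?_
    rw [Real.norm_eq_abs, abs_mul, abs_mul, abs_mul, abs_of_pos Real.pi_pos, abs_of_pos ht.1]
    have h4 : |x| * t ≤ 1 / 16 := (mul_le_mul_of_nonneg_left ht.2 (abs_nonneg x)).trans hx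
    have := Real.pi_lt_four
    have := Real.pi_pos
    have h5 : (0 : ℝ) ≤ |x| * t := mul_nonneg (abs_nonneg _) ht.1.le
    norm_num
    nlinarith
  rw [sub_zero, abs_of_nonneg hR] at h2
  have h3 : ‖(R : ℂ)‖ = R := by simp [abs_of_nonneg hR]
  have := norm_sub_norm_le (R : ℂ) (waveIntegral R x)
  rw [norm_sub_rev] at this
  linarith

theorem measurable_waveIntegral (R ω : ℝ) (hR : 0 ≤ R) :
    StronglyMeasurable fun θ => waveIntegral R (ω - θ) := by
  unfold waveIntegral
  simp only [intervalIntegral.integral_of_le hR]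
  refine StronglyMeasurable.integral_prod_right (f := fun θ t => wave (ω - θ) t) ?_
  have : Continuous fun q : ℝ × ℝ => wave (ω - q.1) q.2 :=
    continuous_wave_uncurry.comp (by fun_prop :
      Continuous fun q : ℝ × ℝ => (ω - q.1, q.2))
  exact this.stronglyMeasurable

theorem integral_prod_mul_conj {α : Type*} [MeasurableSpace α] (τ : Measure α) [SFinite τ]
    (g : α → ℂ) :
    ∫ q, g q.1 * (starRingEnd ℂ) (g q.2) ∂(τ.prod τ) = ((‖∫ t, g t ∂τ‖ ^ 2 : ℝ) : ℂ) := by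
  rw [integral_prod_mul (f := g) (g := fun t => (starRingEnd ℂ) (g t)), integral_conj,
    Complex.mul_conj, Complex.normSq_eq_norm_sq]

theorem integral_integral_eq_of_inner {P Θ Q : Type*} [MeasurableSpace P] [MeasurableSpace Θ]
    [MeasurableSpace Q] {ν : Measure P} {σ : Measure Θ} {κ : Measure Q} [SFinite ν] [SFinite σ]
    [SFinite κ] {G : P → Q → ℂ} {W : Θ → Q → ℂ}
    (hG : Integrable (Function.uncurry G) (ν.prod κ))
    (hW : Integrable (Function.uncurry W) (σ.prod κ))
    (h : ∀ q, ∫ p, G p q ∂ν = ∫ θ, W θ q ∂σ) :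
    ∫ p, ∫ q, G p q ∂κ ∂ν = ∫ θ, ∫ q, W θ q ∂κ ∂σ := by
  rw [integral_integral_swap hG, integral_integral_swap hW]
  exact integral_congr_ae (Eventually.of_forall h)

namespace IsSpectralSystem

variable {P : Type*} [MeasurableSpace P] {ν : Measure P} {Φ : ℝ → P → P} {f : P → ℂ} {C : ℝ}
  {σ : Measure ℝ}

theorem stronglyMeasurable_twist (h : IsSpectralSystem ν Φ f C σ) (ω : ℝ) {R : ℝ} (hR : 0 ≤ R) :
    StronglyMeasurable (twist Φ f ω R) := by
  unfold twist
  simp only [intervalIntegral.integral_of_le hR]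
  refine StronglyMeasurable.integral_prod_right (f := fun p t => wave ω t * f (Φ t p)) ?_
  refine Measurable.stronglyMeasurable ?_
  exact ((continuous_wave ω).measurable.comp measurable_snd).mul
    (h.measurable.comp (h.measurable_flow.comp measurable_swap))

theorem norm_twist_le (h : IsSpectralSystem ν Φ f C σ) (ω : ℝ) {R : ℝ} (hR : 0 ≤ R) (p : P) :
    ‖twist Φ f ω R p‖ ≤ C * R := by
  have := intervalIntegral.norm_integral_le_of_norm_le_const (a := 0) (b := R) (C := C)
    (f := fun t => wave ω t * f (Φ t p)) fun t _ => by
      rw [norm_mul, norm_wave, one_mul]; exact h.norm_le _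
  simpa [twist, abs_of_nonneg hR] using this

theorem integrable_norm_twist [IsFiniteMeasure ν] (h : IsSpectralSystem ν Φ f C σ) (ω : ℝ) {R : ℝ}
    (hR : 0 ≤ R) : Integrable (fun p => ‖twist Φ f ω R p‖) ν :=
  (Integrable.of_bound (h.stronglyMeasurable_twist ω hR).aestronglyMeasurable (C * R)
    (Eventually.of_forall (h.norm_twist_le ω hR))).norm

/-- The square of the `L²` norm of the twisted integral is the integral of the square of the
kernel with respect to the spectral measure. -/
theorem integral_norm_twist_sq [IsFiniteMeasure ν] [IsFiniteMeasure σ]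
    (h : IsSpectralSystem ν Φ f C σ) (ω : ℝ) {R : ℝ} (hR : 0 ≤ R) :
    ∫ p, ‖twist Φ f ω R p‖ ^ 2 ∂ν = ∫ θ, ‖waveIntegral R (ω - θ)‖ ^ 2 ∂σ := by
  set τ : Measure ℝ := volume.restrict (Set.Ioc 0 R) with hτ
  have hτf : IsFiniteMeasure τ := ⟨by simp [hτ]⟩
  have hfΦ : Measurable fun q : P × ℝ => wave ω q.2 * f (Φ q.2 q.1) :=
    ((continuous_wave ω).measurable.comp measurable_snd).mul
      (h.measurable.comp (h.measurable_flow.comp measurable_swap))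
  have hconj : Measurable (starRingEnd ℂ : ℂ → ℂ) := Complex.continuous_conj.measurable
  have hG : Measurable fun x : P × (ℝ × ℝ) => (wave ω x.2.1 * f (Φ x.2.1 x.1)) *
      (starRingEnd ℂ) (wave ω x.2.2 * f (Φ x.2.2 x.1)) := by
    refine Measurable.mul ?_ (hconj.comp ?_)
    · exact hfΦ.comp (measurable_fst.prodMk (measurable_fst.comp measurable_snd))
    · exact hfΦ.comp (measurable_fst.prodMk (measurable_snd.comp measurable_snd))
  have hGi : Integrable (fun x : P × (ℝ × ℝ) => (wave ω x.2.1 * f (Φ x.2.1 x.1)) *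
      (starRingEnd ℂ) (wave ω x.2.2 * f (Φ x.2.2 x.1))) (ν.prod (τ.prod τ)) := by
    refine Integrable.of_bound hG.aestronglyMeasurable (C * C) (Eventually.of_forall fun x => ?_)
    simp only [norm_mul, RCLike.norm_conj, norm_wave, one_mul]
    exact mul_le_mul (h.norm_le _) (h.norm_le _) (norm_nonneg _)
      ((norm_nonneg _).trans (h.norm_le x.1))
  have hW : Continuous fun x : ℝ × (ℝ × ℝ) => wave (ω - x.1) x.2.1 *
      (starRingEnd ℂ) (wave (ω - x.1) x.2.2) := by
    refine Continuous.mul ?_ (Complex.continuous_conj.comp ?_)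
    · exact continuous_wave_uncurry.comp (by fun_prop :
        Continuous fun x : ℝ × (ℝ × ℝ) => (ω - x.1, x.2.1))
    · exact continuous_wave_uncurry.comp (by fun_prop :
        Continuous fun x : ℝ × (ℝ × ℝ) => (ω - x.1, x.2.2))
  have hWi : Integrable (fun x : ℝ × (ℝ × ℝ) => wave (ω - x.1) x.2.1 *
      (starRingEnd ℂ) (wave (ω - x.1) x.2.2)) (σ.prod (τ.prod τ)) := by
    refine Integrable.of_bound hW.aestronglyMeasurable 1 (Eventually.of_forall fun x => ?_)
    simp only [norm_mul, RCLike.norm_conj, norm_wave, one_mul, le_refl]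
  have h1 : ∀ p, ((‖twist Φ f ω R p‖ ^ 2 : ℝ) : ℂ) = ∫ q, (wave ω q.1 * f (Φ q.1 p)) *
      (starRingEnd ℂ) (wave ω q.2 * f (Φ q.2 p)) ∂(τ.prod τ) := by
    intro p
    rw [integral_prod_mul_conj τ fun t => wave ω t * f (Φ t p), twist,
      intervalIntegral.integral_of_le hR]
  have h2 : ∀ θ, ((‖waveIntegral R (ω - θ)‖ ^ 2 : ℝ) : ℂ) = ∫ q, wave (ω - θ) q.1 *
      (starRingEnd ℂ) (wave (ω - θ) q.2) ∂(τ.prod τ) := by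
    intro θ
    rw [integral_prod_mul_conj τ fun t => wave (ω - θ) t, waveIntegral,
      intervalIntegral.integral_of_le hR]
  have h3 : ∀ q : ℝ × ℝ, ∫ p, (wave ω q.1 * f (Φ q.1 p)) *
      (starRingEnd ℂ) (wave ω q.2 * f (Φ q.2 p)) ∂ν =
      ∫ θ, wave (ω - θ) q.1 * (starRingEnd ℂ) (wave (ω - θ) q.2) ∂σ := by
    intro q
    have e1 : ∀ p, (wave ω q.1 * f (Φ q.1 p)) * (starRingEnd ℂ) (wave ω q.2 * f (Φ q.2 p)) =
        wave ω (q.1 - q.2) *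
          (f (Φ (q.1 - q.2) (Φ q.2 p)) * (starRingEnd ℂ) (f (Φ q.2 p))) := by
      intro p
      rw [h.flow_flow, sub_add_cancel, map_mul, wave_conj, sub_eq_add_neg, wave_add]
      ring
    have e2 : ∀ θ, wave (ω - θ) q.1 * (starRingEnd ℂ) (wave (ω - θ) q.2) =
        wave ω (q.1 - q.2) * Complex.exp (2 * Real.pi * Complex.I * θ * (q.1 - q.2 : ℝ)) := by
      intro θ
      rw [wave_conj, ← wave_add, ← sub_eq_add_neg, wave, wave, ← Complex.exp_add]
      push_cast; ring_nf
    simp only [e1, e2]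
    rw [integral_const_mul, integral_const_mul, h.fourier]
    congr 1
    have hm : Measurable fun p => f (Φ (q.1 - q.2) p) * (starRingEnd ℂ) (f p) :=
      (h.measurable.comp h.measurable_flow.of_uncurry_left).mul (hconj.comp h.measurable)
    conv_rhs => rw [← (h.measurePreserving q.2).map_eq]
    rw [integral_map (h.measurePreserving q.2).measurable.aemeasurable hm.aestronglyMeasurable]
  have key : ((∫ p, ‖twist Φ f ω R p‖ ^ 2 ∂ν : ℝ) : ℂ) =
      ((∫ θ, ‖waveIntegral R (ω - θ)‖ ^ 2 ∂σ : ℝ) : ℂ) := by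
    rw [← integral_complex_ofReal, ← integral_complex_ofReal]
    simp only [h1, h2]
    exact integral_integral_eq_of_inner hGi hWi h3
  exact_mod_cast key

theorem integrable_waveIntegral_sq [IsFiniteMeasure σ] (ω : ℝ) {R : ℝ} (hR : 0 ≤ R) :
    Integrable (fun θ => ‖waveIntegral R (ω - θ)‖ ^ 2) σ := by
  refine Integrable.of_bound
    ((measurable_waveIntegral R ω hR).norm.pow 2).aestronglyMeasurable (R ^ 2)
    (Eventually.of_forall fun θ => ?_)
  rw [Real.norm_of_nonneg (by positivity)]
  exact pow_le_pow_left₀ (norm_nonneg _) (norm_waveIntegral_le hR _) 2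

/-- A uniform bound on the twisted integrals bounds the spectral measure of balls. -/
theorem measureReal_ball_le [IsFiniteMeasure ν] [IsFiniteMeasure σ]
    (h : IsSpectralSystem ν Φ f C σ) (ω : ℝ) {R K : ℝ} (hR : 0 < R)
    (hK : ∀ᵐ p ∂ν, ‖twist Φ f ω R p‖ ≤ K) :
    σ.real (Metric.ball ω (1 / (16 * R))) ≤ 4 * K ^ 2 * ν.real Set.univ / R ^ 2 := by
  have h1 : (R / 2) ^ 2 * σ.real (Metric.ball ω (1 / (16 * R))) ≤
      ∫ θ, ‖waveIntegral R (ω - θ)‖ ^ 2 ∂σ := by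
    have e : (R / 2) ^ 2 * σ.real (Metric.ball ω (1 / (16 * R))) =
        ∫ θ in Metric.ball ω (1 / (16 * R)), (R / 2) ^ 2 ∂σ := by
      rw [setIntegral_const, smul_eq_mul, mul_comm]
    rw [e]
    refine (setIntegral_mono_on (integrable_const _).integrableOn
      (integrable_waveIntegral_sq ω hR.le).integrableOn Metric.isOpen_ball.measurableSet
      fun θ hθ => ?_).trans
      (setIntegral_le_integral (integrable_waveIntegral_sq ω hR.le)
        (Eventually.of_forall fun θ => by positivity))
    refine pow_le_pow_left₀ (by positivity) (half_le_norm_waveIntegral hR.le ?_) 2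
    rw [Metric.mem_ball, Real.dist_eq, abs_sub_comm] at hθ
    calc |ω - θ| * R ≤ 1 / (16 * R) * R := by gcongr
      _ = 1 / 16 := by field_simp
  have h2 : ∫ p, ‖twist Φ f ω R p‖ ^ 2 ∂ν ≤ K ^ 2 * ν.real Set.univ := by
    have := integral_mono_of_nonneg (μ := ν) (f := fun p => ‖twist Φ f ω R p‖ ^ 2)
      (g := fun _ => K ^ 2) (Eventually.of_forall fun p => by positivity) (integrable_const _)
      (hK.mono fun p hp => pow_le_pow_left₀ (norm_nonneg _) hp 2)
    rwa [integral_const, smul_eq_mul, mul_comm] at this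
  rw [h.integral_norm_twist_sq ω hR.le] at h2
  rw [le_div_iff₀ (by positivity)]
  linarith

/-- A power bound for the spectral measure of balls around `ω` bounds the mean square of the
twisted integrals, by summing the kernel over dyadic annuli. -/
theorem integral_norm_twist_sq_le [IsFiniteMeasure ν] [IsFiniteMeasure σ]
    (h : IsSpectralSystem ν Φ f C σ) (ω : ℝ) {α A : ℝ} (hα : 0 < α) (hA : 0 ≤ A)
    (hσ : ∀ ρ, 0 < ρ → σ (Metric.ball ω ρ) ≤ ENNReal.ofReal (A * ρ ^ (2 - 2 * α))) :
    ∃ K, ∀ R, 0 < R → ∫ p, ‖twist Φ f ω R p‖ ^ 2 ∂ν ≤ K * R ^ (2 * α) := by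
  have hq : (4 : ℝ) ^ (-α) < 1 := Real.rpow_lt_one_of_one_lt_of_neg (by norm_num) (by linarith)
  have hq0 : (0 : ℝ) ≤ (4 : ℝ) ^ (-α) := by positivity
  refine ⟨4 * A * (1 - (4 : ℝ) ^ (-α))⁻¹, fun R hR => ?_⟩
  rw [h.integral_norm_twist_sq ω hR.le]
  have hnn : 0 ≤ 4 * A * (1 - (4 : ℝ) ^ (-α))⁻¹ * R ^ (2 * α) := by
    have : 0 < (1 - (4 : ℝ) ^ (-α))⁻¹ := inv_pos.mpr (by linarith)
    positivity
  rw [integral_eq_lintegral_of_nonneg_ae (Eventually.of_forall fun θ => by positivity)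
    (integrable_waveIntegral_sq ω hR.le).aestronglyMeasurable]
  refine ENNReal.toReal_le_of_le_ofReal hnn ?_
  have hpt : ∀ θ, ENNReal.ofReal (‖waveIntegral R (ω - θ)‖ ^ 2) ≤
      ∑' k : ℕ, (Metric.ball ω (2 ^ k / R)).indicator
        (fun _ => ENNReal.ofReal (4 * R ^ 2 * (4 ^ k)⁻¹)) θ := by
    intro θ
    by_cases h0 : |ω - θ| < 1 / R
    · refine le_trans ?_ (ENNReal.le_tsum 0)
      rw [Set.indicator_of_mem (by
        rw [Metric.mem_ball, Real.dist_eq, abs_sub_comm]; simpa using h0)]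
      refine ENNReal.ofReal_le_ofReal ?_
      have := pow_le_pow_left₀ (norm_nonneg _) (norm_waveIntegral_le hR.le (ω - θ)) 2
      have : 0 ≤ R ^ 2 := by positivity
      simp only [pow_zero, inv_one, mul_one]
      linarith
    · have hle : 1 ≤ |ω - θ| * R := by
        rw [not_lt, div_le_iff₀ hR] at h0; exact h0
      obtain ⟨k, hk1, hk2⟩ := exists_nat_pow_near hle (one_lt_two)
      refine le_trans ?_ (ENNReal.le_tsum (k + 1))
      rw [Set.indicator_of_mem (by
        rw [Metric.mem_ball, Real.dist_eq, abs_sub_comm, lt_div_iff₀ hR]; exact hk2)]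
      refine ENNReal.ofReal_le_ofReal ?_
      have hx : 0 < |ω - θ| := by
        by_contra hcon
        have : |ω - θ| = 0 := le_antisymm (not_lt.mp hcon) (abs_nonneg _)
        rw [this, zero_mul] at hle
        linarith
      have h1 := norm_waveIntegral_le_inv R (abs_pos.mp hx)
      have h2 : 1 / |ω - θ| ≤ R / 2 ^ k := by
        rw [div_le_div_iff₀ hx (by positivity)]
        linarith
      have h3 := pow_le_pow_left₀ (norm_nonneg _) (h1.trans h2) 2
      refine h3.trans (le_of_eq ?_)
      rw [div_pow, ← pow_mul, mul_comm k 2, pow_mul, pow_succ (4 : ℝ) k]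
      norm_num
      field_simp
  calc ∫⁻ θ, ENNReal.ofReal (‖waveIntegral R (ω - θ)‖ ^ 2) ∂σ
      ≤ ∫⁻ θ, ∑' k : ℕ, (Metric.ball ω (2 ^ k / R)).indicator
        (fun _ => ENNReal.ofReal (4 * R ^ 2 * (4 ^ k)⁻¹)) θ ∂σ := lintegral_mono hpt
    _ = ∑' k : ℕ, ENNReal.ofReal (4 * R ^ 2 * (4 ^ k)⁻¹) * σ (Metric.ball ω (2 ^ k / R)) := by
        rw [lintegral_tsum fun k =>
          (measurable_const.indicator Metric.isOpen_ball.measurableSet).aemeasurable]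
        refine tsum_congr fun k => ?_
        rw [lintegral_indicator_const Metric.isOpen_ball.measurableSet]
    _ ≤ ∑' k : ℕ, ENNReal.ofReal (4 * A * R ^ (2 * α) * ((4 : ℝ) ^ (-α)) ^ k) := by
        refine ENNReal.tsum_le_tsum fun k => ?_
        refine (mul_le_mul_right (hσ (2 ^ k / R) (by positivity)) _).trans (le_of_eq ?_)
        rw [← ENNReal.ofReal_mul (by positivity)]
        congr 1
        have e1 : (2 ^ k / R : ℝ) ^ (2 - 2 * α) =
            4 ^ k * ((4 : ℝ) ^ (-α)) ^ k * R ^ (2 * α) / R ^ 2 := by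
          rw [Real.div_rpow (by positivity) hR.le, Real.rpow_sub hR, ← Real.rpow_natCast 2 k,
            ← Real.rpow_mul (by norm_num), ← Real.rpow_natCast ((4 : ℝ) ^ (-α)) k,
            ← Real.rpow_mul (by norm_num), ← Real.rpow_natCast 4 k,
            ← Real.rpow_add (by norm_num), show (4 : ℝ) = 2 ^ (2 : ℝ) by norm_num,
            ← Real.rpow_mul (by norm_num), ← Real.rpow_natCast R 2]
          rw [show (k : ℝ) * (2 - 2 * α) = 2 * (k + -α * k) by ring]
          have : R ^ (2 * α) ≠ 0 := by positivity
          push_cast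
          field_simp
        rw [e1]
        field_simp
    _ = ENNReal.ofReal (∑' k : ℕ, 4 * A * R ^ (2 * α) * ((4 : ℝ) ^ (-α)) ^ k) := by
        rw [ENNReal.ofReal_tsum_of_nonneg (fun k => by positivity)
          ((summable_geometric_of_lt_one hq0 hq).mul_left _)]
    _ = ENNReal.ofReal (4 * A * (1 - (4 : ℝ) ^ (-α))⁻¹ * R ^ (2 * α)) := by
        rw [tsum_mul_left, tsum_geometric_of_lt_one hq0 hq]
        congr 1; ring

theorem integral_norm_twist_le [IsFiniteMeasure ν] [IsFiniteMeasure σ]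
    (h : IsSpectralSystem ν Φ f C σ) (ω : ℝ) {α A : ℝ} (hα : 0 < α) (hA : 0 ≤ A)
    (hσ : ∀ ρ, 0 < ρ → σ (Metric.ball ω ρ) ≤ ENNReal.ofReal (A * ρ ^ (2 - 2 * α))) :
    ∃ K, 0 ≤ K ∧ ∀ R, 0 ≤ R → ∫ p, ‖twist Φ f ω R p‖ ∂ν ≤ K * R ^ α := by
  obtain ⟨K, hK⟩ := h.integral_norm_twist_sq_le ω hα hA hσ
  refine ⟨|K| + ν.real Set.univ, by positivity, fun R hR0 => ?_⟩
  rcases hR0.eq_or_lt with rfl | hR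
  · simp [twist, Real.zero_rpow hα.ne']
  have hp : 0 < R ^ α := by positivity
  have h2 : R ^ (2 * α) = R ^ α * R ^ α := by rw [two_mul, Real.rpow_add hR]
  have hsq : Integrable (fun p => ‖twist Φ f ω R p‖ ^ 2) ν := by
    refine Integrable.of_bound
      ((h.stronglyMeasurable_twist ω hR.le).norm.pow 2).aestronglyMeasurable ((C * R) ^ 2)
      (Eventually.of_forall fun p => ?_)
    rw [Real.norm_of_nonneg (by positivity)]
    exact pow_le_pow_left₀ (norm_nonneg _) (h.norm_twist_le ω hR.le p) 2
  have hi : ∫ p, ‖twist Φ f ω R p‖ ∂ν ≤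
      ∫ p, ((R ^ α)⁻¹ * ‖twist Φ f ω R p‖ ^ 2 + R ^ α) ∂ν := by
    refine integral_mono (h.integrable_norm_twist ω hR.le)
      ((hsq.const_mul _).add (integrable_const _)) fun p => ?_
    have hx := norm_nonneg (twist Φ f ω R p)
    set x := ‖twist Φ f ω R p‖
    change x ≤ (R ^ α)⁻¹ * x ^ 2 + R ^ α
    have : (R ^ α)⁻¹ * x ^ 2 + R ^ α - x = (R ^ α)⁻¹ * ((x - R ^ α / 2) ^ 2 +
        3 / 4 * (R ^ α) ^ 2) := by field_simp; ring
    have h4 : 0 ≤ (R ^ α)⁻¹ * ((x - R ^ α / 2) ^ 2 + 3 / 4 * (R ^ α) ^ 2) := by positivity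
    linarith
  rw [integral_add (hsq.const_mul _) (integrable_const _), integral_const_mul, integral_const,
    smul_eq_mul] at hi
  refine hi.trans ?_
  rw [add_mul]
  refine add_le_add_left ?_ _
  rw [inv_mul_le_iff₀ hp]
  refine (hK R hR).trans ?_
  rw [h2]
  nlinarith [le_abs_self K, mul_pos hp hp]

/-- Time averages of the twisted integrals are controlled by the space average. -/
theorem mul_measure_le_of_timeAverage [IsFiniteMeasure ν] (h : IsSpectralSystem ν Φ f C σ) (ω : ℝ)
    {R L κ : ℝ} (hR : 0 ≤ R) (hL : 0 ≤ L)
    (hκ : ∀ᵐ p ∂ν, κ ≤ ∫ t in (0 : ℝ)..L, ‖twist Φ f ω R (Φ t p)‖) :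
    κ * ν.real Set.univ ≤ L * ∫ p, ‖twist Φ f ω R p‖ ∂ν := by
  set τ : Measure ℝ := volume.restrict (Set.Ioc 0 L) with hτ
  have hτf : IsFiniteMeasure τ := ⟨by simp [hτ]⟩
  have hm : StronglyMeasurable fun q : P × ℝ => ‖twist Φ f ω R (Φ q.2 q.1)‖ :=
    ((h.stronglyMeasurable_twist ω hR).comp_measurable
      (h.measurable_flow.comp measurable_swap)).norm
  have hi : Integrable (fun q : P × ℝ => ‖twist Φ f ω R (Φ q.2 q.1)‖) (ν.prod τ) :=
    Integrable.of_bound hm.aestronglyMeasurable (C * R) (Eventually.of_forall fun q => by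
      rw [norm_norm]; exact h.norm_twist_le ω hR _)
  have h1 : ∫ p, κ ∂ν ≤ ∫ p, ∫ t, ‖twist Φ f ω R (Φ t p)‖ ∂τ ∂ν := by
    refine integral_mono_ae (integrable_const _) hi.integral_prod_left ?_
    filter_upwards [hκ] with p hp
    rwa [intervalIntegral.integral_of_le hL] at hp
  rw [integral_integral_swap (f := fun p t => ‖twist Φ f ω R (Φ t p)‖) hi] at h1
  have h2 : ∀ t, ∫ p, ‖twist Φ f ω R (Φ t p)‖ ∂ν = ∫ p, ‖twist Φ f ω R p‖ ∂ν := by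
    intro t
    conv_rhs => rw [← (h.measurePreserving t).map_eq]
    rw [integral_map (h.measurePreserving t).measurable.aemeasurable
      (h.stronglyMeasurable_twist ω hR).norm.aestronglyMeasurable]
  simp only [h2] at h1
  rw [integral_const, integral_const, smul_eq_mul, smul_eq_mul] at h1
  have h3 : τ.real Set.univ = L := by
    simp [hτ, Measure.real, hL]
  rw [h3] at h1
  linarith

end IsSpectralSystem

/-! ### Integrals along words -/

/-- Standing assumptions on the roof vector and the components of a cylindrical function. -/
structure IsProfile (r : Fin m → ℝ) (ψ : Fin m → ℝ → ℂ) (C : ℝ) : Prop where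
  pos : ∀ b, 0 < r b
  cont : ∀ b, Continuous (ψ b)
  norm_le : ∀ b t, ‖ψ b t‖ ≤ C

/-- The length of a word, each letter `b` having length `r b`. -/
def wlen (r : Fin m → ℝ) (w : List (Fin m)) : ℝ := (w.map r).sum

theorem wlen_cons (r : Fin m → ℝ) (c : Fin m) (w : List (Fin m)) :
    wlen r (c :: w) = r c + wlen r w := by simp [wlen]

theorem wlen_nil (r : Fin m → ℝ) : wlen r [] = 0 := by simp [wlen]

theorem wlen_singleton (r : Fin m → ℝ) (c : Fin m) : wlen r [c] = r c := by simp [wlen]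

theorem wlen_append (r : Fin m → ℝ) (u v : List (Fin m)) :
    wlen r (u ++ v) = wlen r u + wlen r v := by simp [wlen]

theorem wlen_nonneg {r : Fin m → ℝ} (hr : ∀ b, 0 < r b) (w : List (Fin m)) : 0 ≤ wlen r w := by
  refine List.sum_nonneg ?_
  simp only [List.mem_map]
  rintro _ ⟨c, -, rfl⟩
  exact (hr c).le

theorem wlen_word (r : Fin m → ℝ) (ζ : Substitution m) (b : Fin m) :
    wlen r (ζ.word b) = ζ.transposeMul r b := (ζ.transposeMul_apply r b).symm

/-- The function on `[0, |w|)` obtained by placing the components `ψ_c` one after the other along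
the word `w`. -/
noncomputable def conc (r : Fin m → ℝ) (ψ : Fin m → ℝ → ℂ) : List (Fin m) → ℝ → ℂ
  | [], _ => 0
  | c :: w, t => if t < r c then ψ c t else conc r ψ w (t - r c)

/-- From position `τ` on, the function `g` follows the components `ψ` along the word `w`. -/
def Reads (r : Fin m → ℝ) (ψ : Fin m → ℝ → ℂ) (g : ℝ → ℂ) (τ : ℝ) (w : List (Fin m)) : Prop :=
  ∀ t, 0 ≤ t → t < wlen r w → g (τ + t) = conc r ψ w t

/-- The twisted integral over `[0, u]` along the word `w`. -/
noncomputable def wordInt (ω : ℝ) (r : Fin m → ℝ) (ψ : Fin m → ℝ → ℂ) (w : List (Fin m))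
    (u : ℝ) : ℂ := ∫ t in (0 : ℝ)..u, wave ω t * conc r ψ w t

/-- The twisted integral along the whole word `w`. -/
noncomputable def wordTotal (ω : ℝ) (r : Fin m → ℝ) (ψ : Fin m → ℝ → ℂ) (w : List (Fin m)) : ℂ :=
  wordInt ω r ψ w (wlen r w)

section

variable {r : Fin m → ℝ} {ψ : Fin m → ℝ → ℂ} {C : ℝ}

theorem conc_append (hr : ∀ b, 0 < r b) (u v : List (Fin m)) {t : ℝ} (ht : 0 ≤ t) :
    conc r ψ (u ++ v) t = if t < wlen r u then conc r ψ u t else conc r ψ v (t - wlen r u) := by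
  induction u generalizing t with
  | nil => simp [wlen_nil, not_lt.mpr ht]
  | cons c u ih =>
    simp only [List.cons_append, conc, wlen_cons]
    have := wlen_nonneg hr u
    by_cases h : t < r c
    · rw [if_pos h, if_pos (by linarith), if_pos h]
    · rw [if_neg h, ih (by linarith), if_neg h]
      congr 1
      · rw [eq_iff_iff]; constructor <;> intro <;> linarith
      · congr 1; ring

theorem measurable_conc (h : IsProfile r ψ C) (w : List (Fin m)) : Measurable (conc r ψ w) := by
  induction w with
  | nil => exact measurable_const
  | cons c w ih =>
    exact Measurable.ite measurableSet_Iio (h.cont c).measurable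
      (ih.comp (measurable_id.sub_const _))

theorem norm_conc_le (h : IsProfile r ψ C) (hC : 0 ≤ C) (w : List (Fin m)) (t : ℝ) :
    ‖conc r ψ w t‖ ≤ C := by
  induction w generalizing t with
  | nil => simpa [conc] using hC
  | cons c w ih =>
    simp only [conc]
    split_ifs
    · exact h.norm_le c t
    · exact ih _

theorem intervalIntegrable_wave_mul (ω : ℝ) {g : ℝ → ℂ} (hg : Measurable g)
    (hC : ∀ t, ‖g t‖ ≤ C) (a b : ℝ) :
    IntervalIntegrable (fun t => wave ω t * g t) volume a b := by
  rw [intervalIntegrable_iff]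
  refine Measure.integrableOn_of_bounded (M := C) (by simp)
    ((continuous_wave ω).measurable.mul hg).aestronglyMeasurable
    (Eventually.of_forall fun t => ?_)
  rw [norm_mul, norm_wave, one_mul]
  exact hC t

theorem Reads.append (hr : ∀ b, 0 < r b) {g : ℝ → ℂ} {τ : ℝ} {u v : List (Fin m)}
    (h1 : Reads r ψ g τ u) (h2 : Reads r ψ g (τ + wlen r u) v) : Reads r ψ g τ (u ++ v) := by
  intro t ht0 ht
  rw [conc_append hr u v ht0]
  split_ifs with h
  · exact h1 t ht0 h
  · rw [wlen_append] at ht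
    have := h2 (t - wlen r u) (by linarith) (by linarith)
    rw [← this]; congr 1; ring

theorem Reads.left (hr : ∀ b, 0 < r b) {g : ℝ → ℂ} {τ : ℝ} {u v : List (Fin m)}
    (h : Reads r ψ g τ (u ++ v)) : Reads r ψ g τ u := by
  intro t ht0 ht
  have := wlen_nonneg hr v
  rw [h t ht0 (by rw [wlen_append]; linarith), conc_append hr u v ht0, if_pos ht]

theorem Reads.right (hr : ∀ b, 0 < r b) {g : ℝ → ℂ} {τ : ℝ} {u v : List (Fin m)}
    (h : Reads r ψ g τ (u ++ v)) : Reads r ψ g (τ + wlen r u) v := by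
  intro t ht0 ht
  have := wlen_nonneg hr u
  have h1 := h (wlen r u + t) (by linarith) (by rw [wlen_append]; linarith)
  rw [conc_append hr u v (by linarith), if_neg (by linarith), add_sub_cancel_left] at h1
  rw [add_assoc, h1]

theorem reads_conc (w : List (Fin m)) : Reads r ψ (conc r ψ w) 0 w := fun t _ _ => by
  rw [zero_add]

theorem Reads.integral (ω : ℝ) {g : ℝ → ℂ} {τ : ℝ} {w : List (Fin m)} (h : Reads r ψ g τ w)
    {u : ℝ} (hu0 : 0 ≤ u) (hu : u ≤ wlen r w) :
    ∫ t in τ..(τ + u), wave ω t * g t = wave ω τ * wordInt ω r ψ w u := by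
  have h1 : ∫ t in τ..(τ + u), wave ω t * g t =
      ∫ t in (0 : ℝ)..u, wave ω (τ + t) * g (τ + t) := by
    rw [intervalIntegral.integral_comp_add_left (fun t => wave ω t * g t)]
    simp
  rw [h1, wordInt, ← intervalIntegral.integral_const_mul]
  refine intervalIntegral.integral_congr_ae ?_
  have hne : ∀ᵐ t : ℝ, t ≠ u := by simp [ae_iff]
  filter_upwards [hne] with t ht hmem
  rw [Set.uIoc_of_le hu0] at hmem
  rw [h t hmem.1.le (lt_of_lt_of_le (lt_of_le_of_ne hmem.2 ht) hu), wave_add]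
  ring

theorem Reads.integral_sub (ω : ℝ) {g : ℝ → ℂ} (hg : Measurable g) (hC : ∀ t, ‖g t‖ ≤ C) {τ : ℝ}
    {w : List (Fin m)} (h : Reads r ψ g τ w) {u v : ℝ} (hu0 : 0 ≤ u) (hu : u ≤ wlen r w)
    (hv0 : 0 ≤ v) (hv : v ≤ wlen r w) :
    ∫ t in (τ + u)..(τ + v), wave ω t * g t =
      wave ω τ * (wordInt ω r ψ w v - wordInt ω r ψ w u) := by
  rw [mul_sub, ← h.integral ω hu0 hu, ← h.integral ω hv0 hv]
  exact (intervalIntegral.integral_interval_sub_left (intervalIntegrable_wave_mul ω hg hC _ _)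
    (intervalIntegrable_wave_mul ω hg hC _ _)).symm

theorem wordInt_append_left (hr : ∀ b, 0 < r b) (ω : ℝ) (u v : List (Fin m)) {t : ℝ} (h0 : 0 ≤ t)
    (ht : t ≤ wlen r u) : wordInt ω r ψ (u ++ v) t = wordInt ω r ψ u t := by
  have := ((reads_conc (r := r) (ψ := ψ) (u ++ v)).left hr).integral ω h0 ht
  rwa [zero_add, wave_zero, one_mul] at this

theorem wordInt_append_right (h : IsProfile r ψ C) (hC : 0 ≤ C) (ω : ℝ) (u v : List (Fin m))
    {t : ℝ} (h0 : 0 ≤ t) (ht : t ≤ wlen r v) : wordInt ω r ψ (u ++ v) (wlen r u + t) =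
      wordTotal ω r ψ u + wave ω (wlen r u) * wordInt ω r ψ v t := by
  have h1 := ((reads_conc (r := r) (ψ := ψ) (u ++ v)).right h.pos).integral ω h0 ht
  rw [zero_add] at h1
  rw [← h1, wordTotal, ← wordInt_append_left h.pos ω u v (wlen_nonneg h.pos u) le_rfl, wordInt,
    wordInt, intervalIntegral.integral_add_adjacent_intervals] <;>
  exact intervalIntegrable_wave_mul ω (measurable_conc h _) (norm_conc_le h hC _) _ _

theorem wordTotal_append (h : IsProfile r ψ C) (hC : 0 ≤ C) (ω : ℝ) (u v : List (Fin m)) :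
    wordTotal ω r ψ (u ++ v) =
      wordTotal ω r ψ u + wave ω (wlen r u) * wordTotal ω r ψ v := by
  rw [wordTotal, wlen_append, wordInt_append_right h hC ω u v (wlen_nonneg h.pos v) le_rfl]
  rfl

theorem wordTotal_nil (ω : ℝ) : wordTotal ω r ψ [] = 0 := by
  simp [wordTotal, wordInt, wlen_nil]

theorem wordInt_zero (ω : ℝ) (w : List (Fin m)) : wordInt ω r ψ w 0 = 0 := by simp [wordInt]

theorem wordTotal_flatMap (h : IsProfile r ψ C) (hC : 0 ≤ C) (ω : ℝ) (ζ : Substitution m)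
    (w : List (Fin m)) : wordTotal ω r ψ (w.flatMap ζ.word) =
      wordSum ω (ζ.transposeMul r) (fun c => wordTotal ω r ψ (ζ.word c)) w := by
  induction w with
  | nil => simp [wordTotal_nil, wordSum]
  | cons c w ih =>
    rw [List.flatMap_cons, wordTotal_append h hC, ih, wordSum, wlen_word]

/-- The cocycle iterates the twisted integrals along the words `ζ^{[n]}(c)`. -/
theorem cocycle_mulVec_eq_wordTotal (h : IsProfile r ψ C) (hC : 0 ≤ C) (b : ℕ → Substitution m)
    (ω : ℝ) (ξ : Fin m → ℝ) (hξ : ∀ c, ∃ k : ℤ, ξ c = ω * r c + k) (z : Fin m → ℂ)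
    (hz : ∀ c, z c = wordTotal ω r ψ [c]) (n : ℕ) (c : Fin m) :
    (cocycle b ξ n *ᵥ z) c = wordTotal ω r ψ ((iter b n).word c) := by
  induction n generalizing c with
  | zero => simpa [cocycle, iter, Substitution.one] using hz c
  | succ n ih =>
    rw [cocycle_succ_mulVec b ω r ξ hξ, funext ih, ← wordTotal_flatMap h hC]
    rfl

theorem norm_wordInt_le (h : IsProfile r ψ C) (hC : 0 ≤ C) (ω : ℝ) (w : List (Fin m)) {u : ℝ}
    (hu : 0 ≤ u) : ‖wordInt ω r ψ w u‖ ≤ C * u := by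
  have := intervalIntegral.norm_integral_le_of_norm_le_const (a := 0) (b := u) (C := C)
    (f := fun t => wave ω t * conc r ψ w t) fun t _ => by
      rw [norm_mul, norm_wave, one_mul]; exact norm_conc_le h hC w t
  simpa [wordInt, abs_of_nonneg hu] using this

theorem continuous_wordInt (h : IsProfile r ψ C) (hC : 0 ≤ C) (ω : ℝ) (w : List (Fin m)) :
    Continuous (wordInt ω r ψ w) :=
  intervalIntegral.continuous_primitive (fun a b =>
    intervalIntegrable_wave_mul ω (measurable_conc h w) (norm_conc_le h hC w) a b) 0

/-- An initial segment of a concatenation of words consists of whole words and an initial segment of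
a single one. -/
theorem norm_wordInt_flatMap_le (h : IsProfile r ψ C) (hC : 0 ≤ C) (ω : ℝ) (ζ : Substitution m)
    {A B : ℝ} (hA : ∀ c, ‖wordTotal ω r ψ (ζ.word c)‖ ≤ A)
    (hB : ∀ c, ∀ u ∈ Set.Icc 0 (wlen r (ζ.word c)), ‖wordInt ω r ψ (ζ.word c) u‖ ≤ B)
    (hB0 : 0 ≤ B) (w : List (Fin m)) :
    ∀ u ∈ Set.Icc 0 (wlen r (w.flatMap ζ.word)),
      ‖wordInt ω r ψ (w.flatMap ζ.word) u‖ ≤ w.length * A + B := by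
  induction w with
  | nil =>
    intro u hu
    have : u = 0 := by
      have := hu.2; simp only [List.flatMap_nil, wlen_nil] at this; exact le_antisymm this hu.1
    simp [this, wordInt_zero, hB0]
  | cons c w ih =>
    intro u hu
    have hA0 : 0 ≤ A := (norm_nonneg _).trans (hA c)
    rw [List.flatMap_cons] at hu ⊢
    rcases le_total u (wlen r (ζ.word c)) with hc | hc
    · rw [wordInt_append_left h.pos ω _ _ hu.1 hc]
      have := hB c u ⟨hu.1, hc⟩
      have : 0 ≤ ((c :: w).length : ℝ) * A := by positivity
      linarith
    · have hu2 := hu.2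
      rw [wlen_append] at hu2
      have e := wordInt_append_right h hC ω (ζ.word c) (w.flatMap ζ.word)
        (t := u - wlen r (ζ.word c)) (by linarith) (by linarith)
      rw [add_sub_cancel] at e
      rw [e]
      refine (norm_add_le _ _).trans ?_
      rw [norm_mul, norm_wave, one_mul]
      have h1 := ih (u - wlen r (ζ.word c)) ⟨by linarith, by linarith⟩
      have h2 := hA c
      rw [List.length_cons]
      push_cast
      linarith

end

/-! ### Mean values of the twisted integrals along words -/

theorem lintegral_lintegral_sub_le {F : ℝ → ℂ} (hF : Continuous F) {ρ K : ℝ} (hρ : 0 ≤ ρ)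
    (hK : ∀ R, 0 ≤ R → R ≤ ρ → ∫ u in (0 : ℝ)..(ρ - R), ‖F (u + R) - F u‖ ≤ K) :
    ∫⁻ u in Set.Icc 0 ρ, ∫⁻ v in Set.Icc 0 ρ, ENNReal.ofReal ‖F u - F v‖ ≤
      ENNReal.ofReal (2 * ρ * K) := by
  set G : ℝ → ℝ → ENNReal := fun u v => (Set.Icc 0 ρ).indicator
    (fun _ => (Set.Icc 0 ρ).indicator (fun v => ENNReal.ofReal ‖F u - F v‖) v) u with hG
  have hGm : Measurable (Function.uncurry G) := by
    have h1 : Measurable fun q : ℝ × ℝ => ENNReal.ofReal ‖F q.1 - F q.2‖ := by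
      have := hF.measurable
      fun_prop
    exact (h1.indicator (measurable_snd measurableSet_Icc)).indicator
      (measurable_fst measurableSet_Icc)
  have h1 : ∫⁻ u in Set.Icc 0 ρ, ∫⁻ v in Set.Icc 0 ρ, ENNReal.ofReal ‖F u - F v‖ =
      ∫⁻ u, ∫⁻ v, G u v := by
    rw [← lintegral_indicator measurableSet_Icc]
    refine lintegral_congr fun u => ?_
    by_cases h1 : u ∈ Set.Icc 0 ρ
    · rw [Set.indicator_of_mem h1, ← lintegral_indicator measurableSet_Icc]
      refine lintegral_congr fun v => ?_
      simp only [hG, Set.indicator_of_mem h1]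
    · rw [Set.indicator_of_notMem h1]
      simp [hG, Set.indicator_of_notMem h1]
  have h2 : ∀ u, ∫⁻ v, G u v = ∫⁻ R, G u (R + u) := fun u =>
    (lintegral_add_right_eq_self (fun v => G u v) u).symm
  rw [h1]
  simp only [h2]
  rw [lintegral_lintegral_swap (f := fun u R => G u (R + u))
    (hGm.comp (measurable_fst.prodMk (measurable_snd.add measurable_fst))).aemeasurable]
  have hpos : ∀ R, 0 ≤ R → R ≤ ρ → ∫⁻ u, G u (R + u) ≤ ENNReal.ofReal K := by
    intro R h0 hR
    have e : ∫⁻ u, G u (R + u) ≤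
        ∫⁻ u in Set.Ioc 0 (ρ - R), ENNReal.ofReal ‖F (u + R) - F u‖ := by
      rw [Measure.restrict_congr_set Ioc_ae_eq_Icc, ← lintegral_indicator measurableSet_Icc]
      refine lintegral_mono fun u => ?_
      simp only [hG, Set.indicator]
      split_ifs with a1 a2 a3
      · rw [norm_sub_rev, add_comm R u]
      · exact absurd ⟨a1.1, by linarith [a2.2]⟩ a3
      all_goals exact bot_le
    refine e.trans ?_
    rw [← ofReal_integral_eq_lintegral_ofReal]
    · refine ENNReal.ofReal_le_ofReal ?_
      have := hK R h0 hR
      rwa [intervalIntegral.integral_of_le (by linarith)] at this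
    · exact ((by fun_prop : Continuous fun u => ‖F (u + R) - F u‖).integrableOn_Ioc)
    · exact Eventually.of_forall fun u => norm_nonneg _
  have hall : ∀ R, ∫⁻ u, G u (R + u) ≤
      (Set.Icc (-ρ) ρ).indicator (fun _ => ENNReal.ofReal K) R := by
    intro R
    by_cases hR : R ∈ Set.Icc (-ρ) ρ
    · rw [Set.indicator_of_mem hR]
      rcases le_total 0 R with h0 | h0
      · exact hpos R h0 hR.2
      · rw [← lintegral_add_right_eq_self _ (-R)]
        refine le_of_eq_of_le (lintegral_congr fun u => ?_)
          (hpos (-R) (by linarith) (by linarith [hR.1]))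
        simp only [hG, Set.indicator, show R + (u + -R) = u by ring, add_comm (-R) u]
        split_ifs <;> first | rfl | rw [norm_sub_rev]
    · rw [Set.indicator_of_notMem hR, nonpos_iff_eq_zero,
        ← lintegral_zero (μ := (volume : Measure ℝ))]
      refine lintegral_congr fun u => ?_
      simp only [hG, Set.indicator]
      split_ifs with a1 a2
      · exact absurd ⟨by linarith [a1.2, a2.1], by linarith [a1.1, a2.2]⟩ hR
      all_goals rfl
  refine (lintegral_mono hall).trans ?_
  rw [lintegral_indicator_const measurableSet_Icc, Real.volume_Icc, mul_comm,
    ← ENNReal.ofReal_mul (by linarith)]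
  refine le_of_eq ?_
  congr 1; ring

/-- If the increments of `F` over `[0, ρ]` are small on average, then the mean value of `F` over
`[0, ρ]` is close to the mean value over any subinterval. -/
theorem norm_mean_sub_mean_le {F : ℝ → ℂ} (hF : Continuous F) {ρ K : ℝ} (hρ : 0 < ρ)
    (hK : ∀ R, 0 ≤ R → R ≤ ρ → ∫ u in (0 : ℝ)..(ρ - R), ‖F (u + R) - F u‖ ≤ K)
    {x ρ₁ : ℝ} (hx : 0 ≤ x) (hρ₁ : 0 < ρ₁) (hxρ : x + ρ₁ ≤ ρ) :
    ‖(∫ u in (0 : ℝ)..ρ, F u) / ρ - (∫ u in x..(x + ρ₁), F u) / ρ₁‖ ≤ 2 * K / ρ₁ := by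
  have hK0 : 0 ≤ K := by
    have := hK ρ hρ.le le_rfl
    simpa using this
  have hcont : Continuous fun q : ℝ × ℝ => ‖F q.1 - F q.2‖ := by fun_prop
  have hH : Continuous fun u => ∫ v in (0 : ℝ)..ρ, ‖F u - F v‖ :=
    intervalIntegral.continuous_parametric_intervalIntegral_of_continuous' hcont 0 ρ
  have hH0 : ∀ u, 0 ≤ ∫ v in (0 : ℝ)..ρ, ‖F u - F v‖ := fun u =>
    intervalIntegral.integral_nonneg hρ.le fun v _ => norm_nonneg _
  have h1 : ∫ u in (0 : ℝ)..ρ, ∫ v in (0 : ℝ)..ρ, ‖F u - F v‖ ≤ 2 * ρ * K := by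
    rw [intervalIntegral.integral_of_le hρ.le, integral_eq_lintegral_of_nonneg_ae
      (Eventually.of_forall hH0) hH.aestronglyMeasurable]
    refine ENNReal.toReal_le_of_le_ofReal (by positivity) ?_
    refine le_of_eq_of_le ?_ (lintegral_lintegral_sub_le hF hρ.le hK)
    rw [← Measure.restrict_congr_set Ioc_ae_eq_Icc]
    refine lintegral_congr fun u => ?_
    rw [intervalIntegral.integral_of_le hρ.le, ofReal_integral_eq_lintegral_ofReal]
    · exact (by fun_prop : Continuous fun v => ‖F u - F v‖).integrableOn_Ioc
    · exact Eventually.of_forall fun v => norm_nonneg _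
  have h2 : ∫ u in x..(x + ρ₁), ∫ v in (0 : ℝ)..ρ, ‖F u - F v‖ ≤ 2 * ρ * K :=
    (intervalIntegral.integral_mono_interval hx (by linarith) hxρ
      (Eventually.of_forall hH0) (hH.intervalIntegrable _ _)).trans h1
  have h3 : ∫ u in x..(x + ρ₁), ∫ v in (0 : ℝ)..ρ, (F u - F v) =
      ρ * (∫ u in x..(x + ρ₁), F u) - ρ₁ * ∫ v in (0 : ℝ)..ρ, F v := by
    have : ∀ u, ∫ v in (0 : ℝ)..ρ, (F u - F v) = ρ * F u - ∫ v in (0 : ℝ)..ρ, F v := by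
      intro u
      rw [intervalIntegral.integral_sub (by simp) (hF.intervalIntegrable _ _)]
      simp
    simp only [this]
    rw [intervalIntegral.integral_sub ((hF.const_mul _ |>.intervalIntegrable) _ _) (by simp),
      intervalIntegral.integral_const_mul]
    simp
  have h4 : ‖ρ * (∫ u in x..(x + ρ₁), F u) - ρ₁ * ∫ v in (0 : ℝ)..ρ, F v‖ ≤ 2 * ρ * K := by
    rw [← h3]
    refine le_trans ?_ h2
    refine (intervalIntegral.norm_integral_le_integral_norm (by linarith)).trans ?_
    refine intervalIntegral.integral_mono_on (by linarith) ?_ (hH.intervalIntegrable _ _)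
      fun u _ => intervalIntegral.norm_integral_le_integral_norm hρ.le
    have hc : Continuous fun q : ℝ × ℝ => F q.1 - F q.2 := by fun_prop
    exact (intervalIntegral.continuous_parametric_intervalIntegral_of_continuous' hc
      0 ρ).norm.intervalIntegrable _ _
  have h5 : (∫ u in (0 : ℝ)..ρ, F u) / ρ - (∫ u in x..(x + ρ₁), F u) / ρ₁ =
      -(ρ * (∫ u in x..(x + ρ₁), F u) - ρ₁ * ∫ v in (0 : ℝ)..ρ, F v) / (ρ * ρ₁ : ℝ) := by
    have e1 : (ρ : ℂ) ≠ 0 := by exact_mod_cast hρ.ne'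
    have e2 : (ρ₁ : ℂ) ≠ 0 := by exact_mod_cast hρ₁.ne'
    push_cast
    field_simp
    ring
  rw [h5, norm_div, norm_neg, Complex.norm_real, Real.norm_of_nonneg (by positivity),
    div_le_div_iff₀ (by positivity) hρ₁]
  nlinarith

section

variable {r : Fin m → ℝ} {ψ : Fin m → ℝ → ℂ} {C : ℝ}

/-- The mean value over a word of the twisted integral from the beginning of the word. -/
noncomputable def headMean (ω : ℝ) (r : Fin m → ℝ) (ψ : Fin m → ℝ → ℂ) (w : List (Fin m)) : ℂ :=
  (∫ u in (0 : ℝ)..(wlen r w), wordInt ω r ψ w u) / (wlen r w : ℝ)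

/-- The mean value over a word of the twisted integral up to the end of the word. -/
noncomputable def tailMean (ω : ℝ) (r : Fin m → ℝ) (ψ : Fin m → ℝ → ℂ) (w : List (Fin m)) : ℂ :=
  wordTotal ω r ψ w - headMean ω r ψ w

/-- `K` bounds the averaged increments of the twisted integral along the word `w`. -/
def IncrementBound (ω : ℝ) (r : Fin m → ℝ) (ψ : Fin m → ℝ → ℂ) (w : List (Fin m)) (K : ℝ) : Prop :=
  ∀ R, 0 ≤ R → R ≤ wlen r w → ∫ u in (0 : ℝ)..(wlen r w - R),
    ‖wordInt ω r ψ w (u + R) - wordInt ω r ψ w u‖ ≤ K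

/-- Small averaged increments make the mean of the twisted integral over a word comparable to its
mean over a prefix. -/
theorem norm_headMean_append_sub_le (h : IsProfile r ψ C) (hC : 0 ≤ C) (ω : ℝ)
    (v u : List (Fin m)) (hv : 0 < wlen r v) {K : ℝ} (hK : IncrementBound ω r ψ (v ++ u) K) :
    ‖headMean ω r ψ (v ++ u)‖ ≤ ‖headMean ω r ψ v‖ + 2 * K / wlen r v := by
  have hu := wlen_nonneg h.pos u
  have hlen := wlen_append r v u
  have h1 := norm_mean_sub_mean_le (continuous_wordInt h hC ω (v ++ u)) (by linarith) hK
    (x := 0) le_rfl hv (by linarith)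
  have h2 : ∫ t in (0 : ℝ)..(0 + wlen r v), wordInt ω r ψ (v ++ u) t =
      ∫ t in (0 : ℝ)..(wlen r v), wordInt ω r ψ v t := by
    rw [zero_add]
    refine intervalIntegral.integral_congr fun t ht => ?_
    rw [Set.uIcc_of_le hv.le] at ht
    exact wordInt_append_left h.pos ω v u ht.1 ht.2
  rw [h2] at h1
  have h3 := norm_le_norm_add_norm_sub' (headMean ω r ψ (v ++ u)) (headMean ω r ψ v)
  exact h3.trans (by gcongr; exact h1)

theorem norm_tailMean_append_sub_le (h : IsProfile r ψ C) (hC : 0 ≤ C) (ω : ℝ)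
    (u v : List (Fin m)) (hv : 0 < wlen r v) {K : ℝ} (hK : IncrementBound ω r ψ (u ++ v) K) :
    ‖tailMean ω r ψ (u ++ v)‖ ≤ ‖tailMean ω r ψ v‖ + 2 * K / wlen r v := by
  have hu := wlen_nonneg h.pos u
  have hlen := wlen_append r u v
  have h1 := norm_mean_sub_mean_le (continuous_wordInt h hC ω (u ++ v)) (by linarith) hK
    (x := wlen r u) hu hv (by linarith)
  have hv' : (wlen r v : ℂ) ≠ 0 := by exact_mod_cast hv.ne'
  have h2 : (∫ t in (wlen r u)..(wlen r u + wlen r v), wordInt ω r ψ (u ++ v) t) / (wlen r v : ℂ) =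
      wordTotal ω r ψ u + wave ω (wlen r u) * headMean ω r ψ v := by
    have e : ∫ t in (wlen r u)..(wlen r u + wlen r v), wordInt ω r ψ (u ++ v) t =
        ∫ t in (0 : ℝ)..(wlen r v), wordInt ω r ψ (u ++ v) (wlen r u + t) := by
      rw [intervalIntegral.integral_comp_add_left (fun t => wordInt ω r ψ (u ++ v) t)]
      simp
    have e2 : ∫ t in (0 : ℝ)..(wlen r v), wordInt ω r ψ (u ++ v) (wlen r u + t) =
        ∫ t in (0 : ℝ)..(wlen r v),
          (wordTotal ω r ψ u + wave ω (wlen r u) * wordInt ω r ψ v t) := by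
      refine intervalIntegral.integral_congr fun t ht => ?_
      rw [Set.uIcc_of_le hv.le] at ht
      exact wordInt_append_right h hC ω u v ht.1 ht.2
    rw [e, e2, intervalIntegral.integral_add (by simp)
      ((continuous_wordInt h hC ω v).const_mul _ |>.intervalIntegrable _ _),
      intervalIntegral.integral_const_mul, headMean]
    simp
    field_simp
  rw [h2] at h1
  have h3 : tailMean ω r ψ (u ++ v) = wave ω (wlen r u) * tailMean ω r ψ v -
      (headMean ω r ψ (u ++ v) - (wordTotal ω r ψ u + wave ω (wlen r u) * headMean ω r ψ v)) := by
    rw [tailMean, tailMean, wordTotal_append h hC]; ring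
  rw [h3]
  refine (norm_sub_le _ _).trans ?_
  rw [norm_mul, norm_wave, one_mul]
  gcongr
  exact h1

end

/-! ### Tilings of orbits by the words of a given level -/

/-- The line is tiled by the words `η(c)`, along which the function `g` follows the components
`ψ`. -/
def Tiled (r : Fin m → ℝ) (ψ : Fin m → ℝ → ℂ) (η : Substitution m) (g : ℝ → ℂ) : Prop :=
  ∃ (y : ℤ → Fin m) (τ : ℝ), ∀ j,
    Reads r ψ g (τ + cumul (η.transposeMul r) y j) (η.word (y j))

/-- Along every orbit, a cylindrical function is tiled by the words of every level. -/
theorem CylValue.tiled {a : ℕ → Substitution m} {s : Fin m → ℝ} (hs : ∀ b, 0 < s b) {l : ℕ}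
    {ψ : Fin m → ℝ → ℂ} {f : (ℤ → Fin m) × ℝ → ℂ} (hf : CylValue a s l ψ f)
    {p : (ℤ → Fin m) × ℝ} (hp : p ∈ suspSpace a s) (n : ℕ) :
    Tiled (levelRoof a s l) ψ (iter (tailSeq a l) n) (fun t => f (flow s t p)) := by
  have hr : ∀ b, 0 < levelRoof a s l b := (iter a l).transposeMul_pos hs
  obtain ⟨x, hx, k, -, -, hk⟩ := exists_orbit hs l hp
  set τ := cumul s ((iter a l).onSeq x) k + p.2
  have hseg : ∀ (i : ℤ) (q : ℕ), Reads (levelRoof a s l) ψ (fun t => f (flow s t p))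
      (cumul (levelRoof a s l) x i - τ) (seg x i q) := by
    intro i q
    induction q with
    | zero =>
      intro t h1 h2
      simp only [seg, List.ofFn_zero, wlen_nil] at h2
      exact absurd h1 (not_le.mpr h2)
    | succ q ih =>
      rw [seg_succ]
      refine ih.append hr ?_
      intro t h1 h2
      rw [wlen_singleton] at h2
      have e : cumul (levelRoof a s l) x i - τ + wlen (levelRoof a s l) (seg x i q) + t + τ =
          cumul (levelRoof a s l) x (i + q) + t := by
        rw [cumul_add_seg, wlen]; ring
      rw [hk]
      beta_reduce
      rw [flow_flow hs, e, hf.block hs hx _ h1 h2, conc, if_pos h2]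
  obtain ⟨y, -, k', -, hxy⟩ := exists_desubstitution (tailSeq a l) n hx
  set η := iter (tailSeq a l) n with hη
  refine ⟨y, -τ - cumul (levelRoof a s l) (η.onSeq y) k', fun j => ?_⟩
  have h := hseg (cumul η.len y j - k') (η.word (y j)).length
  have e1 : seg x (cumul η.len y j - k') (η.word (y j)).length = η.word (y j) := by
    rw [hxy, seg_shift, add_sub_cancel, η.seg_block]
  have e2 : cumul (levelRoof a s l) x (cumul η.len y j - k') - τ =
      -τ - cumul (levelRoof a s l) (η.onSeq y) k' + cumul (η.transposeMul (levelRoof a s l)) y j := by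
    rw [hxy, cumul_shift, add_sub_cancel, η.cumul_onSeq]; ring
  rwa [e1, e2] at h

section

variable {r : Fin m → ℝ} {ψ : Fin m → ℝ → ℂ} {C : ℝ}

/-- An interval shorter than all the words of a tiling meets at most two of them. -/
theorem Tiled.norm_integral_le (hr : ∀ b, 0 < r b) {η : Substitution m} {g : ℝ → ℂ}
    (h : Tiled r ψ η g) (hg : Measurable g) (hC : ∀ t, ‖g t‖ ≤ C) (ω : ℝ) {B : ℝ}
    (hB : ∀ c, ∀ u ∈ Set.Icc 0 (wlen r (η.word c)), ‖wordInt ω r ψ (η.word c) u‖ ≤ B)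
    {R : ℝ} (hR0 : 0 ≤ R) (hR : ∀ c, R ≤ wlen r (η.word c)) :
    ‖∫ t in (0 : ℝ)..R, wave ω t * g t‖ ≤ 4 * B := by
  obtain ⟨y, τ, hy⟩ := h
  set ρ := η.transposeMul r with hρ
  have hρpos : ∀ b, 0 < ρ b := η.transposeMul_pos hr
  obtain ⟨h1, h2⟩ := locate_spec hρpos y (-τ)
  set j := locate ρ y (-τ)
  have hwl : ∀ c, wlen r (η.word c) = ρ c := wlen_word r η
  have piece : ∀ (i : ℤ) (u v : ℝ), 0 ≤ u → u ≤ ρ (y i) → 0 ≤ v → v ≤ ρ (y i) →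
      ‖∫ t in (τ + cumul ρ y i + u)..(τ + cumul ρ y i + v), wave ω t * g t‖ ≤ 2 * B := by
    intro i u v hu0 hu hv0 hv
    rw [← hwl] at hu hv
    rw [(hy i).integral_sub ω hg hC hu0 hu hv0 hv, norm_mul, norm_wave, one_mul]
    have e1 := hB (y i) u ⟨hu0, hu⟩
    have e2 := hB (y i) v ⟨hv0, hv⟩
    exact (norm_sub_le _ _).trans (by linarith)
  have hB0 : 0 ≤ B := (norm_nonneg _).trans (hB (y 0) 0 ⟨le_rfl, wlen_nonneg hr _⟩)
  rw [cumul_succ] at h2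
  have hs := cumul_succ ρ y j
  rcases le_total R (τ + cumul ρ y (j + 1)) with hc | hc
  · have := piece j (-(τ + cumul ρ y j)) (R - (τ + cumul ρ y j)) (by linarith) (by linarith)
      (by linarith) (by linarith)
    rw [add_neg_cancel, add_sub_cancel] at this
    linarith
  · have e1 := piece j (-(τ + cumul ρ y j)) (ρ (y j)) (by linarith) (by linarith)
      (by linarith [hρpos (y j)]) le_rfl
    have hR' := hR (y (j + 1))
    rw [hwl] at hR'
    have e2 := piece (j + 1) 0 (R - (τ + cumul ρ y (j + 1))) le_rfl (hρpos _).le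
      (by linarith) (by linarith)
    rw [add_neg_cancel, add_assoc, ← hs] at e1
    rw [add_zero, add_sub_cancel] at e2
    rw [← intervalIntegral.integral_add_adjacent_intervals
      (intervalIntegrable_wave_mul ω hg hC _ _) (intervalIntegrable_wave_mul ω hg hC _ _)]
    exact (norm_add_le _ _).trans (by linarith)

theorem Tiled.exists_reads (hr : ∀ b, 0 < r b) {η : Substitution m} {g : ℝ → ℂ}
    (h : Tiled r ψ η g) {M : ℝ} (hM : ∀ c, wlen r (η.word c) ≤ M) {w : List (Fin m)}
    (hw : ∀ c, w <:+: η.word c) :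
    ∃ τ, 0 ≤ τ ∧ τ + wlen r w ≤ 2 * M ∧ Reads r ψ g τ w := by
  obtain ⟨y, τ, hy⟩ := h
  set ρ := η.transposeMul r with hρ
  have hρpos : ∀ b, 0 < ρ b := η.transposeMul_pos hr
  obtain ⟨h1, h2⟩ := locate_spec hρpos y (-τ)
  set j := locate ρ y (-τ)
  have hwl : ∀ c, wlen r (η.word c) = ρ c := wlen_word r η
  have hs := cumul_succ ρ y j
  obtain ⟨u, v, huv⟩ := hw (y (j + 1))
  have hread := hy (j + 1)
  have hlen : wlen r u + wlen r w + wlen r v = ρ (y (j + 1)) := by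
    rw [← hwl, ← huv, wlen_append, wlen_append]
  rw [← huv] at hread
  have h3 := (hread.left hr).right hr
  have hM1 := hM (y j)
  have hM2 := hM (y (j + 1))
  rw [hwl] at hM1 hM2
  have := wlen_nonneg hr u
  have := wlen_nonneg hr v
  exact ⟨_, by linarith, by linarith, h3⟩

/-- Increments of the twisted integral along a word are seen on every orbit that reads it. -/
theorem Reads.integral_increment_le {g : ℝ → ℂ} (hg : Measurable g) (hC : ∀ t, ‖g t‖ ≤ C) (ω : ℝ)
    {w : List (Fin m)} {τ L : ℝ}
    (hread : Reads r ψ g τ w) (hτ : 0 ≤ τ) (hL : τ + wlen r w ≤ L) {R : ℝ} (hR0 : 0 ≤ R)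
    (hR : R ≤ wlen r w) :
    ∫ u in (0 : ℝ)..(wlen r w - R), ‖wordInt ω r ψ w (u + R) - wordInt ω r ψ w u‖ ≤
      ∫ t in (0 : ℝ)..L, ‖∫ u in (0 : ℝ)..R, wave ω u * g (t + u)‖ := by
  have hI : ∀ t, ‖∫ u in (0 : ℝ)..R, wave ω u * g (t + u)‖ =
      ‖∫ u in t..(t + R), wave ω u * g u‖ := by
    intro t
    have e : ∫ u in t..(t + R), wave ω u * g u =
        wave ω t * ∫ u in (0 : ℝ)..R, wave ω u * g (t + u) := by
      rw [← intervalIntegral.integral_const_mul]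
      have := intervalIntegral.integral_comp_add_left (a := 0) (b := R)
        (fun u => wave ω u * g u) t
      rw [add_zero] at this
      rw [← this]
      simp only [wave_add, mul_assoc]
    rw [e, norm_mul, norm_wave, one_mul]
  have hcont : Continuous fun t => ‖∫ u in t..(t + R), wave ω u * g u‖ := by
    have hp : Continuous fun t => ∫ u in (0 : ℝ)..t, wave ω u * g u :=
      intervalIntegral.continuous_primitive (intervalIntegrable_wave_mul ω hg hC) 0
    have e : ∀ t, ∫ u in t..(t + R), wave ω u * g u =
        (∫ u in (0 : ℝ)..(t + R), wave ω u * g u) - ∫ u in (0 : ℝ)..t, wave ω u * g u := fun t =>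
      (intervalIntegral.integral_interval_sub_left (intervalIntegrable_wave_mul ω hg hC _ _)
        (intervalIntegrable_wave_mul ω hg hC _ _)).symm
    simp only [e]
    exact ((hp.comp (continuous_add_const R)).sub hp).norm
  simp only [hI]
  have h1 : ∫ t in τ..(τ + (wlen r w - R)), ‖∫ u in t..(t + R), wave ω u * g u‖ ≤
      ∫ t in (0 : ℝ)..L, ‖∫ u in t..(t + R), wave ω u * g u‖ :=
    intervalIntegral.integral_mono_interval hτ (by linarith) (by linarith)
      (Eventually.of_forall fun t => norm_nonneg _) (hcont.intervalIntegrable _ _)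
  refine le_trans (le_of_eq ?_) h1
  have h2 := intervalIntegral.integral_comp_add_left (a := 0) (b := wlen r w - R)
    (fun t => ‖∫ u in t..(t + R), wave ω u * g u‖) τ
  rw [add_zero] at h2
  rw [← h2]
  refine intervalIntegral.integral_congr fun u hu => ?_
  rw [Set.uIcc_of_le (by linarith)] at hu
  rw [add_assoc, hread.integral_sub ω hg hC hu.1 (by linarith [hu.2]) (by linarith [hu.1])
    (by linarith [hu.2]), norm_mul, norm_wave, one_mul]

end

/-! ### Growth of words -/

theorem eventually_le_exp_mul {c γ : ℝ} (hγ : 0 < γ) : ∀ᶠ n : ℕ in atTop, c ≤ Real.exp (γ * n) := by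
  have h : Tendsto (fun n : ℕ => Real.exp (γ * n)) atTop atTop :=
    Real.tendsto_exp_atTop.comp
      ((tendsto_natCast_atTop_atTop).const_mul_atTop hγ)
  exact h.eventually_ge_atTop c

theorem eventually_le_mul_nat {c γ : ℝ} (hγ : 0 < γ) : ∀ᶠ n : ℕ in atTop, c ≤ γ * n :=
  (tendsto_natCast_atTop_atTop.const_mul_atTop hγ).eventually_ge_atTop c

theorem transposeMul_eq_sum (b : ℕ → Substitution m) (r : Fin m → ℝ) (n : ℕ) (c : Fin m) :
    (iter b n).transposeMul r c = ∑ i, (matProd b n i c : ℝ) * r i := by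
  rw [← matrix_iter]
  simp [Substitution.transposeMul, Matrix.mulVec, dotProduct]

theorem one_le_norm1 (ζ : Substitution m) (b : Fin m) : 1 ≤ norm1 ζ.matrix :=
  (List.length_pos_iff.mpr (ζ.word_ne_nil b)).trans_le (ζ.length_le_norm1 b)

theorem growth_upper {b : ℕ → Substitution m} {lam : ℝ} (h : HasGrowthRate b 0 lam)
    {r : Fin m → ℝ} (hr : ∀ c, 0 < r c) {ε : ℝ} (hε : 0 < ε) :
    ∀ᶠ n : ℕ in atTop, ∀ c, (iter b n).transposeMul r c ≤ Real.exp ((lam + ε) * n) := by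
  have hb : tailSeq b 0 = b := by funext j; simp [tailSeq]
  rw [HasGrowthRate, hb] at h
  have hev := h.eventually (gt_mem_nhds (show lam < lam + ε / 2 by linarith))
  filter_upwards [hev, eventually_le_exp_mul (c := ∑ i, r i) (half_pos hε), eventually_gt_atTop 0]
    with n h1 h2 h3 c
  have hn : (0 : ℝ) < n := by exact_mod_cast h3
  have hS : (0 : ℝ) < norm1 (matProd b n) := by
    rw [← matrix_iter]
    exact_mod_cast one_le_norm1 (iter b n) c
  have h4 : (norm1 (matProd b n) : ℝ) ≤ Real.exp ((lam + ε / 2) * n) := by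
    rw [← Real.log_le_iff_le_exp hS]
    rw [one_div, inv_mul_lt_iff₀ hn] at h1
    linarith
  have h5 : ∀ i, (matProd b n i c : ℝ) ≤ norm1 (matProd b n) := by
    intro i
    have e1 : matProd b n i c ≤ ∑ i, matProd b n i c :=
      Finset.single_le_sum (f := fun i => matProd b n i c) (fun _ _ => Nat.zero_le _)
        (Finset.mem_univ i)
    have e2 : ∑ i, matProd b n i c ≤ norm1 (matProd b n) :=
      Finset.le_sup (f := fun j => ∑ i, matProd b n i j) (Finset.mem_univ c)
    exact_mod_cast e1.trans e2
  rw [transposeMul_eq_sum]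
  calc ∑ i, (matProd b n i c : ℝ) * r i ≤ ∑ i, (norm1 (matProd b n) : ℝ) * r i :=
        Finset.sum_le_sum fun i _ => mul_le_mul_of_nonneg_right (h5 i) (hr i).le
    _ = norm1 (matProd b n) * ∑ i, r i := by rw [Finset.mul_sum]
    _ ≤ Real.exp ((lam + ε / 2) * n) * Real.exp (ε / 2 * n) := by
        gcongr
        exact Finset.sum_nonneg fun i _ => (hr i).le
    _ = Real.exp ((lam + ε) * n) := by rw [← Real.exp_add]; congr 1; ring

/-- The longest word of level `n` has length at least `e^{(λ - ε) n}`. -/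
theorem growth_lower_exists [Nonempty (Fin m)] {b : ℕ → Substitution m} {lam : ℝ}
    (h : HasGrowthRate b 0 lam) {r : Fin m → ℝ} (hr : ∀ c, 0 < r c) {ε : ℝ} (hε : 0 < ε) :
    ∀ᶠ n : ℕ in atTop, ∃ c, Real.exp ((lam - ε) * n) ≤ (iter b n).transposeMul r c := by
  have hb : tailSeq b 0 = b := by funext j; simp [tailSeq]
  rw [HasGrowthRate, hb] at h
  obtain ⟨i₀, hi₀⟩ := Finite.exists_min r
  have hev := h.eventually (lt_mem_nhds (show lam - ε / 2 < lam by linarith))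
  filter_upwards [hev, eventually_le_exp_mul (c := (r i₀)⁻¹) (half_pos hε), eventually_gt_atTop 0]
    with n h1 h2 h3
  have hn : (0 : ℝ) < n := by exact_mod_cast h3
  obtain ⟨c, -, hc⟩ := Finset.exists_mem_eq_sup (Finset.univ : Finset (Fin m))
    Finset.univ_nonempty (fun j => ∑ i, matProd b n i j)
  change norm1 (matProd b n) = ∑ i, matProd b n i c at hc
  have hS : (0 : ℝ) < norm1 (matProd b n) := by
    rw [← matrix_iter]
    exact_mod_cast one_le_norm1 (iter b n) c
  have h4 : Real.exp ((lam - ε / 2) * n) ≤ norm1 (matProd b n) := by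
    rw [← Real.le_log_iff_exp_le hS]
    rw [one_div, lt_inv_mul_iff₀ hn] at h1
    linarith
  refine ⟨c, ?_⟩
  rw [transposeMul_eq_sum]
  have h5 : Real.exp (-(ε / 2 * n)) ≤ r i₀ := by
    rw [Real.exp_neg]
    exact inv_le_of_inv_le₀ (hr i₀) h2
  calc Real.exp ((lam - ε) * n)
        = Real.exp ((lam - ε / 2) * n) * Real.exp (-(ε / 2 * n)) := by
          rw [← Real.exp_add]; congr 1; ring
    _ ≤ norm1 (matProd b n) * r i₀ := by gcongr
    _ = ∑ i, (matProd b n i c : ℝ) * r i₀ := by rw [hc, ← Finset.sum_mul]; push_cast; rfl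
    _ ≤ ∑ i, (matProd b n i c : ℝ) * r i := by gcongr with i; exact hi₀ i

theorem matrix_iter_eq_prod (b : ℕ → Substitution m) (n : ℕ) :
    (iter b n).matrix = ((List.ofFn fun j : Fin n => b j).map Substitution.matrix).prod := by
  induction n with
  | zero => simp [iter, Substitution.matrix_one]
  | succ n ih =>
    rw [iter, Substitution.matrix_comp, ih, List.ofFn_succ']
    simp

/-- Eventually, words of level `N` contain all the words of level at most `(1 - ε) N`. -/
theorem eventually_infix {a : ℕ → Substitution m} (hadm : ∀ j, (a j).IsAdmissible)
    (hA1 : RegularPositiveWord a) (l : ℕ) {ε : ℝ} (hε : 0 < ε) :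
    ∀ᶠ N : ℕ in atTop, ∀ n : ℕ, (n : ℝ) ≤ (1 - ε) * N → ∀ B c,
      (iter (tailSeq a l) n).word B <:+: (iter (tailSeq a l) N).word c := by
  obtain ⟨q, -, hqpos, hq⟩ := hA1
  obtain ⟨n₀, hn₀⟩ := hq (ε / 2) (half_pos hε)
  filter_upwards [eventually_ge_atTop n₀,
    eventually_le_mul_nat (c := 1 + l * (ε / 2)) (half_pos hε)] with N hN1 hN2 n hn B c
  obtain ⟨k, hk1, hk2, hk3⟩ := hn₀ (N + l) (by omega)
  have hk : n + l ≤ k := by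
    have h1 : ((n + l : ℕ) : ℤ) ≤ ⌊((N + l : ℕ) : ℝ) * (1 - ε / 2)⌋ := by
      rw [Int.le_floor]
      push_cast
      nlinarith
    exact_mod_cast h1.trans hk1
  obtain ⟨d, rfl⟩ : ∃ d, k = l + (n + d) := ⟨k - l - n, by omega⟩
  obtain ⟨e, rfl⟩ : ∃ e, N = n + (d + (q.length + e)) := ⟨N - n - d - q.length, by omega⟩
  set b := tailSeq a l with hb
  set b' := tailSeq b n with hb'
  have hdecomp : iter b' (d + (q.length + e)) = (iter b' d).comp
      ((iter (tailSeq b' d) q.length).comp (iter (tailSeq (tailSeq b' d) q.length) e)) := by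
    rw [iter_add, iter_add]
  -- every letter occurs in some word of an admissible composition
  have hocc : ∀ (u : ℕ) (i : Fin m), ∃ j, i ∈ (iter b' u).word j := by
    intro u
    induction u with
    | zero => intro i; exact ⟨i, by simp [iter, Substitution.one]⟩
    | succ u ih =>
      intro i
      obtain ⟨j, hj⟩ := ih i
      obtain ⟨j', hj'⟩ := (hadm (l + (n + u))).1 j
      refine ⟨j', ?_⟩
      simp only [iter, Substitution.comp, List.mem_flatMap]
      exact ⟨j, hj', hj⟩
  have hQ : ∀ i j, i ∈ (iter (tailSeq b' d) q.length).word j := by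
    intro i j
    rw [Substitution.mem_word_iff, matrix_iter_eq_prod]
    have e1 : (List.ofFn fun j : Fin q.length => tailSeq b' d j) = q := by
      refine Eq.trans ?_ hk3
      congr 1
      funext j
      simp only [hb', hb, tailSeq]
      congr 1
      omega
    rw [e1]
    exact hqpos i j
  have hmem : B ∈ (iter b' (d + (q.length + e))).word c := by
    obtain ⟨j, hj⟩ := hocc d B
    obtain ⟨i, hi⟩ := List.exists_mem_of_ne_nil _
      ((iter (tailSeq (tailSeq b' d) q.length) e).word_ne_nil c)
    rw [hdecomp]
    simp only [Substitution.comp, List.mem_flatMap]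
    exact ⟨j, ⟨i, hi, hQ j i⟩, hj⟩
  rw [iter_add b n]
  exact infix_flatMap_of_mem hmem

theorem wlen_infix {r : Fin m → ℝ} (hr : ∀ b, 0 < r b) {u w : List (Fin m)} (h : u <:+: w) :
    wlen r u ≤ wlen r w := by
  obtain ⟨x, y, rfl⟩ := h
  have := wlen_nonneg hr x
  have := wlen_nonneg hr y
  rw [wlen_append, wlen_append]; linarith

/-- The lower bound for the longest word of a level passes to all words of a slightly higher level,
since these contain it. -/
theorem growth_lower [Nonempty (Fin m)] {b : ℕ → Substitution m} {lam : ℝ}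
    (h : HasGrowthRate b 0 lam)
    (hinf : ∀ ε : ℝ, 0 < ε → ∀ᶠ N : ℕ in atTop, ∀ n : ℕ, (n : ℝ) ≤ (1 - ε) * N → ∀ B c,
      (iter b n).word B <:+: (iter b N).word c) (hlam : 0 < lam)
    {r : Fin m → ℝ} (hr : ∀ c, 0 < r c) {ε : ℝ} (hε : 0 < ε) :
    ∀ᶠ n : ℕ in atTop, ∀ c, Real.exp ((lam - ε) * n) ≤ wlen r ((iter b n).word c) := by
  wlog hε1 : ε ≤ lam generalizing ε
  · filter_upwards [this hlam le_rfl] with n hn c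
    refine le_trans ?_ (hn c)
    gcongr
    linarith
  -- the fraction of the levels given up to pass from one long word to all words
  set δ := ε / (4 * lam) with hδ
  have hδ0 : 0 < δ := by positivity
  have hδ1 : δ ≤ 1 / 4 := by
    rw [hδ, div_le_iff₀ (by positivity)]; linarith
  have hδl : δ * lam = ε / 4 := by rw [hδ]; field_simp
  have hev := growth_lower_exists h hr (half_pos hε)
  have hfl : Tendsto (fun N : ℕ => ⌊(1 - δ) * N⌋₊) atTop atTop :=
    tendsto_nat_floor_atTop.comp
      (tendsto_natCast_atTop_atTop.const_mul_atTop (by linarith))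
  filter_upwards [hfl.eventually hev, hinf δ hδ0,
    eventually_le_mul_nat (c := lam) (show 0 < ε / 4 by linarith)] with N h1 h2 h3 c
  obtain ⟨B, hB⟩ := h1
  have h4 : (⌊(1 - δ) * N⌋₊ : ℝ) ≤ (1 - δ) * N :=
    Nat.floor_le (mul_nonneg (by linarith) (Nat.cast_nonneg _))
  have h5 : (1 - δ) * N - 1 ≤ (⌊(1 - δ) * N⌋₊ : ℝ) := (Nat.sub_one_lt_floor _).le
  have h6 := wlen_infix hr (h2 _ h4 B c)
  rw [← wlen_word] at hB
  refine le_trans (Real.exp_le_exp.mpr ?_) (hB.trans h6)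
  have h7 : (lam - ε / 2) * ((1 - δ) * N - 1) ≤ (lam - ε / 2) * (⌊(1 - δ) * N⌋₊ : ℝ) :=
    mul_le_mul_of_nonneg_left h5 (by linarith)
  refine le_trans ?_ h7
  have hN : (0 : ℝ) ≤ N := Nat.cast_nonneg _
  have h8 : δ * lam * N = ε / 4 * N := by rw [hδl]
  nlinarith [mul_nonneg (mul_nonneg hδ0.le hε.le) hN]

theorem eventually_length_le {a : ℕ → Substitution m} (hA3 : SubexponentialMatrices a) (l : ℕ)
    {ε : ℝ} (hε : 0 < ε) :
    ∀ᶠ n : ℕ in atTop, ∀ c, (((tailSeq a l n).word c).length : ℝ) ≤ Real.exp (ε * n) := by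
  have hev := hA3.eventually (gt_mem_nhds (half_pos hε))
  have hsh : Tendsto (fun n => l + n) atTop atTop :=
    (tendsto_add_atTop_nat l).congr fun n => add_comm n l
  filter_upwards [hsh.eventually hev,
    eventually_le_mul_nat (c := ε / 2 * (l + 1)) (half_pos hε)] with n h1 h2 c
  have hS : (0 : ℝ) < 1 + norm1 (a (l + n)).matrix := by positivity
  have hn : (0 : ℝ) < ((l + n : ℕ) : ℝ) + 1 := by positivity
  rw [one_div, inv_mul_lt_iff₀ hn] at h1
  have h3 : (1 + norm1 (a (l + n)).matrix : ℝ) ≤ Real.exp (ε * n) := by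
    rw [← Real.log_le_iff_le_exp hS]
    push_cast at h1
    linarith
  have h4 : (((a (l + n)).word c).length : ℝ) ≤ norm1 (a (l + n)).matrix := by
    exact_mod_cast (a (l + n)).length_le_norm1 c
  change (((a (l + n)).word c).length : ℝ) ≤ _
  linarith

/-- A sequence with exponentially bounded increments is exponentially bounded. -/
theorem eventually_le_mul_exp_of_increment {X : ℕ → ℝ} {κ : ℝ} (hκ : 0 < κ)
    (h : ∀ᶠ n : ℕ in atTop, X (n + 1) ≤ X n + Real.exp (κ * n)) :
    ∃ D, 0 < D ∧ ∀ᶠ n : ℕ in atTop, X n ≤ D * Real.exp (κ * n) := by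
  obtain ⟨n₀, hn₀⟩ := eventually_atTop.mp h
  have hq : 0 < Real.exp κ - 1 := by
    have := Real.add_one_lt_exp hκ.ne'
    linarith
  set D := |X n₀| + (Real.exp κ - 1)⁻¹ with hD
  have hDpos : 0 < D := by positivity
  refine ⟨D, hDpos, eventually_atTop.mpr ⟨n₀, fun n hn => ?_⟩⟩
  induction n, hn using Nat.le_induction with
  | base =>
    have h1 : X n₀ ≤ D := by
      have := le_abs_self (X n₀)
      have := inv_pos.mpr hq
      linarith
    have h2 : 1 ≤ Real.exp (κ * n₀) := Real.one_le_exp (by positivity)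
    nlinarith
  | succ n hn ih =>
    have h1 := hn₀ n hn
    have h2 : Real.exp (κ * (n + 1 : ℕ)) = Real.exp (κ * n) * Real.exp κ := by
      rw [← Real.exp_add]; push_cast; ring_nf
    rw [h2]
    have h3 : 1 ≤ D * (Real.exp κ - 1) := by
      rw [hD, add_mul, inv_mul_cancel₀ hq.ne']
      have : 0 ≤ |X n₀| * (Real.exp κ - 1) := by positivity
      linarith
    have h4 := Real.exp_pos (κ * n)
    nlinarith

/-! ### Exponents in the extended reals -/

theorem log_enorm_div_le_iff {E : Type*} [SeminormedAddCommGroup E] (v : E) {n : ℕ} (hn : 0 < n)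
    (κ : ℝ) : ENNReal.log ‖v‖ₑ / (n : EReal) ≤ κ ↔ ‖v‖ ≤ Real.exp (κ * n) := by
  have h1 : ((n : EReal)) = ((n : ℝ) : EReal) := by simp
  have hn' : (0 : ℝ) < n := by exact_mod_cast hn
  have h2 : ((n : ℝ) : EReal) * (κ : EReal) =
      ENNReal.log (ENNReal.ofReal (Real.exp (κ * n))) := by
    rw [ENNReal.log_ofReal_of_pos (Real.exp_pos _), Real.log_exp, mul_comm, ← EReal.coe_mul]
  rw [h1, EReal.div_le_iff_le_mul (by exact_mod_cast hn') (EReal.coe_ne_top _), h2,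
    ENNReal.log_le_log_iff, ← ofReal_norm,
    ENNReal.ofReal_le_ofReal_iff (Real.exp_pos _).le]

theorem upperLyapunov_le_of_eventually {b : ℕ → Substitution m} {ξ : Fin m → ℝ} {z : Fin m → ℂ}
    {κ : ℝ} (h : ∀ᶠ n : ℕ in atTop, ‖cocycle b ξ n *ᵥ z‖ ≤ Real.exp (κ * n)) :
    upperLyapunov b ξ z ≤ κ := by
  refine limsup_le_of_le (by isBoundedDefault) ?_
  filter_upwards [h, eventually_gt_atTop 0] with n h1 h2
  exact (log_enorm_div_le_iff _ h2 κ).mpr h1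

theorem upperLyapunov_le_of_eventually_mul {b : ℕ → Substitution m} {ξ : Fin m → ℝ}
    {z : Fin m → ℂ} {κ κ' D : ℝ} (hκ : κ < κ')
    (h : ∀ᶠ n : ℕ in atTop, ‖cocycle b ξ n *ᵥ z‖ ≤ D * Real.exp (κ * n)) :
    upperLyapunov b ξ z ≤ κ' := by
  refine upperLyapunov_le_of_eventually ?_
  filter_upwards [h, eventually_le_exp_mul (c := D) (sub_pos.mpr hκ)] with n h1 h2
  refine h1.trans ?_
  calc D * Real.exp (κ * n) ≤ Real.exp ((κ' - κ) * n) * Real.exp (κ * n) := by gcongr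
    _ = Real.exp (κ' * n) := by rw [← Real.exp_add]; congr 1; ring

theorem eventually_of_upperLyapunov_lt {b : ℕ → Substitution m} {ξ : Fin m → ℝ} {z : Fin m → ℂ}
    {κ : ℝ} (h : upperLyapunov b ξ z < κ) :
    ∀ᶠ n : ℕ in atTop, ‖cocycle b ξ n *ᵥ z‖ ≤ Real.exp (κ * n) := by
  filter_upwards [eventually_lt_of_limsup_lt h (by isBoundedDefault), eventually_gt_atTop 0]
    with n h1 h2
  exact (log_enorm_div_le_iff _ h2 κ).mp h1.le

theorem log_rpow_div_log {r : ℝ} (h0 : 0 < r) (h1 : r < 1) (γ : ℝ) :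
    ENNReal.log (ENNReal.ofReal (r ^ γ)) / ((Real.log r : ℝ) : EReal) = γ := by
  rw [ENNReal.log_ofReal_of_pos (by positivity), Real.log_rpow h0, ← EReal.coe_div,
    mul_div_cancel_right₀ _ (Real.log_neg h0 h1).ne]

theorem le_lowerLocalDim {ν : Measure ℝ} [IsFiniteMeasure ν] {w γ γ' D : ℝ} (hγ : γ < γ')
    (h : ∀ᶠ r : ℝ in 𝓝[>] 0, ν.real (Metric.ball w r) ≤ D * r ^ γ') :
    (γ : EReal) ≤ lowerLocalDim ν w := by
  refine le_liminf_of_le (by isBoundedDefault) ?_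
  have hlim : Tendsto (fun r : ℝ => |D| * r ^ (γ' - γ)) (𝓝[>] 0) (𝓝 (|D| * 0)) := by
    refine Tendsto.const_mul _ ?_
    have := (Real.continuousAt_rpow_const 0 (γ' - γ) (Or.inr (by linarith))).tendsto
    rw [Real.zero_rpow (by linarith)] at this
    exact this.mono_left nhdsWithin_le_nhds
  rw [mul_zero] at hlim
  have h01 : ∀ᶠ r : ℝ in 𝓝[>] 0, r < 1 := nhdsWithin_le_nhds (gt_mem_nhds one_pos)
  filter_upwards [h, hlim.eventually (gt_mem_nhds one_pos), h01, self_mem_nhdsWithin]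
    with r h1 h2 h3 h4
  have h4' : 0 < r := h4
  rw [← log_rpow_div_log h4' h3 γ]
  refine EReal.div_le_div_right_of_nonpos
    (by exact_mod_cast (Real.log_neg h4' h3).le) (ENNReal.log_le_log ?_)
  rw [← ofReal_measureReal]
  refine ENNReal.ofReal_le_ofReal (h1.trans ?_)
  have e : r ^ γ' = r ^ (γ' - γ) * r ^ γ := by rw [← Real.rpow_add h4', sub_add_cancel]
  have h5 : 0 < r ^ γ := by positivity
  calc D * r ^ γ' ≤ |D| * r ^ γ' := by gcongr; exact le_abs_self D
    _ = (|D| * r ^ (γ' - γ)) * r ^ γ := by rw [e]; ring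
    _ ≤ 1 * r ^ γ := by gcongr
    _ = r ^ γ := one_mul _

theorem eventually_measure_ball_le {ν : Measure ℝ} {w γ : ℝ} (h : (γ : EReal) < lowerLocalDim ν w) :
    ∀ᶠ r : ℝ in 𝓝[>] 0, ν (Metric.ball w r) ≤ ENNReal.ofReal (r ^ γ) := by
  have h01 : ∀ᶠ r : ℝ in 𝓝[>] 0, r < 1 := nhdsWithin_le_nhds (gt_mem_nhds one_pos)
  filter_upwards [eventually_lt_of_lt_liminf h (by isBoundedDefault), h01, self_mem_nhdsWithin]
    with r h1 h2 h3
  have h3' : 0 < r := h3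
  by_contra hcon
  have h4 := EReal.div_le_div_right_of_nonpos (c := ((Real.log r : ℝ) : EReal))
    (by exact_mod_cast (Real.log_neg h3' h2).le) (ENNReal.log_le_log (not_le.mp hcon).le)
  rw [log_rpow_div_log h3' h2] at h4
  exact absurd h1 (not_lt.mpr h4)

theorem exists_forall_measure_ball_le {ν : Measure ℝ} [IsFiniteMeasure ν] {w γ : ℝ} (hγ0 : 0 ≤ γ)
    (h : (γ : EReal) < lowerLocalDim ν w) :
    ∃ A, 0 ≤ A ∧ ∀ ρ, 0 < ρ → ν (Metric.ball w ρ) ≤ ENNReal.ofReal (A * ρ ^ γ) := by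
  obtain ⟨δ, hδ0, hδ⟩ := mem_nhdsGT_iff_exists_Ioo_subset.mp (eventually_measure_ball_le h)
  have hδ0' : 0 < δ := hδ0
  refine ⟨1 + ν.real Set.univ / δ ^ γ, by positivity, fun ρ hρ => ?_⟩
  have hρ' : 0 < ρ ^ γ := by positivity
  have hq : 0 ≤ ν.real Set.univ / δ ^ γ := by positivity
  rcases lt_or_ge ρ δ with hc | hc
  · refine (hδ ⟨hρ, hc⟩ : ν (Metric.ball w ρ) ≤ ENNReal.ofReal (ρ ^ γ)).trans
      (ENNReal.ofReal_le_ofReal ?_)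
    nlinarith
  · refine (measure_mono (Set.subset_univ _)).trans ?_
    rw [← ofReal_measureReal]
    refine ENNReal.ofReal_le_ofReal ?_
    have h1 : δ ^ γ ≤ ρ ^ γ := Real.rpow_le_rpow hδ0'.le hc hγ0
    have h2 : ν.real Set.univ = ν.real Set.univ / δ ^ γ * δ ^ γ := by
      rw [div_mul_cancel₀]; positivity
    calc ν.real Set.univ = ν.real Set.univ / δ ^ γ * δ ^ γ := h2
      _ ≤ ν.real Set.univ / δ ^ γ * ρ ^ γ := by gcongr
      _ ≤ (1 + ν.real Set.univ / δ ^ γ) * ρ ^ γ := by nlinarith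

/-! ### The two estimates for the spectral measure -/

section

variable {P : Type*} [MeasurableSpace P] {ν : Measure P} {Φ : ℝ → P → P} {f : P → ℂ} {C : ℝ}
  {σ : Measure ℝ} {r : Fin m → ℝ} {ψ : Fin m → ℝ → ℂ} {b : ℕ → Substitution m} {lam : ℝ}

/-- An exponential bound for the twisted integrals along whole words carries over to all initial
segments of words, since a word of level `n + 1` is made of subexponentially many words of
level `n`. -/
theorem exists_wordInt_bound (h : IsProfile r ψ C) (hC : 0 ≤ C) (ω : ℝ)
    (hlen : ∀ ε : ℝ, 0 < ε → ∀ᶠ n : ℕ in atTop, ∀ c,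
      (((b n).word c).length : ℝ) ≤ Real.exp (ε * n)) {κ κ' : ℝ} (hκ' : 0 < κ') (hκ : κ < κ')
    (hΦ : ∀ᶠ n : ℕ in atTop, ∀ c, ‖wordTotal ω r ψ ((iter b n).word c)‖ ≤ Real.exp (κ * n)) :
    ∃ D, 0 < D ∧ ∀ᶠ n : ℕ in atTop, ∀ c, ∀ u ∈ Set.Icc 0 (wlen r ((iter b n).word c)),
      ‖wordInt ω r ψ ((iter b n).word c) u‖ ≤ D * Real.exp (κ' * n) := by
  obtain ⟨n₀, hn₀⟩ := eventually_atTop.mp (hΦ.and (hlen _ (sub_pos.mpr hκ)))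
  set X : ℕ → ℝ := fun n => (∑ c, C * wlen r ((iter b n₀).word c)) +
    ∑ j ∈ Finset.Ico n₀ n, Real.exp (κ' * j) with hX
  have hw : ∀ c, 0 ≤ C * wlen r ((iter b n₀).word c) := fun c =>
    mul_nonneg hC (wlen_nonneg h.pos _)
  have hX0 : ∀ n, 0 ≤ X n := fun n => add_nonneg (Finset.sum_nonneg fun c _ => hw c)
    (Finset.sum_nonneg fun j _ => (Real.exp_pos _).le)
  have hXs : ∀ n, n₀ ≤ n → X (n + 1) = X n + Real.exp (κ' * n) := by
    intro n hn
    simp only [hX, Finset.sum_Ico_succ_top hn, add_assoc]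
  have hb : ∀ n, n₀ ≤ n → ∀ c, ∀ u ∈ Set.Icc 0 (wlen r ((iter b n).word c)),
      ‖wordInt ω r ψ ((iter b n).word c) u‖ ≤ X n := by
    intro n hn
    induction n, hn using Nat.le_induction with
    | base =>
      intro c u hu
      simp only [hX, Finset.Ico_self, Finset.sum_empty, add_zero]
      refine (norm_wordInt_le h hC ω _ hu.1).trans ?_
      refine (mul_le_mul_of_nonneg_left hu.2 hC).trans ?_
      exact Finset.single_le_sum (f := fun c => C * wlen r ((iter b n₀).word c))
        (fun c _ => hw c) (Finset.mem_univ c)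
    | succ n hn ih =>
      intro c u hu
      obtain ⟨h1, h2⟩ := hn₀ n hn
      refine (norm_wordInt_flatMap_le h hC ω (iter b n) h1 ih (hX0 n) ((b n).word c) u hu).trans ?_
      rw [hXs n hn, add_comm (X n)]
      gcongr
      calc (((b n).word c).length : ℝ) * Real.exp (κ * n)
          ≤ Real.exp ((κ' - κ) * n) * Real.exp (κ * n) := by gcongr; exact h2 c
        _ = Real.exp (κ' * n) := by rw [← Real.exp_add]; congr 1; ring
  obtain ⟨D, hD, hev⟩ := eventually_le_mul_exp_of_increment hκ'
    (eventually_atTop.mpr ⟨n₀, fun n hn => (hXs n hn).le⟩)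
  refine ⟨D, hD, ?_⟩
  filter_upwards [hev, eventually_ge_atTop n₀] with n h1 h2 c u hu
  exact (hb n h2 c u hu).trans h1

/-- Upper bound for the spectral measure of balls, from a bound for the cocycle. The twisted
integral of length `R` is estimated by words of the first level at which all words are longer
than `R`. -/
theorem eventually_measureReal_ball_le [IsFiniteMeasure ν] [IsFiniteMeasure σ]
    (h : IsProfile r ψ C) (hC : 0 ≤ C) (sys : IsSpectralSystem ν Φ f C σ)
    (htile : ∀ᵐ p ∂ν, ∀ n, Tiled r ψ (iter b n) (fun t => f (Φ t p)))
    (hlen : ∀ ε : ℝ, 0 < ε → ∀ᶠ n : ℕ in atTop, ∀ c,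
      (((b n).word c).length : ℝ) ≤ Real.exp (ε * n))
    (hlow : ∀ ε : ℝ, 0 < ε → ∀ᶠ n : ℕ in atTop, ∀ c,
      Real.exp ((lam - ε) * n) ≤ wlen r ((iter b n).word c))
    (ω : ℝ) {κ β : ℝ} (hκ0 : 0 < κ) (hβ : 0 < β) (hκ : κ < β * lam)
    (hΦ : ∀ᶠ n : ℕ in atTop, ∀ c, ‖wordTotal ω r ψ ((iter b n).word c)‖ ≤ Real.exp (κ * n)) :
    ∃ D, ∀ᶠ ρ : ℝ in 𝓝[>] 0, σ.real (Metric.ball ω ρ) ≤ D * ρ ^ (2 - 2 * β) := by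
  obtain ⟨κ', h1, h2⟩ := exists_between hκ
  have hκ' : 0 < κ' := hκ0.trans h1
  obtain ⟨D, hD0, hD⟩ := exists_wordInt_bound h hC ω hlen hκ' h1 hΦ
  set θ := κ' / β with hθ
  have hθ0 : 0 < θ := by positivity
  have hθl : θ < lam := by rw [hθ, div_lt_iff₀ hβ]; linarith
  have hlow' := hlow (lam - θ) (by linarith)
  have hceil : Tendsto (fun R : ℝ => ⌈Real.log R / θ⌉₊) atTop atTop :=
    tendsto_nat_ceil_atTop.comp (Real.tendsto_log_atTop.atTop_div_const hθ0)
  set D' := 4 * (D * Real.exp κ') with hD'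
  have hR : ∀ᶠ R : ℝ in atTop, ∀ᵐ p ∂ν, ‖twist Φ f ω R p‖ ≤ D' * R ^ β := by
    filter_upwards [hceil.eventually (hD.and hlow'), eventually_ge_atTop 1] with R hR hR1
    obtain ⟨hR2, hR3⟩ := hR
    set n := ⌈Real.log R / θ⌉₊ with hn
    have hRpos : 0 < R := by linarith
    have hlog : 0 ≤ Real.log R := Real.log_nonneg hR1
    have hn1 : Real.log R / θ ≤ n := Nat.le_ceil _
    have hn2 : (n : ℝ) < Real.log R / θ + 1 := Nat.ceil_lt_add_one (by positivity)
    have hRn : ∀ c, R ≤ wlen r ((iter b n).word c) := by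
      intro c
      refine le_trans ?_ (hR3 c)
      rw [← Real.log_le_iff_le_exp hRpos]
      rw [div_le_iff₀ hθ0] at hn1
      linarith
    have hexp : Real.exp (κ' * n) ≤ Real.exp κ' * R ^ β := by
      rw [Real.rpow_def_of_pos hRpos, ← Real.exp_add]
      refine Real.exp_le_exp.mpr ?_
      have : κ' * (Real.log R / θ) = Real.log R * β := by
        rw [hθ]; field_simp
      nlinarith
    filter_upwards [htile] with p hp
    have hm : Measurable fun t => f (Φ t p) :=
      sys.measurable.comp (sys.measurable_flow.comp measurable_prodMk_right)
    refine ((hp n).norm_integral_le h.pos hm (fun t => sys.norm_le _) ω hR2 hRpos.le hRn).trans ?_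
    rw [hD', mul_assoc, mul_assoc D]
    gcongr
  have hinv : Tendsto (fun ρ : ℝ => 1 / (16 * ρ)) (𝓝[>] 0) atTop := by
    have := (tendsto_inv_nhdsGT_zero (𝕜 := ℝ)).const_mul_atTop (show (0 : ℝ) < 1 / 16 by norm_num)
    refine this.congr fun ρ => ?_
    rw [one_div, one_div, mul_inv]
  refine ⟨4 * D' ^ 2 * ν.real Set.univ * 16 ^ (2 - 2 * β), ?_⟩
  filter_upwards [hinv.eventually hR, self_mem_nhdsWithin] with ρ hρ hρ0
  have hρ0' : 0 < ρ := hρ0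
  set R := 1 / (16 * ρ) with hRdef
  have hRpos : 0 < R := by positivity
  have hball := sys.measureReal_ball_le ω hRpos hρ
  have e1 : 1 / (16 * R) = ρ := by rw [hRdef]; field_simp
  rw [e1] at hball
  refine hball.trans (le_of_eq ?_)
  have e2 : 16 ^ (2 - 2 * β) * ρ ^ (2 - 2 * β) = R ^ (2 * β) / R ^ 2 := by
    rw [← Real.mul_rpow (by norm_num) hρ0'.le]
    have e3 : 16 * ρ = R⁻¹ := by rw [hRdef]; simp
    rw [e3, Real.inv_rpow hRpos.le, ← Real.rpow_neg hRpos.le, ← Real.rpow_natCast,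
      ← Real.rpow_sub hRpos]
    congr 1; push_cast; ring
  have e4 : (R ^ β) ^ 2 = R ^ (2 * β) := by
    rw [← Real.rpow_natCast, ← Real.rpow_mul hRpos.le]; congr 1; push_cast; ring
  rw [mul_assoc _ (16 ^ _), e2, mul_pow, e4]
  ring

/-- A power bound for the mean of the twisted integrals bounds the averaged increments along a
word that every word of a higher level contains. -/
theorem incrementBound_of_infix [IsFiniteMeasure ν] (hν : 0 < ν.real Set.univ)
    (h : IsProfile r ψ C) (sys : IsSpectralSystem ν Φ f C σ)
    (htile : ∀ᵐ p ∂ν, ∀ n, Tiled r ψ (iter b n) (fun t => f (Φ t p))) (ω : ℝ) {K α M : ℝ}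
    (hα : 0 < α) (hK0 : 0 ≤ K) (hM0 : 0 ≤ M)
    (hK : ∀ R, 0 ≤ R → ∫ p, ‖twist Φ f ω R p‖ ∂ν ≤ K * R ^ α) {N : ℕ}
    (hM : ∀ c, wlen r ((iter b N).word c) ≤ M) {w : List (Fin m)}
    (hw : ∀ c, w <:+: (iter b N).word c) :
    IncrementBound ω r ψ w (2 * M * K * wlen r w ^ α / ν.real Set.univ) := by
  intro R hR0 hR
  rw [le_div_iff₀ hν]
  have h1 := sys.mul_measure_le_of_timeAverage (ν := ν) ω (R := R) (L := 2 * M) hR0 (by positivity)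
    (κ := ∫ u in (0 : ℝ)..(wlen r w - R), ‖wordInt ω r ψ w (u + R) - wordInt ω r ψ w u‖) ?_
  · refine h1.trans ?_
    rw [mul_assoc (2 * M)]
    have : ∫ p, ‖twist Φ f ω R p‖ ∂ν ≤ K * wlen r w ^ α := (hK R hR0).trans (by gcongr)
    gcongr
  · filter_upwards [htile] with p hp
    obtain ⟨τ, hτ0, hτ, hread⟩ := (hp N).exists_reads h.pos hM hw
    have hm : Measurable fun t => f (Φ t p) :=
      sys.measurable.comp (sys.measurable_flow.comp measurable_prodMk_right)
    have h2 := hread.integral_increment_le hm (fun t => sys.norm_le _) ω hτ0 hτ hR0 hR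
    refine h2.trans (le_of_eq ?_)
    simp only [twist, sys.flow_flow, add_comm]

/-- Bound for the cocycle, from a power bound for the mean of the twisted integrals. The mean
values over a word of level `n + 1` of the twisted integrals from its beginning, and to its end,
are compared with the same quantities for its first and last subwords of level `n`; the errors
form a geometric series. -/
theorem eventually_wordTotal_le [IsFiniteMeasure ν] (hν : 0 < ν.real Set.univ)
    (h : IsProfile r ψ C) (hC : 0 ≤ C) (sys : IsSpectralSystem ν Φ f C σ)
    (htile : ∀ᵐ p ∂ν, ∀ n, Tiled r ψ (iter b n) (fun t => f (Φ t p)))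
    (hlow : ∀ ε : ℝ, 0 < ε → ∀ᶠ n : ℕ in atTop, ∀ c,
      Real.exp ((lam - ε) * n) ≤ wlen r ((iter b n).word c))
    (hup : ∀ ε : ℝ, 0 < ε → ∀ᶠ n : ℕ in atTop, ∀ c,
      wlen r ((iter b n).word c) ≤ Real.exp ((lam + ε) * n))
    (hinf : ∀ ε : ℝ, 0 < ε → ∀ᶠ N : ℕ in atTop, ∀ n : ℕ, (n : ℝ) ≤ (1 - ε) * N → ∀ B c,
      (iter b n).word B <:+: (iter b N).word c)
    (hlam : 0 < lam) (ω : ℝ) {K α κ : ℝ} (hα : 0 < α) (hK0 : 0 ≤ K)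
    (hK : ∀ R, 0 ≤ R → ∫ p, ‖twist Φ f ω R p‖ ∂ν ≤ K * R ^ α) (hκ : α * lam < κ) :
    ∃ D, ∀ᶠ n : ℕ in atTop, ∀ c,
      ‖wordTotal ω r ψ ((iter b n).word c)‖ ≤ D * Real.exp (κ * n) := by
  set γ := κ - α * lam with hγ
  have hγ0 : 0 < γ := by linarith
  have hκ0 : 0 < κ := by nlinarith
  -- the losses `ε` in the growth rate and `η` in the level are small compared with `γ`
  obtain ⟨ε, hε0, hε⟩ : ∃ ε : ℝ, 0 < ε ∧ (2 + α) * ε ≤ γ / 4 :=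
    ⟨γ / (4 * (2 + α)), by positivity, le_of_eq (by field_simp)⟩
  obtain ⟨η, hη0, hη⟩ : ∃ η : ℝ, 0 < η ∧ η * (lam + ε) ≤ γ / 4 :=
    ⟨γ / (4 * (lam + ε)), by positivity, le_of_eq (by field_simp)⟩
  set ε₀ := η / (1 + η) with hε₀
  have hε₀0 : 0 < ε₀ := by positivity
  set Nf : ℕ → ℕ := fun n => n + 1 + ⌈η * (n + 1)⌉₊ with hNf
  have hN1 : ∀ n : ℕ, (1 + η) * ((n : ℝ) + 1) ≤ Nf n := by
    intro n
    have := Nat.le_ceil (η * ((n : ℝ) + 1))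
    simp only [hNf]; push_cast; linarith
  have hN2 : ∀ n : ℕ, (Nf n : ℝ) ≤ (1 + η) * ((n : ℝ) + 1) + 1 := by
    intro n
    have := (Nat.ceil_lt_add_one (show 0 ≤ η * ((n : ℝ) + 1) by positivity)).le
    simp only [hNf]; push_cast; linarith
  have hNf' : Tendsto Nf atTop atTop := tendsto_atTop_mono
    (fun n => show n ≤ Nf n by simp only [hNf]; omega) tendsto_id
  set V := ν.real Set.univ with hV
  set c₀ := (lam + ε) * (2 + η) + α * (lam + ε) with hc₀
  -- the increment bound for the words of level `n + 1`, relative to the length of those of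
  -- level `n`
  have hinc : ∀ᶠ n : ℕ in atTop, ∀ B c, ∃ K', IncrementBound ω r ψ ((iter b (n + 1)).word B) K' ∧
      2 * K' / wlen r ((iter b n).word c) ≤ Real.exp (κ * n) := by
    filter_upwards [hlow ε hε0, (tendsto_add_atTop_nat 1).eventually (hup ε hε0),
      hNf'.eventually (hup ε hε0), hNf'.eventually (hinf ε₀ hε₀0),
      eventually_le_exp_mul (c := 4 * K / V * Real.exp c₀) (half_pos hγ0)] with n g1 g2 g3 g4 g5 B c
    have hn1 : ((n + 1 : ℕ) : ℝ) ≤ (1 - ε₀) * Nf n := by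
      have e : 1 - ε₀ = (1 + η)⁻¹ := by rw [hε₀]; field_simp; ring
      rw [e, inv_mul_eq_div, le_div_iff₀ (by positivity)]
      have := hN1 n
      push_cast; linarith
    refine ⟨_, incrementBound_of_infix hν h sys htile ω hα hK0 (Real.exp_pos _).le hK g3
      (fun c => g4 (n + 1) hn1 B c), ?_⟩
    have hpos : 0 < wlen r ((iter b n).word c) := (Real.exp_pos _).trans_le (g1 c)
    rw [div_le_iff₀ hpos]
    refine le_trans ?_ (mul_le_mul_of_nonneg_left (g1 c) (Real.exp_pos _).le)
    have hwα : wlen r ((iter b (n + 1)).word B) ^ α ≤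
        Real.exp ((lam + ε) * (n + 1 : ℕ) * α) := by
      rw [Real.exp_mul]
      exact Real.rpow_le_rpow (wlen_nonneg h.pos _) (g2 B) hα.le
    calc 2 * (2 * Real.exp ((lam + ε) * Nf n) * K *
          wlen r ((iter b (n + 1)).word B) ^ α / V)
        ≤ 2 * (2 * Real.exp ((lam + ε) * Nf n) * K *
          Real.exp ((lam + ε) * (n + 1 : ℕ) * α) / V) := by gcongr
      _ = 4 * K / V * Real.exp ((lam + ε) * Nf n + (lam + ε) * (n + 1 : ℕ) * α) := by
          rw [Real.exp_add]; ring
      _ ≤ 4 * K / V * Real.exp (c₀ + ((α * lam + γ / 2) * n + (lam - ε) * n)) := by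
          refine mul_le_mul_of_nonneg_left (Real.exp_le_exp.mpr ?_) (by positivity)
          have h1 : (lam + ε) * Nf n ≤ (lam + ε) * ((1 + η) * ((n : ℝ) + 1) + 1) := by
            gcongr; exact hN2 n
          have h2 : (2 + α) * ε * n ≤ γ / 4 * n := by gcongr
          have h3 : η * (lam + ε) * n ≤ γ / 4 * n := by gcongr
          push_cast
          rw [hc₀]
          linarith
      _ = 4 * K / V * Real.exp c₀ * Real.exp ((α * lam + γ / 2) * n + (lam - ε) * n) := by
          rw [Real.exp_add]; ring
      _ ≤ Real.exp (γ / 2 * n) * Real.exp ((α * lam + γ / 2) * n + (lam - ε) * n) := by gcongr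
      _ = Real.exp (κ * n) * Real.exp ((lam - ε) * n) := by
          rw [← Real.exp_add, ← Real.exp_add]; congr 1; rw [hγ]; ring
  have hwpos : ∀ n c, 0 < wlen r ((iter b n).word c) := by
    intro n c
    rw [wlen_word]; exact (iter b n).transposeMul_pos h.pos c
  have hhead : ∀ᶠ n : ℕ in atTop, ‖fun c => headMean ω r ψ ((iter b (n + 1)).word c)‖ ≤
      ‖fun c => headMean ω r ψ ((iter b n).word c)‖ + Real.exp (κ * n) := by
    filter_upwards [hinc] with n hn
    refine (pi_norm_le_iff_of_nonneg (by positivity)).mpr fun B => ?_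
    obtain ⟨c, w, hcw⟩ := List.exists_cons_of_ne_nil ((b n).word_ne_nil B)
    obtain ⟨K', hK1, hK2⟩ := hn B c
    have e : (iter b (n + 1)).word B = (iter b n).word c ++ w.flatMap (iter b n).word := by
      change ((b n).word B).flatMap (iter b n).word = _
      rw [hcw, List.flatMap_cons]
    rw [e] at hK1 ⊢
    refine (norm_headMean_append_sub_le h hC ω _ _ (hwpos n c) hK1).trans ?_
    gcongr
    exact norm_le_pi_norm (fun c => headMean ω r ψ ((iter b n).word c)) c
  have htail : ∀ᶠ n : ℕ in atTop, ‖fun c => tailMean ω r ψ ((iter b (n + 1)).word c)‖ ≤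
      ‖fun c => tailMean ω r ψ ((iter b n).word c)‖ + Real.exp (κ * n) := by
    filter_upwards [hinc] with n hn
    refine (pi_norm_le_iff_of_nonneg (by positivity)).mpr fun B => ?_
    set c := ((b n).word B).getLast ((b n).word_ne_nil B) with hc
    obtain ⟨K', hK1, hK2⟩ := hn B c
    have e : (iter b (n + 1)).word B =
        ((b n).word B).dropLast.flatMap (iter b n).word ++ (iter b n).word c := by
      change ((b n).word B).flatMap (iter b n).word = _
      conv_lhs => rw [← List.dropLast_append_getLast ((b n).word_ne_nil B)]
      rw [List.flatMap_append, List.flatMap_singleton]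
    rw [e] at hK1 ⊢
    refine (norm_tailMean_append_sub_le h hC ω _ _ (hwpos n c) hK1).trans ?_
    gcongr
    exact norm_le_pi_norm (fun c => tailMean ω r ψ ((iter b n).word c)) c
  obtain ⟨D₁, -, hD₁⟩ := eventually_le_mul_exp_of_increment
    (X := fun n => ‖fun c => headMean ω r ψ ((iter b n).word c)‖) hκ0 hhead
  obtain ⟨D₂, -, hD₂⟩ := eventually_le_mul_exp_of_increment
    (X := fun n => ‖fun c => tailMean ω r ψ ((iter b n).word c)‖) hκ0 htail
  refine ⟨D₁ + D₂, ?_⟩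
  filter_upwards [hD₁, hD₂] with n h1 h2 c
  have e : wordTotal ω r ψ ((iter b n).word c) =
      headMean ω r ψ ((iter b n).word c) + tailMean ω r ψ ((iter b n).word c) := by
    rw [tailMean]; ring
  rw [e, add_mul]
  refine (norm_add_le _ _).trans (add_le_add ?_ ?_)
  · exact (norm_le_pi_norm (fun c => headMean ω r ψ ((iter b n).word c)) c).trans h1
  · exact (norm_le_pi_norm (fun c => tailMean ω r ψ ((iter b n).word c)) c).trans h2

end

/-! ### Cylindrical functions as spectral systems -/

/-- The components of a Lip-cylindrical function may be taken continuous and bounded on the whole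
line; this does not change their values on the intervals `[0, r_b]`. -/
theorem exists_isProfile {r : Fin m → ℝ} (hr : ∀ b, 0 < r b) {ψ : Fin m → ℝ → ℂ}
    (hψ : ∀ b, ∃ K, LipschitzOnWith K (ψ b) (Set.Icc 0 (r b))) :
    ∃ ψ' C, 0 ≤ C ∧ IsProfile r ψ' C ∧ ∀ b, ∀ t ∈ Set.Icc 0 (r b), ψ' b t = ψ b t := by
  have hc : ∀ b, ContinuousOn (ψ b) (Set.Icc 0 (r b)) := fun b =>
    (hψ b).elim fun K hK => hK.continuousOn
  have hC : ∀ b, ∃ C, ∀ t ∈ Set.Icc 0 (r b), ‖ψ b t‖ ≤ C := fun b =>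
    isCompact_Icc.exists_bound_of_continuousOn (hc b)
  choose C hC using hC
  refine ⟨fun b => Set.IccExtend (hr b).le ((Set.Icc 0 (r b)).domRestrict (ψ b)), ∑ b, |C b|,
    Finset.sum_nonneg fun b _ => abs_nonneg _, ⟨hr, fun b => ?_, fun b t => ?_⟩, fun b t ht => ?_⟩
  · exact (hc b).domRestrict.Icc_extend'
  · refine (hC b _ (Set.projIcc 0 (r b) (hr b).le t).2).trans ((le_abs_self _).trans ?_)
    exact Finset.single_le_sum (f := fun b => |C b|) (fun _ _ => abs_nonneg _) (Finset.mem_univ b)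
  · exact Set.IccExtend_of_mem (hr b).le _ ht

theorem wordTotal_singleton {r : Fin m → ℝ} {ψ ψ' : Fin m → ℝ → ℂ} (hr : ∀ b, 0 < r b)
    (h : ∀ b, ∀ t ∈ Set.Icc 0 (r b), ψ' b t = ψ b t) (ω : ℝ) (c : Fin m) :
    wordTotal ω r ψ' [c] = ∫ t in (0 : ℝ)..(r c), wave ω t * ψ c t := by
  rw [wordTotal, wordInt, wlen_singleton]
  refine intervalIntegral.integral_congr_ae ?_
  have hne : ∀ᵐ t : ℝ, t ≠ r c := by simp [ae_iff]
  filter_upwards [hne] with t ht hmem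
  rw [Set.uIoc_of_le (hr c).le] at hmem
  rw [conc, if_pos (lt_of_le_of_ne hmem.2 ht), h c t ⟨hmem.1.le, hmem.2⟩]

theorem IsSpectralMeasure.isSpectralSystem {a : ℕ → Substitution m} {s : Fin m → ℝ}
    (hs : ∀ b, 0 < s b) {μ : Measure (ℤ → Fin m)} (hμ : IsInvariantProb a μ) {l : ℕ}
    {ψ : Fin m → ℝ → ℂ} {C : ℝ} (hC : 0 ≤ C) (hψ : IsProfile (levelRoof a s l) ψ C)
    {f : (ℤ → Fin m) × ℝ → ℂ} (hf : CylValue a s l ψ f) {σ : Measure ℝ}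
    (hσ : IsSpectralMeasure s μ f σ) :
    IsSpectralSystem (suspMeasure s μ) (flow s) ((suspSpace a s).indicator f) C σ := by
  have := hμ.prob
  refine ⟨measurable_flow hs, measurePreserving_flow hs hμ.invariant, flow_flow hs,
    hf.measurable hs hψ.cont, fun p => ?_, fun t => ?_⟩
  · by_cases hp : p ∈ suspSpace a s
    · rw [Set.indicator_of_mem hp]
      exact hf.norm_le hs hψ.norm_le hp
    · rw [Set.indicator_of_notMem hp, norm_zero]
      exact hC
  · rw [hσ.fourier]
    refine integral_congr_ae ?_
    filter_upwards [ae_mem_suspSpace hs hμ.carried] with p hp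
    rw [Set.indicator_of_mem hp, Set.indicator_of_mem (flow_mem_suspSpace hs hp t)]

end SAdic

theorem theorem4p5 {m : ℕ}
    -- the sequence of substitutions and its standing properties
    (a : ℕ → Substitution m) (hadm : ∀ j, (a j).IsAdmissible)
    (l : ℕ) (lam : ℝ)
    (hA1 : RegularPositiveWord a) (hA2 : HasGrowthRate a l lam)
    (hA3 : SubexponentialMatrices a)
    (haper : Aperiodic a) (hrec : Recognizable a)
    -- the suspension flow
    (s : Fin m → ℝ) (hs : ∀ b, 0 < s b)
    (μ : Measure (ℤ → Fin m)) (hμ : IsInvariantProb a μ)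
    -- the cylindrical function of level l and its spectral measure
    (ψ : Fin m → ℝ → ℂ) (f : (ℤ → Fin m) × ℝ → ℂ) (hf : IsLipCylindrical a s l ψ f)
    (σ : Measure ℝ) (hσ : IsSpectralMeasure s μ f σ)
    -- the spectral parameter
    (ω : ℝ) (ξ : Fin m → ℝ) (hξ : ∀ b, ∃ k : ℤ, ξ b = ω * levelRoof a s l b + k)
    (z : Fin m → ℂ)
    (hz : ∀ b, z b = ∫ t in (0 : ℝ)..(levelRoof a s l b),
      Complex.exp (-2 * Real.pi * Complex.I * ω * t) * ψ b t) :
    (0 < upperLyapunov (tailSeq a l) ξ z →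
      lowerLocalDim σ ω = 2 - 2 * upperLyapunov (tailSeq a l) ξ z / (lam : EReal)) ∧
    (0 < lam → upperLyapunov (tailSeq a l) ξ z ≤ 0 → 2 ≤ lowerLocalDim σ ω) := by
  have hprob := hμ.prob
  have hσfin := hσ.finite
  have hνfin : IsFiniteMeasure (suspMeasure s μ) := suspMeasure_finite μ
  obtain ⟨x₀⟩ : Nonempty (ℤ → Fin m) := nonempty_of_isProbabilityMeasure μ
  have hm : Nonempty (Fin m) := ⟨x₀ 0⟩
  set r := levelRoof a s l with hrdef
  have hr : ∀ b, 0 < r b := (iter a l).transposeMul_pos hs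
  obtain ⟨ψ', C, hC, hprof, hψψ'⟩ := exists_isProfile hr hf.lipschitz
  have hcyl : CylValue a s l ψ' f := fun y hy t ht => by
    rw [hf.value y hy t ht]; exact (hψψ' _ t ⟨ht.1, ht.2.le⟩).symm
  have sys := hσ.isSpectralSystem hs hμ hC hprof hcyl
  set b := tailSeq a l with hb
  set F := (suspSpace a s).indicator f with hF
  have htile : ∀ᵐ p ∂(suspMeasure s μ), ∀ n, Tiled r ψ' (iter b n) (fun t => F (flow s t p)) := by
    filter_upwards [ae_mem_suspSpace hs hμ.carried] with p hp n
    have h1 := hcyl.tiled hs hp n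
    have h2 : (fun t => F (flow s t p)) = fun t => f (flow s t p) := by
      funext t
      exact Set.indicator_of_mem (flow_mem_suspSpace hs hp t) _
    rw [h2]
    exact h1
  have hν : 0 < (suspMeasure s μ).real Set.univ :=
    ENNReal.toReal_pos (suspMeasure_ne_zero hs μ) (measure_ne_top _ _)
  have hgr : HasGrowthRate b 0 lam := by
    have : tailSeq b 0 = tailSeq a l := by rw [hb, tailSeq_tailSeq, add_zero]
    unfold HasGrowthRate at hA2 ⊢
    rwa [this]
  have hlen := fun ε hε => eventually_length_le hA3 l (ε := ε) hε
  have hinf := fun ε hε => eventually_infix hadm hA1 l (ε := ε) hε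
  have hup : ∀ ε : ℝ, 0 < ε → ∀ᶠ n : ℕ in atTop, ∀ c,
      wlen r ((iter b n).word c) ≤ Real.exp ((lam + ε) * n) := fun ε hε => by
    simp only [wlen_word]
    exact growth_upper hgr hr hε
  have hlow : 0 < lam → ∀ ε : ℝ, 0 < ε → ∀ᶠ n : ℕ in atTop, ∀ c,
      Real.exp ((lam - ε) * n) ≤ wlen r ((iter b n).word c) := fun hlam ε hε =>
    growth_lower hgr hinf hlam hr hε
  have hcoc : ∀ n c, (cocycle b ξ n *ᵥ z) c = wordTotal ω r ψ' ((iter b n).word c) := fun n c =>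
    cocycle_mulVec_eq_wordTotal hprof hC b ω ξ hξ z
      (fun c => by rw [hz, wordTotal_singleton hr hψψ']; rfl) n c
  set χ := upperLyapunov b ξ z with hχ
  -- every exponent `γ` below `2 - 2 χ⁺ / λ` is a lower bound for the dimension
  have hlower : 0 < lam → ∀ γ κ : ℝ, 0 < κ → χ < κ → κ < (2 - γ) / 2 * lam →
      (γ : EReal) ≤ lowerLocalDim σ ω := by
    intro hlam γ κ hκ0 hχκ hκγ
    have h1 : κ / lam < (2 - γ) / 2 := by rwa [div_lt_iff₀ hlam]
    obtain ⟨β, hβ1, hβ2⟩ := exists_between h1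
    have hβ0 : 0 < β := lt_trans (by positivity) hβ1
    have hΦ : ∀ᶠ n : ℕ in atTop, ∀ c,
        ‖wordTotal ω r ψ' ((iter b n).word c)‖ ≤ Real.exp (κ * n) := by
      filter_upwards [eventually_of_upperLyapunov_lt hχκ] with n hn c
      rw [← hcoc]
      exact (norm_le_pi_norm _ c).trans hn
    obtain ⟨D, hD⟩ := eventually_measureReal_ball_le hprof hC sys htile hlen (hlow hlam) ω hκ0 hβ0
      ((div_lt_iff₀ hlam).mp hβ1) hΦ
    exact le_lowerLocalDim (by linarith) hD
  refine ⟨fun hpos => ?_, fun hlam hχ0 => ?_⟩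
  · have hχle : ∀ ε : ℝ, 0 < ε → χ ≤ ((lam + ε : ℝ) : EReal) := by
      intro ε hε
      refine upperLyapunov_le_of_eventually_mul (κ := lam + ε / 2) (D := C) (by linarith) ?_
      filter_upwards [hup (ε / 2) (half_pos hε)] with n hn
      refine (pi_norm_le_iff_of_nonneg (by positivity)).mpr fun c => ?_
      rw [hcoc]
      exact (norm_wordInt_le hprof hC ω _ (wlen_nonneg hr _)).trans (by gcongr; exact hn c)
    obtain ⟨x, hx⟩ : ∃ x : ℝ, χ = x := by
      refine ⟨χ.toReal, (EReal.coe_toReal ?_ ?_).symm⟩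
      · exact ((hχle 1 one_pos).trans_lt (EReal.coe_lt_top _)).ne
      · exact (EReal.bot_lt_zero.trans hpos).ne'
    rw [hx] at hpos hχle hlower ⊢
    have hx0 : 0 < x := by exact_mod_cast hpos
    have hxl : x ≤ lam := le_of_forall_pos_le_add fun ε hε => by exact_mod_cast hχle ε hε
    have hlam : 0 < lam := hx0.trans_le hxl
    have hgoal : (2 : EReal) - 2 * (x : EReal) / (lam : EReal) =
        ((2 - 2 * x / lam : ℝ) : EReal) := by
      rw [EReal.coe_sub, EReal.coe_div, EReal.coe_mul]; rfl
    rw [hgoal]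
    refine le_antisymm ?_ ?_
    · by_contra hcon
      rw [not_le] at hcon
      -- the minimum with `2` makes `α = (2 - γ) / 2` positive, also when the dimension is infinite
      have hlt2 : ((2 - 2 * x / lam : ℝ) : EReal) < min (lowerLocalDim σ ω) ((2 : ℝ) : EReal) := by
        refine lt_min hcon ?_
        have : 0 < 2 * x / lam := by positivity
        exact_mod_cast (by linarith : 2 - 2 * x / lam < 2)
      obtain ⟨γ, hγ1, hγ2⟩ := EReal.lt_iff_exists_real_btwn.mp hlt2
      have hγd : (γ : EReal) < lowerLocalDim σ ω := hγ2.trans_le (min_le_left _ _)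
      have hγlt : γ < 2 := by exact_mod_cast hγ2.trans_le (min_le_right _ _)
      have hγgt : 2 - 2 * x / lam < γ := by exact_mod_cast hγ1
      have hxl' : x / lam ≤ 1 := (div_le_one hlam).mpr hxl
      have hγ0 : 0 ≤ γ := by
        have : 2 * x / lam = 2 * (x / lam) := by ring
        linarith
      obtain ⟨A, hA0, hA⟩ := exists_forall_measure_ball_le hγ0 hγd
      set α := (2 - γ) / 2 with hα
      have hα0 : 0 < α := by rw [hα]; linarith
      have hγα : γ = 2 - 2 * α := by rw [hα]; ring
      rw [hγα] at hA
      obtain ⟨K, hK0, hK⟩ := sys.integral_norm_twist_le ω hα0 hA0 hA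
      have hαx : α * lam < x := by
        rw [← lt_div_iff₀ hlam, hα]
        have : 2 * x / lam = 2 * (x / lam) := by ring
        linarith
      obtain ⟨κ, hκ1, hκ2⟩ := exists_between hαx
      obtain ⟨κ', hκ3, hκ4⟩ := exists_between hκ2
      obtain ⟨D, hD⟩ := eventually_wordTotal_le hν hprof hC sys htile (hlow hlam) hup hinf hlam ω
        hα0 hK0 hK hκ1
      have hle : χ ≤ κ' := by
        refine upperLyapunov_le_of_eventually_mul (κ := κ) (D := D) hκ3 ?_
        filter_upwards [hD] with n hn
        refine (pi_norm_le_iff_of_nonneg ((norm_nonneg _).trans (hn (x₀ 0)))).mpr fun c => ?_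
        rw [hcoc]
        exact hn c
      rw [hx] at hle
      exact absurd (by exact_mod_cast hle : x ≤ κ') (not_le.mpr hκ4)
    · by_contra hcon
      rw [not_le] at hcon
      obtain ⟨γ, hγ1, hγ2⟩ := EReal.lt_iff_exists_real_btwn.mp hcon
      have hγ2' : γ < 2 - 2 * x / lam := by exact_mod_cast hγ2
      have h1 : x < (2 - γ) / 2 * lam := by
        rw [← div_lt_iff₀ hlam]
        have : 2 * x / lam = 2 * (x / lam) := by ring
        linarith
      obtain ⟨κ, hκ1, hκ2⟩ := exists_between h1
      exact absurd hγ1 (not_lt.mpr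
        (hlower hlam γ κ (hx0.trans hκ1) (by exact_mod_cast hκ1) hκ2))
  · by_contra hcon
    rw [not_le] at hcon
    obtain ⟨γ, hγ1, hγ2⟩ := EReal.lt_iff_exists_real_btwn.mp hcon
    have hγ2' : γ < 2 := EReal.coe_lt_coe_iff.mp (show (γ : EReal) < ((2 : ℝ) : EReal) from hγ2)
    have h1 : 0 < (2 - γ) / 2 * lam := mul_pos (by linarith) hlam
    obtain ⟨κ, hκ1, hκ2⟩ := exists_between h1
    exact absurd hγ1 (not_lt.mpr
      (hlower hlam γ κ hκ1 (hχ0.trans_lt (by exact_mod_cast hκ1)) hκ2))
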